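/- Let $N\ge 1$ and $m\ge 2$, and let $T_1,\dots,T_m$ be non-singular linear maps on $\mathbb R^N$ with $\|T_i\|<1$ for all $i$. For a finite word $\mathbf i=(i_1,\dots,i_k)$ over $\{1,\dots,m\}$ write $|\mathbf i|=k$ and $T_{\mathbf i}=T_{i_1}\cdots T_{i_k}$. For a linear map $T$ with singular values $\alpha_1\ge\dots\ge\alpha_N$ let $\phi^s(T)=\alpha_1\cdots\alpha_{j-1}\alpha_j^{\,s-j+1}$ if $0<s\le N$, where $j$ is the integer with $j-1<s\le j$, and $\phi^s(T)=(\alpha_1\cdots\alpha_N)^{s/N}$ if $s>N$. Let $p_1,\dots,p_m>0$ with $\sum_i p_i=1$, and let $\mu$ be the Bernoulli measure on $I_\infty=\{1,\dots,m\}^{\mathbb N}$, that is, the Borel measure giving the cylinder $C_{\mathbf i}$ of all infinite words starting with $\mathbf i=(i_1,\dots,i_k)$ the mass $p_{\mathbf i}=p_{i_1}\cdots p_{i_k}$. Let $\omega=\{\omega_{\mathbf i}\}$, indexed by all finite words $\mathbf i$, be a family of independent identically distributed random vectors with values in a bounded subset of $\mathbb R^N$, whose common distribution is absolutely continuous with respect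 to $N$-dimensional Lebesgue measure. Let $$\Pi^\omega(i_1,i_2,\dots)=\omega_{i_1}+T_{i_1}\omega_{i_1,i_2}+T_{i_1}T_{i_2}\omega_{i_1,i_2,i_3}+\cdots,$$ and let $\mu^\omega$ be the image of $\mu$ under $\Pi^\omega$. For a finite Borel measure $\tau$ of bounded support on $\mathbb R^N$ and $q>1$ let $\underline D_q(\tau)$ and $\overline D_q(\tau)$ be the lower and upper limits, as $r\to0^+$, of $\dfrac{\log\sum_C\tau(C)^q}{(q-1)\log r}$, where the sum is over the cubes $C=\prod_{l=1}^N[j_lr,(j_l+1)r)$, $j_l\in\mathbb Z$, with $\tau(C)>0$; if they agree, their common value is $D_q(\tau)$. Then for every $q>1$ there is a unique positive number $d_q$ with $$\lim_{k\to\infty}\Big(\sum_{|\mathbf i|=k}\phi^{d_q}(T_{\mathbf i})^{1-q}\,p_{\mathbf i}^{\,q}\Big)^{1/k}=1,$$ and, almost surely, for all $q>1$ simultaneously, $D_q(\mu^\omega)$ exists and $$D_q(\mu^\omega)=\underline D_q(\mu^\omega)=\overline D_q(\mu^\omega)=\min\{d_q,N\}.$$ -/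

import Mathlib

open MeasureTheory Filter Topology

noncomputable section

namespace AlmostSelfAffine

/-- Euclidean space `ℝ^N`. -/
abbrev E (N : ℕ) : Type := EuclideanSpace ℝ (Fin N)

/-- The singular value function `φ^s(T)`. With singular values `α₁ ≥ α₂ ≥ … ≥ α_N`, it is
`α₁ ⋯ α_{j-1} α_j^{s-j+1}` for `0 ≤ s ≤ N`, where `j - 1 < s ≤ j`, that is `j = ⌈s⌉`, and
`(α₁ ⋯ α_N)^{s/N}` for `s > N`. Mathlib numbers singular values from `0`, so that
`α_j` is `singularValues (j - 1)`. For `s = 0` the value is `1`. -/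
def singularValueFunction {N : ℕ} (s : ℝ) (T : E N →L[ℝ] E N) : ℝ :=
  let α : ℕ → ℝ := (T : E N →ₗ[ℝ] E N).singularValues
  if s ≤ N then
    (∏ i ∈ Finset.range (⌈s⌉₊ - 1), α i) * α (⌈s⌉₊ - 1) ^ (s - ((⌈s⌉₊ - 1 : ℕ) : ℝ))
  else
    (∏ i ∈ Finset.range N, α i) ^ (s / N)

/-- The composition `T_{i₁} T_{i₂} ⋯ T_{i_k}` along a finite word; the identity for the empty
word. -/
def wordMap {N m : ℕ} (T : Fin m → E N →L[ℝ] E N) (w : List (Fin m)) : E N →L[ℝ] E N :=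
  (w.map T).prod

/-- The curtailment `𝐢|_k = (i₁, …, i_k)` of an infinite word. -/
def curtail {m : ℕ} (i : ℕ → Fin m) (k : ℕ) : List (Fin m) :=
  List.ofFn fun j : Fin k => i j

/-- The cylinder `C_𝐰` of the infinite words that start with the finite word `𝐰`. -/
def cylinder {m k : ℕ} (w : Fin k → Fin m) : Set (ℕ → Fin m) :=
  {i | ∀ j : Fin k, i j = w j}

/-- The Bernoulli measure on the code space with weights `p`: the law of a sequence of independent
letters, each distributed according to `p`. -/
def bernoulliMeasure {m : ℕ} (p : PMF (Fin m)) : Measure (ℕ → Fin m) :=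
  Measure.infinitePi fun _ : ℕ => p.toMeasure

/-- The law of the family `ω = (ω_𝐢)` of displacements, indexed by all finite words, which are
independent and identically distributed with law `ν`. -/
def displacementLaw (m : ℕ) {N : ℕ} (ν : Measure (E N)) [IsProbabilityMeasure ν] :
    Measure (List (Fin m) → E N) :=
  Measure.infinitePi fun _ : List (Fin m) => ν

/-- The projection `Π^ω(𝐢) = ω_{i₁} + T_{i₁} ω_{i₁ i₂} + T_{i₁} T_{i₂} ω_{i₁ i₂ i₃} + ⋯`. -/
def projection {N m : ℕ} (T : Fin m → E N →L[ℝ] E N) (ω : List (Fin m) → E N)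
    (i : ℕ → Fin m) : E N :=
  ∑' k : ℕ, wordMap T (curtail i k) (ω (curtail i (k + 1)))

/-- The image `μ^ω` of a measure `μ` on the code space under the projection `Π^ω`. -/
def projectedMeasure {N m : ℕ} (T : Fin m → E N →L[ℝ] E N) (μ : Measure (ℕ → Fin m))
    (ω : List (Fin m) → E N) : Measure (E N) :=
  μ.map (projection T ω)

/-- The half-open `r`-mesh cube `[j₁ r, (j₁ + 1) r) × ⋯ × [j_N r, (j_N + 1) r)`. -/
def meshCube {N : ℕ} (r : ℝ) (j : Fin N → ℤ) : Set (E N) :=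
  {x | ∀ l, x l ∈ Set.Ico (j l * r) ((j l + 1) * r)}

/-- The moment sum `M_r(q) = ∑ τ(C)^q` over the `r`-mesh cubes `C`. Cubes of measure zero
contribute nothing when `q > 0`. -/
def momentSum {N : ℕ} (τ : Measure (E N)) (q r : ℝ) : ℝ :=
  ∑' j : Fin N → ℤ, τ.real (meshCube r j) ^ q

/-- The lower generalised `q`-dimension, the lower limit of `log M_r(q) / ((q - 1) log r)`
as `r → 0+`. -/
def lowerDim {N : ℕ} (q : ℝ) (τ : Measure (E N)) : EReal :=
  liminf (fun r : ℝ => ((Real.log (momentSum τ q r) / ((q - 1) * Real.log r) : ℝ) : EReal))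
    (𝓝[>] 0)

/-- The upper generalised `q`-dimension, the upper limit of `log M_r(q) / ((q - 1) log r)`
as `r → 0+`. -/
def upperDim {N : ℕ} (q : ℝ) (τ : Measure (E N)) : EReal :=
  limsup (fun r : ℝ => ((Real.log (momentSum τ q r) / ((q - 1) * Real.log r) : ℝ) : EReal))
    (𝓝[>] 0)

/-- The sum `∑_{|𝐢| = k} φ^s(T_𝐢)^{1-q} μ(C_𝐢)^q` over the words of length `k`. -/
def levelSum {N m : ℕ} (T : Fin m → E N →L[ℝ] E N) (μ : Measure (ℕ → Fin m)) (q s : ℝ)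
    (k : ℕ) : ℝ :=
  ∑ w : Fin k → Fin m,
    singularValueFunction s (wordMap T (List.ofFn w)) ^ (1 - q) * μ.real (cylinder w) ^ q

/-- The equation `lim_k (∑_{|𝐢| = k} φ^s(T_𝐢)^{1-q} μ(C_𝐢)^q)^{1/k} = 1`, together with `s > 0`,
which determines `s = d_q(T₁, …, T_m; μ)`. -/
def IsCriticalExponent {N m : ℕ} (T : Fin m → E N →L[ℝ] E N) (μ : Measure (ℕ → Fin m))
    (q s : ℝ) : Prop :=
  0 < s ∧ Tendsto (fun k : ℕ => levelSum T μ q s k ^ (1 / (k : ℝ))) atTop (𝓝 1)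

end AlmostSelfAffine

end

/-! Let P(q,s) be the limit of (1/k) log of the level sums (`pressure`). As φ^s is submultiplicative
and 1 - q < 0, the level sums are supermultiplicative, so the limit exists by Fekete's lemma.
Comparing φ^{s+h} with φ^s shows that P(q,·) is Lipschitz and strictly increasing, and its unique
zero is d_q (`isCriticalExponent_iff`, `exists_pressure_eq_zero`).

Upper bound for the dimension, valid for every bounded family ω. If α_⌈s⌉(T_u) is comparable to r,
the image of the cylinder u meets at most a constant times φ^s(T_u) r^{-s} mesh cubes, so by Hölder
it contributes at least a constant times r^{s(q-1)} φ^s(T_u)^{1-q} p_u^q to the moment sum. If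
P(q,s) > 0, some level k has level sum at least 1; extending words by blocks of length k until α_⌈s⌉
drops to r then keeps the total of these terms at least 1 (`mul_wordTerm_le_cylinderMoment`). The
cap N comes from counting cubes that meet a bounded set.

Lower bound, almost surely. With x = q - 1, the expectation of ∫ μ{j : ‖A(Πi - Πj)‖ ≤ r}^x dμ(i) is
estimated for all injective A at once, because removing the first letter a replaces A by A T_a.
Words with a common first letter reproduce the same quantity at A T_a. Words with different first
letters involve independent displacements, so the centre may be frozen, which leads to a
concentration moment. There the absolutely continuous root displacement averages over translates and
trades one power of the mass for the volume r^s/φ^s(A), leaving a correlation moment of order x - 1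
(`corrMoment_le`, `concMoment_le`).

The recursions are solved by comparison with `potential`, the sum of θ^k L^k(φ^s(·)^{-x}) for the
transfer operator L and some θ > 1 (`le_of_recursive`, `exists_corrMoment_le`). At the identity the
iterates are exactly the level sums, so the potential is finite there for suitable θ > 1 once P(q,s)
< 0. Summation over dyadic scales gives an almost sure bound, and rational parameters make it hold
for all q simultaneously (`ae_forall_localMoment_le`). -/

open scoped ENNReal

namespace AlmostSelfAffine

/-! ### Singular values under restriction and composition. -/

section SingularValues

open Module InnerProductSpace

variable {U V W : Type*} [NormedAddCommGroup U] [InnerProductSpace ℝ U] [FiniteDimensional ℝ U]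
  [NormedAddCommGroup V] [InnerProductSpace ℝ V] [FiniteDimensional ℝ V]
  [NormedAddCommGroup W] [InnerProductSpace ℝ W] [FiniteDimensional ℝ W]

/-- An orthonormal basis of right singular vectors. -/
theorem exists_singularBasis (f : U →ₗ[ℝ] V) {n : ℕ} (hn : finrank ℝ U = n) :
    ∃ e : OrthonormalBasis (Fin n) ℝ U, ∀ i j : Fin n,
      ⟪f (e i), f (e j)⟫_ℝ = if i = j then f.singularValues i ^ 2 else 0 := by
  refine ⟨f.isSymmetric_adjoint_comp_self.eigenvectorBasis hn, fun i j => ?_⟩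
  rw [← LinearMap.adjoint_inner_left, ← LinearMap.comp_apply,
    LinearMap.IsSymmetric.apply_eigenvectorBasis, f.sq_singularValues_fin hn]
  simp only [RCLike.ofReal_real_eq_id, id_eq, inner_smul_left, conj_trivial]
  rw [OrthonormalBasis.inner_eq_ite]
  split_ifs <;> simp

theorem norm_sq_apply_eq_sum {f : U →ₗ[ℝ] V} {n : ℕ} {e : OrthonormalBasis (Fin n) ℝ U}
    (he : ∀ i j : Fin n, ⟪f (e i), f (e j)⟫_ℝ = if i = j then f.singularValues i ^ 2 else 0)
    (x : U) : ‖f x‖ ^ 2 = ∑ i : Fin n, f.singularValues i ^ 2 * ⟪e i, x⟫_ℝ ^ 2 := by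
  have hx : f x = ∑ i, ⟪e i, x⟫_ℝ • f (e i) := by
    conv_lhs => rw [← e.sum_repr' x]
    simp
  rw [← real_inner_self_eq_norm_sq, hx, sum_inner]
  refine Finset.sum_congr rfl fun i _ => ?_
  rw [inner_sum, Finset.sum_eq_single i]
  · rw [inner_smul_left, inner_smul_right, he]
    simp
    ring
  · intro j _ hj
    rw [inner_smul_left, inner_smul_right, he]
    simp [hj.symm]
  · simp

/-- Restricting to a subspace does not increase singular values. -/
theorem singularValues_domRestrict_le (f : V →ₗ[ℝ] W) (S : Submodule ℝ V) (i : ℕ)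
    (hi : i < finrank ℝ S) : (f.domRestrict S).singularValues i ≤ f.singularValues i := by
  obtain ⟨a, ha⟩ := exists_singularBasis (f.domRestrict S) rfl
  obtain ⟨e, he⟩ := exists_singularBasis f rfl
  have hSV : finrank ℝ S ≤ finrank ℝ V := S.finrank_le
  -- These dim S - 1 conditions kill the singular directions of `f` before the `i`-th and those of
  -- the restriction after the `i`-th. Some nonzero `x` in `S` satisfies them all, and on it `‖f x‖
  -- / ‖x‖` lies between the two singular values to be compared.
  let M : S →ₗ[ℝ] (Fin (finrank ℝ S - 1) → ℝ) := LinearMap.pi fun k =>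
    if k.1 < i then (innerₗ V (e ⟨k.1, by omega⟩)) ∘ₗ S.subtype
      else innerₗ S (a ⟨k.1 + 1, by omega⟩)
  have hker : LinearMap.ker M ≠ ⊥ := LinearMap.ker_ne_bot_of_finrank_lt (by
    rw [finrank_fin_fun]; omega)
  obtain ⟨x, hx, hx0⟩ := Submodule.exists_mem_ne_zero_of_ne_bot hker
  have hM : ∀ k, M x k = 0 := fun k => by rw [LinearMap.mem_ker.1 hx]; rfl
  have he0 : ∀ k : Fin (finrank ℝ V), k.1 < i → ⟪e k, (x : V)⟫_ℝ = 0 := fun k hk => by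
    have := hM ⟨k.1, by omega⟩
    simpa [M, hk] using this
  have ha0 : ∀ k : Fin (finrank ℝ S), i < k.1 → ⟪a k, x⟫_ℝ = 0 := fun k hk => by
    have := hM ⟨k.1 - 1, by omega⟩
    have h2 : ¬ (k.1 - 1 < i) := by omega
    have h3 : k.1 - 1 + 1 = k.1 := by omega
    simpa [M, h2, h3] using this
  have h1 : (f.domRestrict S).singularValues i ^ 2 * ‖x‖ ^ 2 ≤ ‖f x‖ ^ 2 := by
    have := norm_sq_apply_eq_sum ha x
    rw [LinearMap.domRestrict_apply] at this
    rw [this, ← a.sum_sq_inner_right x, Finset.mul_sum]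
    refine Finset.sum_le_sum fun k _ => ?_
    by_cases hk : i < k.1
    · simp [ha0 k hk]
    · gcongr
      · exact LinearMap.singularValues_nonneg _ _
      · exact LinearMap.singularValues_antitone _ (not_lt.1 hk)
  have h2 : ‖f x‖ ^ 2 ≤ f.singularValues i ^ 2 * ‖x‖ ^ 2 := by
    have hn : ‖x‖ = ‖(x : V)‖ := rfl
    rw [hn, norm_sq_apply_eq_sum he (x : V), ← e.sum_sq_inner_right (x : V), Finset.mul_sum]
    refine Finset.sum_le_sum fun k _ => ?_
    by_cases hk : k.1 < i
    · simp [he0 k hk]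
    · gcongr
      · exact LinearMap.singularValues_nonneg _ _
      · exact LinearMap.singularValues_antitone _ (not_lt.1 hk)
  have hxpos : 0 < ‖x‖ ^ 2 := by positivity
  exact le_of_sq_le_sq (le_of_mul_le_mul_right (h1.trans h2) hxpos)
    (LinearMap.singularValues_nonneg _ _)

theorem normDet_domRestrict_le (f : V →ₗ[ℝ] W) (S : Submodule ℝ V) :
    (f.domRestrict S).normDet ≤ ∏ i ∈ Finset.range (finrank ℝ S), f.singularValues i := by
  rw [LinearMap.normDet_eq_prod_singularValues]
  exact Finset.prod_le_prod (fun i _ => LinearMap.singularValues_nonneg _ _)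
    fun i hi => singularValues_domRestrict_le f S i (Finset.mem_range.1 hi)

/-- The isometry sends the standard basis to the first `j` right singular vectors, whose images have
a diagonal Gram matrix. The bound of `normDet_domRestrict_le` is therefore attained. -/
theorem exists_isometry_normDet_comp (f : V →ₗ[ℝ] W) {j : ℕ} (hj : j ≤ finrank ℝ V) :
    ∃ g : EuclideanSpace ℝ (Fin j) →ₗᵢ[ℝ] V,
      (f ∘ₗ g.toLinearMap).normDet = ∏ i ∈ Finset.range j, f.singularValues i := by
  obtain ⟨e, he⟩ := exists_singularBasis f rfl
  let b := EuclideanSpace.basisFun (Fin j) ℝ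
  let v : Fin j → V := fun i => e (Fin.castLE hj i)
  have hv : Orthonormal ℝ v := e.orthonormal.comp _ (Fin.castLE_injective hj)
  let g0 : EuclideanSpace ℝ (Fin j) →ₗ[ℝ] V := b.toBasis.constr ℝ v
  have hg0 : ∀ i, g0 (b i) = v i := fun i => by
    have := b.toBasis.constr_basis ℝ v i
    rwa [b.coe_toBasis] at this
  have hO : Orthonormal ℝ (g0 ∘ b.toBasis) := by
    have : g0 ∘ b.toBasis = v := by ext1 i; simpa using hg0 i
    rwa [this]
  let g : EuclideanSpace ℝ (Fin j) →ₗᵢ[ℝ] V :=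
    g0.isometryOfOrthonormal (v := b.toBasis) (by simp) hO
  refine ⟨g, ?_⟩
  have hgb : ∀ i, g.toLinearMap (b i) = v i := hg0
  have h := (f ∘ₗ g.toLinearMap).normDet_sq_eq_det_gram b
  have hgram : Matrix.gram ℝ (fun i => (f ∘ₗ g.toLinearMap) (b i)) =
      Matrix.diagonal fun i : Fin j => f.singularValues i ^ 2 := by
    ext i k
    rw [Matrix.gram_apply, LinearMap.comp_apply, LinearMap.comp_apply, hgb, hgb, he,
      Matrix.diagonal_apply]
    simp
  rw [hgram, Matrix.det_diagonal, Finset.prod_pow,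
    Fin.prod_univ_eq_prod_range (fun i => f.singularValues i) j] at h
  exact (sq_eq_sq₀ (LinearMap.normDet_nonneg _)
    (Finset.prod_nonneg fun i _ => f.singularValues_nonneg i)).1 h

/-- The product of the largest `j` singular values is submultiplicative. -/
theorem prod_singularValues_comp_le (f : U →ₗ[ℝ] V) (g : V →ₗ[ℝ] W) (hf : Function.Injective f)
    {j : ℕ} (hj : j ≤ finrank ℝ U) :
    ∏ i ∈ Finset.range j, (g ∘ₗ f).singularValues i ≤
      (∏ i ∈ Finset.range j, g.singularValues i) * ∏ i ∈ Finset.range j, f.singularValues i := by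
  -- The left side is the factor by which `g ∘ₗ f` scales `j`-volume on one subspace. It is the
  -- product of the factor of `f` there and that of `g` on the image, which still has dimension `j`
  -- by injectivity.
  obtain ⟨ι, hι⟩ := exists_isometry_normDet_comp (g ∘ₗ f) hj
  have hdim1 : finrank ℝ (LinearMap.range (f ∘ₗ ι.toLinearMap)) = j := by
    rw [LinearMap.finrank_range_of_inj]
    · simp
    · exact hf.comp ι.injective
  have hdim2 : finrank ℝ (LinearMap.range ι.toLinearMap) = j := by
    rw [LinearMap.finrank_range_of_inj ι.injective]
    simp
  have h1 := normDet_domRestrict_le g (LinearMap.range (f ∘ₗ ι.toLinearMap))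
  have h2 := normDet_domRestrict_le f (LinearMap.range ι.toLinearMap)
  rw [hdim1] at h1
  rw [hdim2] at h2
  rw [← hι, LinearMap.comp_assoc, LinearMap.normDet_comp,
    LinearMap.normDet_comp ι.toLinearMap f, LinearIsometry.normDet_eq_one, mul_one]
  exact mul_le_mul h1 h2 (LinearMap.normDet_nonneg _)
    (Finset.prod_nonneg fun i _ => g.singularValues_nonneg i)

end SingularValues

/-! ### The singular value function: dependence on `s` and submultiplicativity. -/

section SingularValueFunction

open Module InnerProductSpace

variable {N : ℕ}

/-- The singular values of a continuous linear map, numbered from `0`. -/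
noncomputable abbrev sv (A : E N →L[ℝ] E N) (i : ℕ) : ℝ := (A : E N →ₗ[ℝ] E N).singularValues i

theorem sv_nonneg (A : E N →L[ℝ] E N) (i : ℕ) : 0 ≤ sv A i := LinearMap.singularValues_nonneg _ _

theorem sv_antitone (A : E N →L[ℝ] E N) : Antitone (sv A) := LinearMap.singularValues_antitone _

theorem sv_pos {A : E N →L[ℝ] E N} (hA : Function.Injective A) {i : ℕ} (hi : i < N) :
    0 < sv A i :=
  (LinearMap.injective_iff_forall_lt_finrank_singularValues_pos (A : E N →ₗ[ℝ] E N)).1 hA i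
    (by simpa using hi)

theorem exists_basis_sv (A : E N →L[ℝ] E N) :
    ∃ e : OrthonormalBasis (Fin N) ℝ (E N), ∀ i j : Fin N,
      ⟪A (e i), A (e j)⟫_ℝ = if i = j then sv A i ^ 2 else 0 :=
  exists_singularBasis (A : E N →ₗ[ℝ] E N) (by simp)

theorem exists_unit_norm_apply_eq_sv (A : E N →L[ℝ] E N) {i : ℕ} (hi : i < N) :
    ∃ x, ‖x‖ = 1 ∧ ‖A x‖ = sv A i := by
  obtain ⟨e, he⟩ := exists_basis_sv A
  refine ⟨e ⟨i, hi⟩, e.orthonormal.1 _, ?_⟩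
  have := he ⟨i, hi⟩ ⟨i, hi⟩
  rw [real_inner_self_eq_norm_sq, if_pos rfl] at this
  exact (sq_eq_sq₀ (norm_nonneg _) (sv_nonneg _ _)).1 this

theorem sv_le_norm (A : E N →L[ℝ] E N) (i : ℕ) : sv A i ≤ ‖A‖ := by
  by_cases hi : i < N
  · obtain ⟨x, hx, hAx⟩ := exists_unit_norm_apply_eq_sv A hi
    rw [← hAx]
    simpa [hx] using A.le_opNorm x
  · rw [sv, LinearMap.singularValues_of_finrank_le _ (by simpa using hi)]
    exact norm_nonneg _

theorem le_sv {A : E N →L[ℝ] E N} {c : ℝ} (hc : ∀ x, c * ‖x‖ ≤ ‖A x‖) {i : ℕ} (hi : i < N) :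
    c ≤ sv A i := by
  obtain ⟨x, hx, hAx⟩ := exists_unit_norm_apply_eq_sv A hi
  simpa [hx, hAx] using hc x

theorem sv_one {i : ℕ} (hi : i < N) : sv (1 : E N →L[ℝ] E N) i = 1 :=
  le_antisymm ((sv_le_norm _ _).trans ContinuousLinearMap.norm_id_le)
    (le_sv (fun x => by simp) hi)

/-- The exponents for which `φ^s(A) = ∏ α_i ^ (e_i(s))`. -/
noncomputable def svExp (N : ℕ) (s : ℝ) (i : ℕ) : ℝ :=
  if s ≤ N then max 0 (min 1 (s - i)) else s / N

theorem svExp_nonneg {s : ℝ} (hs : 0 < s) (i : ℕ) : 0 ≤ svExp N s i := by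
  unfold svExp
  split_ifs
  · exact le_max_left _ _
  · positivity

theorem svExp_le_one {s : ℝ} (hs : s ≤ N) (i : ℕ) : svExp N s i ≤ 1 := by
  rw [svExp, if_pos hs]
  exact max_le zero_le_one (min_le_left _ _)

theorem svExp_mono {i : ℕ} (hi : i < N) : Monotone fun s => svExp N s i := by
  have hN : (0 : ℝ) < N := by exact_mod_cast (Nat.zero_le i).trans_lt hi
  intro s t hst
  simp only [svExp]
  split_ifs with h1 h2 h2
  · gcongr
  · refine max_le ?_ ((min_le_left _ _).trans ?_)
    · exact div_nonneg (hN.le.trans (not_le.1 h2).le) hN.le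
    · rw [one_le_div hN]
      exact (not_le.1 h2).le
  · exact absurd (hst.trans h2) h1
  · gcongr

theorem sum_svExp_mul {s : ℝ} (hs : 0 < s) (hsN : s ≤ N) (f : ℕ → ℝ) :
    ∑ i ∈ Finset.range N, svExp N s i * f i =
      (∑ i ∈ Finset.range (⌈s⌉₊ - 1), f i) + (s - ((⌈s⌉₊ - 1 : ℕ) : ℝ)) * f (⌈s⌉₊ - 1) := by
  have hj : 1 ≤ ⌈s⌉₊ := Nat.one_le_ceil_iff.2 hs
  have hjN : ⌈s⌉₊ ≤ N := Nat.ceil_le.2 hsN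
  obtain ⟨k, hk⟩ : ∃ k, ⌈s⌉₊ = k + 1 := ⟨⌈s⌉₊ - 1, by omega⟩
  have h1 : (k : ℝ) < s := by
    have := Nat.lt_ceil (a := s) (n := k)
    exact this.1 (by omega)
  have h2 : s ≤ k + 1 := by
    have := Nat.le_ceil s
    rw [hk] at this
    exact_mod_cast this
  rw [hk, Nat.add_sub_cancel, ← Finset.sum_range_add_sum_Ico _ (hk ▸ hjN : k + 1 ≤ N),
    Finset.sum_range_succ]
  have hz : ∑ i ∈ Finset.Ico (k + 1) N, svExp N s i * f i = 0 := by
    refine Finset.sum_eq_zero fun i hi => ?_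
    have : (k : ℝ) + 1 ≤ i := by exact_mod_cast (Finset.mem_Ico.1 hi).1
    rw [svExp, if_pos hsN, max_eq_left ((min_le_right _ _).trans (by linarith)), zero_mul]
  rw [hz, add_zero]
  congr 1
  · refine Finset.sum_congr rfl fun i hi => ?_
    have : (i : ℝ) + 1 ≤ k := by exact_mod_cast Finset.mem_range.1 hi
    rw [svExp, if_pos hsN, min_eq_left (by linarith), max_eq_right zero_le_one, one_mul]
  · rw [svExp, if_pos hsN, min_eq_right (by linarith), max_eq_right (by linarith)]

/-- The exponents have total `s`; this turns uniform bounds on singular values into powers with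
exponent `s`. -/
theorem sum_svExp (hN : 1 ≤ N) {s : ℝ} (hs : 0 < s) :
    ∑ i ∈ Finset.range N, svExp N s i = s := by
  by_cases hsN : s ≤ N
  · have := sum_svExp_mul hs hsN (fun _ => 1)
    simpa using this
  · have h0 : (N : ℝ) ≠ 0 := by positivity
    simp only [svExp, if_neg hsN, Finset.sum_const, Finset.card_range, nsmul_eq_mul]
    field_simp

theorem svf_pos {A : E N →L[ℝ] E N} (hA : Function.Injective A) {s : ℝ} (hs : 0 < s) :
    0 < singularValueFunction s A := by
  unfold singularValueFunction
  dsimp only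
  split_ifs with h
  · have hj : 1 ≤ ⌈s⌉₊ := Nat.one_le_ceil_iff.2 hs
    have hjN : ⌈s⌉₊ ≤ N := Nat.ceil_le.2 h
    refine mul_pos (Finset.prod_pos fun i hi => sv_pos hA ?_)
      (Real.rpow_pos_of_pos (sv_pos hA ?_) _)
    · have := Finset.mem_range.1 hi
      omega
    · omega
  · exact Real.rpow_pos_of_pos (Finset.prod_pos fun i hi => sv_pos hA (Finset.mem_range.1 hi)) _

theorem log_svf {A : E N →L[ℝ] E N} (hA : Function.Injective A) {s : ℝ} (hs : 0 < s) :
    Real.log (singularValueFunction s A) =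
      ∑ i ∈ Finset.range N, svExp N s i * Real.log (sv A i) := by
  unfold singularValueFunction
  dsimp only
  split_ifs with h
  · have hj : 1 ≤ ⌈s⌉₊ := Nat.one_le_ceil_iff.2 hs
    have hjN : ⌈s⌉₊ ≤ N := Nat.ceil_le.2 h
    have h1 : ∀ i ∈ Finset.range (⌈s⌉₊ - 1), 0 < sv A i := fun i hi => sv_pos hA (by
      have := Finset.mem_range.1 hi
      omega)
    have h2 : 0 < sv A (⌈s⌉₊ - 1) := sv_pos hA (by omega)
    rw [sum_svExp_mul hs h, Real.log_mul (Finset.prod_pos h1).ne' (Real.rpow_pos_of_pos h2 _).ne',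
      Real.log_prod fun i hi => (h1 i hi).ne', Real.log_rpow h2]
  · have h1 : ∀ i ∈ Finset.range N, 0 < sv A i := fun i hi => sv_pos hA (Finset.mem_range.1 hi)
    rw [Real.log_rpow (Finset.prod_pos h1), Real.log_prod fun i hi => (h1 i hi).ne',
      Finset.mul_sum]
    simp only [svExp, if_neg h]

theorem svf_eq_prod {A : E N →L[ℝ] E N} (hA : Function.Injective A) {s : ℝ} (hs : 0 < s) :
    singularValueFunction s A = ∏ i ∈ Finset.range N, sv A i ^ svExp N s i := by
  rw [← Real.exp_log (svf_pos hA hs), log_svf hA hs, Real.exp_sum]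
  refine Finset.prod_congr rfl fun i hi => ?_
  rw [Real.rpow_def_of_pos (sv_pos hA (Finset.mem_range.1 hi)), mul_comm]

theorem svf_one {s : ℝ} (hs : 0 < s) : singularValueFunction s (1 : E N →L[ℝ] E N) = 1 := by
  rw [svf_eq_prod (fun x y h => h) hs]
  refine Finset.prod_eq_one fun i hi => ?_
  rw [sv_one (Finset.mem_range.1 hi), Real.one_rpow]

/-- Passing from `s` to `s + h` raises each exponent by a nonnegative amount, `h` in total, and
every singular value is at most `a`. The reverse estimate `le_svf_add` is the same with a lower
bound. -/
theorem svf_add_le (hN : 1 ≤ N) {A : E N →L[ℝ] E N} (hA : Function.Injective A) {s h a : ℝ}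
    (hs : 0 < s) (hh : 0 ≤ h) (ha : ‖A‖ ≤ a) :
    singularValueFunction (s + h) A ≤ singularValueFunction s A * a ^ h := by
  have ha0 : 0 < a := (sv_pos hA hN).trans_le ((sv_le_norm A 0).trans ha)
  rw [← Real.log_le_log_iff (svf_pos hA (by linarith))
    (mul_pos (svf_pos hA hs) (Real.rpow_pos_of_pos ha0 _)),
    Real.log_mul (svf_pos hA hs).ne' (Real.rpow_pos_of_pos ha0 _).ne', Real.log_rpow ha0,
    log_svf hA hs, log_svf hA (by linarith)]
  have e : h * Real.log a = ∑ i ∈ Finset.range N, (svExp N (s + h) i - svExp N s i) * Real.log a := by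
    rw [← Finset.sum_mul, Finset.sum_sub_distrib, sum_svExp hN hs, sum_svExp hN (by linarith)]
    ring
  rw [e, ← Finset.sum_add_distrib]
  refine Finset.sum_le_sum fun i hi => ?_
  have h1 : svExp N s i ≤ svExp N (s + h) i :=
    svExp_mono (Finset.mem_range.1 hi) (by linarith)
  have h2 : Real.log (sv A i) ≤ Real.log a :=
    Real.log_le_log (sv_pos hA (Finset.mem_range.1 hi)) ((sv_le_norm A i).trans ha)
  nlinarith

theorem le_svf_add (hN : 1 ≤ N) {A : E N →L[ℝ] E N} (hA : Function.Injective A) {s h c : ℝ}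
    (hs : 0 < s) (hh : 0 ≤ h) (hc0 : 0 < c) (hc : ∀ x, c * ‖x‖ ≤ ‖A x‖) :
    singularValueFunction s A * c ^ h ≤ singularValueFunction (s + h) A := by
  rw [← Real.log_le_log_iff (mul_pos (svf_pos hA hs) (Real.rpow_pos_of_pos hc0 _))
    (svf_pos hA (by linarith)),
    Real.log_mul (svf_pos hA hs).ne' (Real.rpow_pos_of_pos hc0 _).ne', Real.log_rpow hc0,
    log_svf hA hs, log_svf hA (by linarith)]
  have e : h * Real.log c = ∑ i ∈ Finset.range N, (svExp N (s + h) i - svExp N s i) * Real.log c := by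
    rw [← Finset.sum_mul, Finset.sum_sub_distrib, sum_svExp hN hs, sum_svExp hN (by linarith)]
    ring
  rw [e, ← Finset.sum_add_distrib]
  refine Finset.sum_le_sum fun i hi => ?_
  have h1 : svExp N s i ≤ svExp N (s + h) i :=
    svExp_mono (Finset.mem_range.1 hi) (by linarith)
  have h2 : Real.log c ≤ Real.log (sv A i) :=
    Real.log_le_log hc0 (le_sv hc (Finset.mem_range.1 hi))
  nlinarith

theorem svf_le (hN : 1 ≤ N) {A : E N →L[ℝ] E N} (hA : Function.Injective A) {s a : ℝ}
    (hs : 0 < s) (ha : ‖A‖ ≤ a) : singularValueFunction s A ≤ a ^ s := by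
  have ha0 : 0 < a := (sv_pos hA hN).trans_le ((sv_le_norm A 0).trans ha)
  rw [← Real.log_le_log_iff (svf_pos hA hs) (Real.rpow_pos_of_pos ha0 _), Real.log_rpow ha0,
    log_svf hA hs]
  nth_rw 2 [← sum_svExp hN hs]
  rw [Finset.sum_mul]
  refine Finset.sum_le_sum fun i hi => mul_le_mul_of_nonneg_left ?_ (svExp_nonneg hs i)
  exact Real.log_le_log (sv_pos hA (Finset.mem_range.1 hi)) ((sv_le_norm A i).trans ha)

theorem le_svf (hN : 1 ≤ N) {A : E N →L[ℝ] E N} (hA : Function.Injective A) {s c : ℝ}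
    (hs : 0 < s) (hc0 : 0 < c) (hc : ∀ x, c * ‖x‖ ≤ ‖A x‖) : c ^ s ≤ singularValueFunction s A := by
  rw [← Real.log_le_log_iff (Real.rpow_pos_of_pos hc0 _) (svf_pos hA hs), Real.log_rpow hc0,
    log_svf hA hs]
  nth_rw 1 [← sum_svExp hN hs]
  rw [Finset.sum_mul]
  refine Finset.sum_le_sum fun i hi => mul_le_mul_of_nonneg_left ?_ (svExp_nonneg hs i)
  exact Real.log_le_log hc0 (le_sv hc (Finset.mem_range.1 hi))

theorem prod_sv_mul_le (A : E N →L[ℝ] E N) {B : E N →L[ℝ] E N} (hB : Function.Injective B)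
    {j : ℕ} (hj : j ≤ N) :
    ∏ i ∈ Finset.range j, sv (A * B) i ≤
      (∏ i ∈ Finset.range j, sv A i) * ∏ i ∈ Finset.range j, sv B i :=
  prod_singularValues_comp_le (B : E N →ₗ[ℝ] E N) (A : E N →ₗ[ℝ] E N) hB (by simpa using hj)

/-- For `s ≤ N`, `φ^s` interpolates between two products of leading singular values. -/
theorem svf_eq_interpolate {A : E N →L[ℝ] E N} (hA : Function.Injective A) {s : ℝ} (hs : 0 < s)
    (hsN : s ≤ N) :
    singularValueFunction s A =
      (∏ i ∈ Finset.range (⌈s⌉₊ - 1), sv A i) ^ (1 - (s - ((⌈s⌉₊ - 1 : ℕ) : ℝ))) *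
        (∏ i ∈ Finset.range ⌈s⌉₊, sv A i) ^ (s - ((⌈s⌉₊ - 1 : ℕ) : ℝ)) := by
  have hj : 1 ≤ ⌈s⌉₊ := Nat.one_le_ceil_iff.2 hs
  have hjN : ⌈s⌉₊ ≤ N := Nat.ceil_le.2 hsN
  have h1 : 0 < ∏ i ∈ Finset.range (⌈s⌉₊ - 1), sv A i :=
    Finset.prod_pos fun i hi => sv_pos hA (by
      have := Finset.mem_range.1 hi
      omega)
  have h2 : ∏ i ∈ Finset.range ⌈s⌉₊, sv A i =
      (∏ i ∈ Finset.range (⌈s⌉₊ - 1), sv A i) * sv A (⌈s⌉₊ - 1) := by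
    rw [← Finset.prod_range_succ]
    congr 2
    omega
  rw [h2, Real.mul_rpow h1.le (sv_nonneg _ _), ← mul_assoc, ← Real.rpow_add h1, sub_add_cancel,
    Real.rpow_one]
  simp only [singularValueFunction, if_pos hsN, sv]

theorem mul_injective {A B : E N →L[ℝ] E N} (hA : Function.Injective A)
    (hB : Function.Injective B) : Function.Injective (A * B) := hA.comp hB

/-- The singular value function is submultiplicative. -/
theorem svf_mul_le {A B : E N →L[ℝ] E N} (hA : Function.Injective A) (hB : Function.Injective B)
    {s : ℝ} (hs : 0 < s) :
    singularValueFunction s (A * B) ≤ singularValueFunction s A * singularValueFunction s B := by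
  have hp : ∀ (C : E N →L[ℝ] E N) (j : ℕ), 0 ≤ ∏ i ∈ Finset.range j, sv C i := fun C j =>
    Finset.prod_nonneg fun i _ => sv_nonneg C i
  by_cases hsN : s ≤ N
  · have hj : 1 ≤ ⌈s⌉₊ := Nat.one_le_ceil_iff.2 hs
    have hjN : ⌈s⌉₊ ≤ N := Nat.ceil_le.2 hsN
    have e1 : ((⌈s⌉₊ - 1 : ℕ) : ℝ) = ⌈s⌉₊ - 1 := by push_cast [hj]; ring
    -- Both interpolation weights are nonnegative, so submultiplicativity passes from the two
    -- leading products to their weighted geometric mean.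
    have h1 : 0 ≤ 1 - (s - ((⌈s⌉₊ - 1 : ℕ) : ℝ)) := by
      have := Nat.le_ceil s
      rw [e1]
      linarith
    have h2 : 0 ≤ s - ((⌈s⌉₊ - 1 : ℕ) : ℝ) := by
      have := Nat.ceil_lt_add_one hs.le
      rw [e1]
      linarith
    rw [svf_eq_interpolate (mul_injective hA hB) hs hsN, svf_eq_interpolate hA hs hsN,
      svf_eq_interpolate hB hs hsN, mul_mul_mul_comm, ← Real.mul_rpow (hp _ _) (hp _ _),
      ← Real.mul_rpow (hp _ _) (hp _ _)]
    exact mul_le_mul (Real.rpow_le_rpow (hp _ _) (prod_sv_mul_le A hB (by omega)) h1)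
      (Real.rpow_le_rpow (hp _ _) (prod_sv_mul_le A hB hjN) h2)
      (Real.rpow_nonneg (hp _ _) _)
      (Real.rpow_nonneg (mul_nonneg (hp _ _) (hp _ _)) _)
  · simp only [singularValueFunction, if_neg hsN]
    rw [← Real.mul_rpow (hp _ _) (hp _ _)]
    refine Real.rpow_le_rpow (hp _ _) (prod_sv_mul_le A hB le_rfl) ?_
    positivity

theorem exists_inverse {A : E N →L[ℝ] E N} (hA : Function.Injective A) :
    ∃ B : E N →L[ℝ] E N, Function.Injective B ∧ A * B = 1 ∧ B * A = 1 := by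
  let e : E N ≃L[ℝ] E N := (LinearEquiv.ofInjectiveEndo (A : E N →ₗ[ℝ] E N) hA).toContinuousLinearEquiv
  have he : ∀ x, e x = A x := fun x => rfl
  refine ⟨e.symm, e.symm.injective, ?_, ?_⟩
  · ext1 x
    change A (e.symm x) = x
    rw [← he, e.apply_symm_apply]
  · ext1 x
    change e.symm (A x) = x
    rw [← he, e.symm_apply_apply]

theorem exists_lower_norm {A : E N →L[ℝ] E N} (hA : Function.Injective A) :
    ∃ c : ℝ, 0 < c ∧ c ≤ 1 ∧ ∀ x, c * ‖x‖ ≤ ‖A x‖ := by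
  obtain ⟨B, -, -, hB⟩ := exists_inverse hA
  refine ⟨(1 + ‖B‖)⁻¹, by positivity, inv_le_one_of_one_le₀ (by simp), fun x => ?_⟩
  have hx : x = B (A x) := by
    rw [← mul_apply_eq_comp, hB]
    rfl
  rw [inv_mul_le_iff₀ (by positivity)]
  calc ‖x‖ = ‖B (A x)‖ := by rw [← hx]
    _ ≤ ‖B‖ * ‖A x‖ := B.le_opNorm _
    _ ≤ (1 + ‖B‖) * ‖A x‖ := by gcongr; simp

/-- Submultiplicativity applied to `A = (A * B) * B⁻¹`: a fixed right factor can lower φ^s only by a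
bounded factor. -/
theorem exists_svf_le_mul {B : E N →L[ℝ] E N} (hB : Function.Injective B) {s : ℝ} (hs : 0 < s) :
    ∃ K : ℝ, 0 < K ∧ ∀ A : E N →L[ℝ] E N, Function.Injective A →
      singularValueFunction s A ≤ K * singularValueFunction s (A * B) := by
  obtain ⟨C, hC, hBC, -⟩ := exists_inverse hB
  refine ⟨singularValueFunction s C, svf_pos hC hs, fun A hA => ?_⟩
  have h := svf_mul_le (mul_injective hA hB) hC hs
  rw [mul_assoc, hBC, mul_one] at h
  linarith

end SingularValueFunction

/-! ### Volumes of ellipsoids and counts of mesh cubes. -/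

section Volume

open Module InnerProductSpace

variable {N : ℕ}

theorem volume_box (e : OrthonormalBasis (Fin N) ℝ (E N)) (a b : Fin N → ℝ) :
    volume {z : E N | ∀ i, ⟪e i, z⟫_ℝ ∈ Set.Icc (a i) (b i)} =
      ∏ i, ENNReal.ofReal (b i - a i) := by
  have h := (PiLp.volume_preserving_ofLp (Fin N)).comp e.measurePreserving_repr
  have hs : MeasurableSet (Set.univ.pi fun i => Set.Icc (a i) (b i)) :=
    MeasurableSet.univ_pi fun _ => measurableSet_Icc
  rw [← Real.volume_Icc_pi, ← Set.pi_univ_Icc, ← h.measure_preimage hs.nullMeasurableSet]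
  congr 1
  ext z
  simp only [Set.mem_preimage, Set.mem_univ_pi, Function.comp_apply, e.repr_apply_apply]
  rfl

theorem sv_mul_abs_inner_le {A : E N →L[ℝ] E N} {e : OrthonormalBasis (Fin N) ℝ (E N)}
    (he : ∀ i j : Fin N, ⟪A (e i), A (e j)⟫_ℝ = if i = j then sv A i ^ 2 else 0) (x : E N)
    (i : Fin N) : sv A i * |⟪e i, x⟫_ℝ| ≤ ‖A x‖ := by
  have h := norm_sq_apply_eq_sum (f := (A : E N →ₗ[ℝ] E N)) he x
  refine le_of_sq_le_sq ?_ (norm_nonneg _)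
  rw [mul_pow, sq_abs]
  refine le_of_le_of_eq ?_ h.symm
  exact Finset.single_le_sum (f := fun i : Fin N => sv A i ^ 2 * ⟪e i, x⟫_ℝ ^ 2)
    (fun i _ => by positivity) (Finset.mem_univ i)

/-- The volume of the part of an ellipsoid `A⁻¹(B(y, r))` in a fixed ball is at most
`C r^s / φ^s(A)`. -/
theorem volume_ellipsoid_le {s R : ℝ} (hN : 1 ≤ N) (hs : 0 < s) (hsN : s ≤ N) (hR : 0 ≤ R)
    {A : E N →L[ℝ] E N} (hA : Function.Injective A) (y : E N) {r : ℝ} (hr : 0 < r) :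
    volume {z : E N | ‖z‖ ≤ R ∧ ‖A (y - z)‖ ≤ r} ≤
      ENNReal.ofReal ((2 * (R + 1)) ^ N * (r ^ s / singularValueFunction s A)) := by
  obtain ⟨e, he⟩ := exists_basis_sv A
  let x : ℕ → ℝ := fun i => r / sv A i
  have hα : ∀ i : Fin N, 0 < sv A i := fun i => sv_pos hA i.2
  have hx : ∀ i : Fin N, 0 < x i := fun i => div_pos hr (hα i)
  -- In the `i`-th singular direction the side comes from the ball if the semi-axis `x i = r / α_i`
  -- is at least 1, and from the ellipsoid otherwise. As the exponent `e_i` lies in [0, 1], either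
  -- length is at most `2 (R + 1) x_i ^ e_i`.
  let a : Fin N → ℝ := fun i => if 1 ≤ x i then -R else ⟪e i, y⟫_ℝ - x i
  let b : Fin N → ℝ := fun i => if 1 ≤ x i then R else ⟪e i, y⟫_ℝ + x i
  have hsub : {z : E N | ‖z‖ ≤ R ∧ ‖A (y - z)‖ ≤ r} ⊆
      {z : E N | ∀ i, ⟪e i, z⟫_ℝ ∈ Set.Icc (a i) (b i)} := by
    rintro z ⟨hz1, hz2⟩ i
    by_cases hxi : 1 ≤ x i
    · have h1 : |⟪e i, z⟫_ℝ| ≤ R := by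
        have := abs_real_inner_le_norm (e i) z
        rw [e.orthonormal.1 i, one_mul] at this
        exact this.trans hz1
      simpa [a, b, hxi, Set.mem_Icc] using abs_le.1 h1
    · have h1 : |⟪e i, y - z⟫_ℝ| ≤ x i := by
        rw [le_div_iff₀ (hα i), mul_comm]
        exact (sv_mul_abs_inner_le he _ i).trans hz2
      rw [inner_sub_right] at h1
      have h2 := abs_le.1 h1
      simp only [a, b, hxi, if_false, Set.mem_Icc]
      constructor <;> linarith [h2.1, h2.2]
  refine (measure_mono hsub).trans ?_
  rw [volume_box, ← ENNReal.ofReal_prod_of_nonneg]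
  swap
  · intro i _
    simp only [a, b]
    split_ifs
    · linarith
    · linarith [hx i]
  refine ENNReal.ofReal_le_ofReal ?_
  have hterm : ∀ i : Fin N, b i - a i ≤ 2 * (R + 1) * x i ^ svExp N s i := by
    intro i
    simp only [a, b]
    split_ifs with hxi
    · have := Real.one_le_rpow hxi (svExp_nonneg (N := N) hs i)
      nlinarith
    · have h1 : x i ≤ x i ^ svExp N s i := by
        have := Real.rpow_le_rpow_of_exponent_ge (hx i) (not_le.1 hxi).le (svExp_le_one hsN i)
        rwa [Real.rpow_one] at this
      have := hx i
      nlinarith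
  have h0 : ∀ i : Fin N, 0 ≤ b i - a i := by
    intro i
    simp only [a, b]
    split_ifs
    · linarith
    · linarith [hx i]
  refine (Finset.prod_le_prod (fun i _ => h0 i) fun i _ => hterm i).trans (le_of_eq ?_)
  rw [Finset.prod_mul_distrib, Finset.prod_const, Finset.card_univ, Fintype.card_fin]
  congr 1
  rw [svf_eq_prod hA hs]
  have hrs : r ^ s = ∏ i ∈ Finset.range N, r ^ svExp N s i := by
    rw [← Real.rpow_sum_of_pos hr, sum_svExp hN hs]
  rw [hrs, ← Finset.prod_div_distrib,
    ← Fin.prod_univ_eq_prod_range (fun i => r ^ svExp N s i / sv A i ^ svExp N s i) N]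
  refine Finset.prod_congr rfl fun i _ => ?_
  rw [Real.div_rpow hr.le (sv_nonneg _ _)]

theorem mem_meshCube_iff {r : ℝ} (hr : 0 < r) {j : Fin N → ℤ} {x : E N} :
    x ∈ meshCube r j ↔ ∀ l, ⌊x l / r⌋ = j l := by
  simp only [meshCube, Set.mem_ofPred_eq, Set.mem_Ico]
  refine forall_congr' fun l => ?_
  rw [Int.floor_eq_iff, le_div_iff₀ hr, div_lt_iff₀ hr]

theorem measurableSet_meshCube (r : ℝ) (j : Fin N → ℤ) : MeasurableSet (meshCube r j) := by
  have : meshCube r j = ⋂ l, {x : E N | x l ∈ Set.Ico (j l * r) ((j l + 1) * r)} := by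
    ext x
    simp [meshCube]
  rw [this]
  refine MeasurableSet.iInter fun l => ?_
  have hm : Measurable fun x : E N => x l := by fun_prop
  exact hm measurableSet_Ico

theorem pairwise_disjoint_meshCube {r : ℝ} (hr : 0 < r) :
    Pairwise fun j k : Fin N → ℤ => Disjoint (meshCube r j) (meshCube r k) := by
  intro j k hjk
  rw [Set.disjoint_left]
  intro x hx hx'
  rw [mem_meshCube_iff hr] at hx hx'
  exact hjk (funext fun l => (hx l).symm.trans (hx' l))

theorem iUnion_meshCube {r : ℝ} (hr : 0 < r) : ⋃ j : Fin N → ℤ, meshCube r j = Set.univ := by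
  refine Set.eq_univ_of_forall fun x => Set.mem_iUnion.2 ⟨fun l => ⌊x l / r⌋, ?_⟩
  rw [mem_meshCube_iff hr]
  exact fun _ => rfl

theorem volume_meshCube {r : ℝ} (hr : 0 < r) (j : Fin N → ℤ) :
    volume (meshCube r j) = ENNReal.ofReal (r ^ N) := by
  have h := PiLp.volume_preserving_ofLp (Fin N)
  have hs : MeasurableSet (Set.univ.pi fun l => Set.Ico (j l * r) ((j l + 1) * r)) :=
    MeasurableSet.univ_pi fun _ => measurableSet_Ico
  have he : meshCube r j =
      WithLp.ofLp ⁻¹' (Set.univ.pi fun l => Set.Ico (j l * r) ((j l + 1) * r)) := by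
    ext x
    simp [meshCube, Set.mem_pi]
  rw [he, h.measure_preimage hs.nullMeasurableSet, Real.volume_pi_Ico]
  have h1 : ∀ l, ENNReal.ofReal ((j l + 1) * r - j l * r) = ENNReal.ofReal r := fun l => by
    congr 1
    ring
  simp only [h1, Finset.prod_const, Finset.card_univ, Fintype.card_fin]
  rw [ENNReal.ofReal_pow hr.le]

theorem norm_sub_le_of_mem_meshCube {r : ℝ} {j : Fin N → ℤ} {x y : E N} (hx : x ∈ meshCube r j)
    (hy : y ∈ meshCube r j) (hr : 0 < r) : ‖x - y‖ ≤ Real.sqrt N * r := by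
  rw [EuclideanSpace.norm_eq]
  refine Real.sqrt_le_iff.2 ⟨by positivity, ?_⟩
  rw [mul_pow, Real.sq_sqrt (Nat.cast_nonneg N)]
  have : ∀ l ∈ Finset.univ, ‖(x - y) l‖ ^ 2 ≤ r ^ 2 := by
    intro l _
    have h1 := hx l
    have h2 := hy l
    rw [Set.mem_Ico] at h1 h2
    rw [Real.norm_eq_abs, sq_abs, sq_le_sq, abs_of_pos hr, abs_le, PiLp.sub_apply]
    constructor <;> linarith [h1.1, h1.2, h2.1, h2.2]
  refine (Finset.sum_le_sum this).trans (le_of_eq ?_)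
  simp

/-- The basis consists of the left singular vectors, the normalised images of the right ones. -/
theorem exists_basis_image (hN : 1 ≤ N) {A : E N →L[ℝ] E N} (hA : Function.Injective A) :
    ∃ f : OrthonormalBasis (Fin N) ℝ (E N), ∀ (i : Fin N) (x : E N),
      |⟪f i, A x⟫_ℝ| ≤ sv A i * ‖x‖ := by
  obtain ⟨e, he⟩ := exists_basis_sv A
  have hα : ∀ i : Fin N, 0 < sv A i := fun i => sv_pos hA i.2
  let v : Fin N → E N := fun i => (sv A i)⁻¹ • A (e i)
  have hv : Orthonormal ℝ v := by
    rw [orthonormal_iff_ite]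
    intro i j
    simp only [v, inner_smul_left, inner_smul_right, he, conj_trivial]
    split_ifs with h
    · subst h
      have := (hα i).ne'
      field_simp
    · simp
  have : Nonempty (Fin N) := ⟨⟨0, hN⟩⟩
  let B := basisOfOrthonormalOfCardEqFinrank hv (by simp)
  have hB : (B : Fin N → E N) = v := coe_basisOfOrthonormalOfCardEqFinrank _ _
  refine ⟨B.toOrthonormalBasis (by rwa [hB]), fun i x => ?_⟩
  have hAx : A x = ∑ j, ⟪e j, x⟫_ℝ • A (e j) := by
    conv_lhs => rw [← e.sum_repr' x]
    simp
  have h1 : ⟪v i, A x⟫_ℝ = sv A i * ⟪e i, x⟫_ℝ := by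
    rw [hAx, inner_sum, Finset.sum_eq_single i]
    · simp only [v, inner_smul_left, inner_smul_right, he, conj_trivial]
      have := (hα i).ne'
      simp
      field_simp
    · intro j _ hj
      simp only [v, inner_smul_left, inner_smul_right, he, conj_trivial]
      simp [hj.symm]
    · simp
  rw [B.coe_toOrthonormalBasis, hB, h1, abs_mul, abs_of_pos (hα i)]
  refine mul_le_mul_of_nonneg_left ?_ (hα i).le
  have := abs_real_inner_le_norm (e i) x
  rwa [e.orthonormal.1 i, one_mul] at this

/-- Volume comparison: the cubes are disjoint, of volume `r ^ N`, and lie in a box along the left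
singular directions with half-sides `R α_i + √N r`. -/
theorem card_meshCube_le (hN : 1 ≤ N) {R : ℝ} (hR : 0 ≤ R) {A : E N →L[ℝ] E N}
    (hA : Function.Injective A) (y : E N) {r : ℝ} (hr : 0 < r) (F : Finset (Fin N → ℤ))
    (hF : ∀ j ∈ F, ∃ x, ‖x‖ ≤ R ∧ y + A x ∈ meshCube r j) :
    (F.card : ℝ) ≤ (2 * (R + Real.sqrt N)) ^ N * ∏ i ∈ Finset.range N, max 1 (sv A i / r) := by
  obtain ⟨f, hf⟩ := exists_basis_image hN hA
  let w : Fin N → ℝ := fun i => R * sv A i + Real.sqrt N * r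
  have hw : ∀ i, 0 ≤ w i := fun i => by
    have := sv_nonneg A i
    positivity
  have hsub : ⋃ j ∈ F, meshCube r j ⊆
      {z : E N | ∀ i, ⟪f i, z⟫_ℝ ∈ Set.Icc (⟪f i, y⟫_ℝ - w i) (⟪f i, y⟫_ℝ + w i)} := by
    intro z hz i
    obtain ⟨j, hj, hzj⟩ := Set.mem_iUnion₂.1 hz
    obtain ⟨x, hx, hyx⟩ := hF j hj
    have h1 : |⟪f i, z - (y + A x)⟫_ℝ| ≤ Real.sqrt N * r := by
      have := abs_real_inner_le_norm (f i) (z - (y + A x))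
      rw [f.orthonormal.1 i, one_mul] at this
      exact this.trans (norm_sub_le_of_mem_meshCube hzj hyx hr)
    have h2 : |⟪f i, A x⟫_ℝ| ≤ R * sv A i := by
      refine (hf i x).trans ?_
      rw [mul_comm]
      gcongr
      exact sv_nonneg A i
    have h3 : ⟪f i, z⟫_ℝ = ⟪f i, y⟫_ℝ + ⟪f i, A x⟫_ℝ + ⟪f i, z - (y + A x)⟫_ℝ := by
      rw [inner_sub_right, inner_add_right]
      ring
    have h1' := abs_le.1 h1
    have h2' := abs_le.1 h2
    rw [h3, Set.mem_Icc]
    constructor <;> simp only [w] <;> linarith [h1'.1, h1'.2, h2'.1, h2'.2]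
  have hvol := measure_mono (μ := volume) hsub
  rw [measure_biUnion_finset (fun a _ b _ hab => pairwise_disjoint_meshCube hr hab)
    (fun b _ => measurableSet_meshCube r b), volume_box] at hvol
  simp only [volume_meshCube hr, Finset.sum_const, nsmul_eq_mul] at hvol
  rw [← ENNReal.ofReal_prod_of_nonneg (fun i _ => by linarith [hw i]),
    ← ENNReal.ofReal_natCast, ← ENNReal.ofReal_mul (Nat.cast_nonneg _),
    ENNReal.ofReal_le_ofReal_iff (Finset.prod_nonneg fun i _ => by linarith [hw i])] at hvol
  have hrN : 0 < r ^ N := by positivity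
  rw [← mul_le_mul_iff_left₀ hrN]
  refine hvol.trans ?_
  have h4 : ∀ i : Fin N, ⟪f i, y⟫_ℝ + w i - (⟪f i, y⟫_ℝ - w i) ≤
      2 * (R + Real.sqrt N) * max 1 (sv A i / r) * r := by
    intro i
    have h5 : sv A i ≤ max 1 (sv A i / r) * r := by
      rw [← div_le_iff₀ hr]
      exact le_max_right _ _
    have h6 : r ≤ max 1 (sv A i / r) * r := le_mul_of_one_le_left hr.le (le_max_left _ _)
    have h7 := Real.sqrt_nonneg N
    simp only [w]
    nlinarith
  refine (Finset.prod_le_prod (fun i _ => by linarith [hw i]) fun i _ => h4 i).trans (le_of_eq ?_)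
  rw [Finset.prod_mul_distrib, Finset.prod_mul_distrib, Finset.prod_const, Finset.prod_const,
    Finset.card_univ, Fintype.card_fin, ← Fin.prod_univ_eq_prod_range (fun i => max 1 (sv A i / r))]

/-- When `α_{⌈s⌉}` is comparable to `r`, the box-counting product is bounded by `φ^s(A) r^{-s}`. -/
theorem prod_max_le (hN : 1 ≤ N) {s : ℝ} (hs : 0 < s) (hsN : s ≤ N) {A : E N →L[ℝ] E N}
    (hA : Function.Injective A) {r c : ℝ} (hr : 0 < r) (hc0 : 0 < c) (hc1 : c ≤ 1)
    (h1 : c * r ≤ sv A (⌈s⌉₊ - 1)) (h2 : sv A (⌈s⌉₊ - 1) ≤ r) :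
    ∏ i ∈ Finset.range N, max 1 (sv A i / r) ≤
      c⁻¹ ^ N * (singularValueFunction s A / r ^ s) := by
  have hrs : r ^ s = ∏ i ∈ Finset.range N, r ^ svExp N s i := by
    rw [← Real.rpow_sum_of_pos hr, sum_svExp hN hs]
  rw [svf_eq_prod hA hs, hrs, ← Finset.prod_div_distrib]
  have hcN : c⁻¹ ^ N = ∏ i ∈ Finset.range N, c⁻¹ := by simp
  rw [hcN, ← Finset.prod_mul_distrib]
  have hj : 1 ≤ ⌈s⌉₊ := Nat.one_le_ceil_iff.2 hs
  have hci : 1 ≤ c⁻¹ := (one_le_inv₀ hc0).2 hc1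
  refine Finset.prod_le_prod (fun i _ => le_max_of_le_left zero_le_one) fun i hi => ?_
  rw [← Real.div_rpow (sv_nonneg _ _) hr.le]
  have hα : 0 < sv A i := sv_pos hA (Finset.mem_range.1 hi)
  -- Before the critical index the exponent is 1; at the critical index the ratio `α_i / r` lies in
  -- [c, 1]; after it the exponent is 0 and the ratio is at most 1. One factor `c⁻¹` per index
  -- covers every case.
  by_cases hij : i ≤ ⌈s⌉₊ - 1
  · have hαi : c ≤ sv A i / r := by
      rw [le_div_iff₀ hr]
      exact h1.trans (sv_antitone A hij)
    have he0 := svExp_nonneg (N := N) hs i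
    have he1 := svExp_le_one hsN i
    refine max_le ?_ ?_
    · rw [inv_mul_eq_div, le_div_iff₀ hc0, one_mul]
      calc c = c ^ (1 : ℝ) := (Real.rpow_one c).symm
        _ ≤ c ^ svExp N s i := Real.rpow_le_rpow_of_exponent_ge hc0 hc1 he1
        _ ≤ _ := Real.rpow_le_rpow hc0.le hαi he0
    · rcases hij.lt_or_eq with hlt | heq
      · have : svExp N s i = 1 := by
          rw [svExp, if_pos hsN]
          have h3 : ((i + 1 : ℕ) : ℝ) < s := Nat.lt_ceil.1 (by omega)
          push_cast at h3
          rw [min_eq_left (by linarith), max_eq_right zero_le_one]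
        rw [this, Real.rpow_one]
        exact le_mul_of_one_le_left (by positivity) hci
      · have h4 : sv A i / r ≤ 1 := by
          rw [div_le_one hr, heq]
          exact h2
        refine h4.trans ?_
        rw [inv_mul_eq_div, le_div_iff₀ hc0, one_mul]
        calc c = c ^ (1 : ℝ) := (Real.rpow_one c).symm
          _ ≤ c ^ svExp N s i := Real.rpow_le_rpow_of_exponent_ge hc0 hc1 he1
          _ ≤ _ := Real.rpow_le_rpow hc0.le hαi he0
  · have he : svExp N s i = 0 := by
      rw [svExp, if_pos hsN]
      have h3 : (⌈s⌉₊ : ℝ) ≤ i := by exact_mod_cast (by omega : ⌈s⌉₊ ≤ i)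
      have := Nat.le_ceil s
      exact max_eq_left ((min_le_right _ _).trans (by linarith))
    rw [he, Real.rpow_zero, mul_one]
    refine (max_le le_rfl ?_).trans hci
    rw [div_le_one hr]
    exact (sv_antitone A (by omega)).trans h2

end Volume

/-! ### Norm and weight estimates along finite words. -/

section Words

variable {N m : ℕ}

/-- Uniform upper and lower norm bounds for a finite family of contractions. -/
structure NormBounds (T : Fin m → E N →L[ℝ] E N) (lam c : ℝ) : Prop where
  inj : ∀ i, Function.Injective (T i)
  lam_pos : 0 < lam
  lam_lt_one : lam < 1
  norm_le : ∀ i, ‖T i‖ ≤ lam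
  c_pos : 0 < c
  c_lt_one : c < 1
  lower : ∀ i x, c * ‖x‖ ≤ ‖T i x‖

theorem exists_normBounds (T : Fin m → E N →L[ℝ] E N) (hT_inj : ∀ i, Function.Injective (T i))
    (hT_norm : ∀ i, ‖T i‖ < 1) : ∃ lam c, NormBounds T lam c := by
  choose κ hκ0 hκ1 hκ using fun i => exists_lower_norm (hT_inj i)
  have h1 : ∃ lam : ℝ, 0 < lam ∧ lam < 1 ∧ ∀ i, ‖T i‖ ≤ lam := by
    rcases isEmpty_or_nonempty (Fin m) with hm | hm
    · exact ⟨1 / 2, by norm_num, by norm_num, fun i => isEmptyElim i⟩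
    · obtain ⟨i0, hi0⟩ := Finite.exists_max fun i => ‖T i‖
      refine ⟨(‖T i0‖ + 1) / 2, by positivity, by linarith [hT_norm i0], fun i => ?_⟩
      linarith [hi0 i, hT_norm i0]
  have h2 : ∃ c : ℝ, 0 < c ∧ c < 1 ∧ ∀ i, c ≤ κ i := by
    rcases isEmpty_or_nonempty (Fin m) with hm | hm
    · exact ⟨1 / 2, by norm_num, by norm_num, fun i => isEmptyElim i⟩
    · obtain ⟨i0, hi0⟩ := Finite.exists_min κ
      refine ⟨κ i0 / 2, by linarith [hκ0 i0], by linarith [hκ1 i0], fun i => ?_⟩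
      linarith [hi0 i, hκ0 i0]
  obtain ⟨lam, hl0, hl1, hl⟩ := h1
  obtain ⟨c, hc0, hc1, hc⟩ := h2
  exact ⟨lam, c, hT_inj, hl0, hl1, hl, hc0, hc1, fun i x =>
    (mul_le_mul_of_nonneg_right (hc i) (norm_nonneg x)).trans (hκ i x)⟩

theorem wordMap_append (T : Fin m → E N →L[ℝ] E N) (u v : List (Fin m)) :
    wordMap T (u ++ v) = wordMap T u * wordMap T v := by
  simp [wordMap]

theorem wordMap_cons (T : Fin m → E N →L[ℝ] E N) (a : Fin m) (v : List (Fin m)) :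
    wordMap T (a :: v) = T a * wordMap T v := by
  simp [wordMap]

theorem wordMap_nil (T : Fin m → E N →L[ℝ] E N) : wordMap T [] = 1 := by
  simp [wordMap]

theorem NormBounds.wordMap_injective {T : Fin m → E N →L[ℝ] E N} {lam c : ℝ}
    (hT : NormBounds T lam c) (w : List (Fin m)) : Function.Injective (wordMap T w) := by
  induction w with
  | nil =>
    rw [wordMap_nil]
    exact fun x y h => h
  | cons a v ih =>
    rw [wordMap_cons]
    exact mul_injective (hT.inj a) ih

theorem NormBounds.norm_wordMap_le {T : Fin m → E N →L[ℝ] E N} {lam c : ℝ}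
    (hT : NormBounds T lam c) (w : List (Fin m)) : ‖wordMap T w‖ ≤ lam ^ w.length := by
  induction w with
  | nil =>
    rw [wordMap_nil]
    rw [List.length_nil, pow_zero]
    exact ContinuousLinearMap.norm_id_le
  | cons a v ih =>
    rw [wordMap_cons, List.length_cons, pow_succ']
    exact (norm_mul_le _ _).trans (mul_le_mul (hT.norm_le a) ih (norm_nonneg _) hT.lam_pos.le)

theorem NormBounds.lower_wordMap {T : Fin m → E N →L[ℝ] E N} {lam c : ℝ}
    (hT : NormBounds T lam c) (w : List (Fin m)) (x : E N) :
    c ^ w.length * ‖x‖ ≤ ‖wordMap T w x‖ := by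
  induction w with
  | nil => simp [wordMap_nil]
  | cons a v ih =>
    rw [wordMap_cons, List.length_cons, pow_succ', mul_apply_eq_comp, mul_assoc]
    exact (mul_le_mul_of_nonneg_left ih hT.c_pos.le).trans (hT.lower a _)

/-- The product of the weights along a word. -/
noncomputable def wordWeight (p : PMF (Fin m)) (w : List (Fin m)) : ℝ :=
  (w.map fun i => (p i).toReal).prod

theorem wordWeight_append (p : PMF (Fin m)) (u v : List (Fin m)) :
    wordWeight p (u ++ v) = wordWeight p u * wordWeight p v := by
  simp [wordWeight]

theorem wordWeight_cons (p : PMF (Fin m)) (a : Fin m) (v : List (Fin m)) :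
    wordWeight p (a :: v) = (p a).toReal * wordWeight p v := by
  simp [wordWeight]

theorem wordWeight_nil (p : PMF (Fin m)) : wordWeight p [] = 1 := by
  simp [wordWeight]

theorem weight_pos {p : PMF (Fin m)} (hp : ∀ i, 0 < p i) (i : Fin m) : 0 < (p i).toReal :=
  ENNReal.toReal_pos (hp i).ne' (p.apply_ne_top i)

theorem weight_le_one (p : PMF (Fin m)) (i : Fin m) : (p i).toReal ≤ 1 :=
  ENNReal.toReal_le_of_le_ofReal zero_le_one (by simpa using p.coe_le_one i)

theorem sum_weight (p : PMF (Fin m)) : ∑ i, (p i).toReal = 1 := by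
  rw [← ENNReal.toReal_sum fun i _ => p.apply_ne_top i]
  have := p.tsum_coe
  rw [tsum_fintype] at this
  simp [this]

theorem wordWeight_pos {p : PMF (Fin m)} (hp : ∀ i, 0 < p i) (w : List (Fin m)) :
    0 < wordWeight p w := by
  induction w with
  | nil => simp [wordWeight_nil]
  | cons a v ih =>
    rw [wordWeight_cons]
    exact mul_pos (weight_pos hp a) ih

theorem wordWeight_le_one {p : PMF (Fin m)} (hp : ∀ i, 0 < p i) (w : List (Fin m)) :
    wordWeight p w ≤ 1 := by
  induction w with
  | nil => simp [wordWeight_nil]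
  | cons a v ih =>
    rw [wordWeight_cons]
    exact mul_le_one₀ (weight_le_one p a) (wordWeight_pos hp v).le ih

theorem bernoulliMeasure_cylinder (p : PMF (Fin m)) {k : ℕ} (w : Fin k → Fin m) :
    bernoulliMeasure p (cylinder w) = ∏ j, p (w j) := by
  let t : ℕ → Set (Fin m) := fun n => if h : n < k then {w ⟨n, h⟩} else Set.univ
  have ht : cylinder w = Set.pi (Finset.range k) t := by
    ext i
    simp only [cylinder, Set.mem_ofPred_eq, Set.mem_pi, Finset.coe_range, Set.mem_Iio]
    constructor
    · intro h n hn
      simp only [t, hn, dif_pos]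
      exact h ⟨n, hn⟩
    · intro h j
      have := h j j.2
      simpa [t] using this
  rw [ht, bernoulliMeasure, Measure.infinitePi_pi _ (fun _ _ => MeasurableSet.of_discrete),
    ← Fin.prod_univ_eq_prod_range (fun n => p.toMeasure (t n)) k]
  refine Finset.prod_congr rfl fun j _ => ?_
  simp [t]

theorem bernoulliMeasure_real_cylinder (p : PMF (Fin m)) {k : ℕ} (w : Fin k → Fin m) :
    (bernoulliMeasure p).real (cylinder w) = wordWeight p (List.ofFn w) := by
  rw [Measure.real, bernoulliMeasure_cylinder, ENNReal.toReal_prod, wordWeight, List.map_ofFn,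
    List.prod_ofFn]
  rfl

/-- The term `φ^s(T_𝐢)^{1-q} p_𝐢^q` of a level sum. -/
noncomputable def wordTerm (T : Fin m → E N →L[ℝ] E N) (p : PMF (Fin m)) (q s : ℝ)
    (w : List (Fin m)) : ℝ :=
  singularValueFunction s (wordMap T w) ^ (1 - q) * wordWeight p w ^ q

theorem levelSum_eq (T : Fin m → E N →L[ℝ] E N) (p : PMF (Fin m)) (q s : ℝ) (k : ℕ) :
    levelSum T (bernoulliMeasure p) q s k =
      ∑ w : Fin k → Fin m, wordTerm T p q s (List.ofFn w) := by
  simp only [levelSum, wordTerm, bernoulliMeasure_real_cylinder]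

variable {T : Fin m → E N →L[ℝ] E N} {lam c : ℝ} {p : PMF (Fin m)} {q s : ℝ}

theorem wordTerm_pos (hT : NormBounds T lam c) (hp : ∀ i, 0 < p i) (hs : 0 < s)
    (w : List (Fin m)) : 0 < wordTerm T p q s w :=
  mul_pos (Real.rpow_pos_of_pos (svf_pos (hT.wordMap_injective w) hs) _)
    (Real.rpow_pos_of_pos (wordWeight_pos hp w) _)

/-- The exponent `1 - q` is negative, so submultiplicativity of φ^s becomes supermultiplicativity;
the weights are exactly multiplicative. -/
theorem wordTerm_mul_le (hT : NormBounds T lam c) (hp : ∀ i, 0 < p i) (hs : 0 < s) (hq : 1 < q)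
    (u v : List (Fin m)) :
    wordTerm T p q s u * wordTerm T p q s v ≤ wordTerm T p q s (u ++ v) := by
  have hu := svf_pos (hT.wordMap_injective u) hs
  have hv := svf_pos (hT.wordMap_injective v) hs
  have huv := svf_pos (hT.wordMap_injective (u ++ v)) hs
  have hwu := wordWeight_pos hp u
  have hwv := wordWeight_pos hp v
  rw [wordTerm, wordTerm, wordTerm, wordWeight_append, mul_mul_mul_comm,
    ← Real.mul_rpow hu.le hv.le, ← Real.mul_rpow hwu.le hwv.le]
  refine mul_le_mul_of_nonneg_right ?_ (by positivity)
  refine Real.rpow_le_rpow_of_nonpos huv ?_ (by linarith)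
  rw [wordMap_append]
  exact svf_mul_le (hT.wordMap_injective u) (hT.wordMap_injective v) hs

theorem levelSum_pos (hm : 1 ≤ m) (hT : NormBounds T lam c) (hp : ∀ i, 0 < p i) (hs : 0 < s)
    (k : ℕ) : 0 < levelSum T (bernoulliMeasure p) q s k := by
  rw [levelSum_eq]
  have : Nonempty (Fin m) := ⟨⟨0, hm⟩⟩
  exact Finset.sum_pos (fun w _ => wordTerm_pos hT hp hs _) Finset.univ_nonempty

theorem levelSum_mul_le (hT : NormBounds T lam c) (hp : ∀ i, 0 < p i) (hs : 0 < s) (hq : 1 < q)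
    (k l : ℕ) :
    levelSum T (bernoulliMeasure p) q s k * levelSum T (bernoulliMeasure p) q s l ≤
      levelSum T (bernoulliMeasure p) q s (k + l) := by
  rw [levelSum_eq, levelSum_eq, levelSum_eq, Finset.sum_mul_sum, ← Fintype.sum_prod_type',
    ← (Fin.appendEquiv k l).sum_comp]
  refine Finset.sum_le_sum fun x _ => ?_
  have : List.ofFn ((Fin.appendEquiv k l) x) = List.ofFn x.1 ++ List.ofFn x.2 :=
    List.ofFn_fin_append x.1 x.2
  rw [this]
  exact wordTerm_mul_le hT hp hs hq _ _

theorem wordTerm_add_bounds (hN : 1 ≤ N) (hT : NormBounds T lam c) (hp : ∀ i, 0 < p i)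
    (hs : 0 < s) (hq : 1 < q) {h : ℝ} (hh : 0 ≤ h) (w : List (Fin m)) :
    (lam ^ (-(h * (q - 1)))) ^ w.length * wordTerm T p q s w ≤ wordTerm T p q (s + h) w ∧
      wordTerm T p q (s + h) w ≤ (c ^ (-(h * (q - 1)))) ^ w.length * wordTerm T p q s w := by
  have hi := hT.wordMap_injective w
  have h0 := svf_pos hi hs
  have h1 := svf_pos hi (by linarith : 0 < s + h)
  have hw := wordWeight_pos hp w
  have key : ∀ a : ℝ, 0 < a → (a ^ (-(h * (q - 1)))) ^ w.length = ((a ^ w.length) ^ h) ^ (1 - q) := by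
    intro a ha
    rw [← Real.rpow_natCast, ← Real.rpow_natCast, ← Real.rpow_mul ha.le, ← Real.rpow_mul ha.le,
      ← Real.rpow_mul ha.le]
    congr 1
    ring
  have hl : 0 < lam ^ w.length := pow_pos hT.lam_pos _
  have hc : 0 < c ^ w.length := pow_pos hT.c_pos _
  unfold wordTerm
  rw [key lam hT.lam_pos, key c hT.c_pos, ← mul_assoc, ← mul_assoc,
    ← Real.mul_rpow (by positivity) h0.le, ← Real.mul_rpow (by positivity) h0.le]
  constructor
  · refine mul_le_mul_of_nonneg_right ?_ (by positivity)
    refine Real.rpow_le_rpow_of_nonpos h1 ?_ (by linarith)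
    rw [mul_comm]
    exact svf_add_le hN hi hs hh (hT.norm_wordMap_le w)
  · refine mul_le_mul_of_nonneg_right ?_ (by positivity)
    refine Real.rpow_le_rpow_of_nonpos (by positivity) ?_ (by linarith)
    rw [mul_comm]
    exact le_svf_add hN hi hs hh hc (hT.lower_wordMap w)

theorem wordTerm_bounds (hN : 1 ≤ N) (hT : NormBounds T lam c) (hp : ∀ i, 0 < p i)
    (hs : 0 < s) (hq : 1 < q) (w : List (Fin m)) :
    (lam ^ (-(s * (q - 1)))) ^ w.length * wordWeight p w ^ q ≤ wordTerm T p q s w ∧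
      wordTerm T p q s w ≤ (c ^ (-(s * (q - 1)))) ^ w.length * wordWeight p w ^ q := by
  have hi := hT.wordMap_injective w
  have h0 := svf_pos hi hs
  have hw := wordWeight_pos hp w
  have key : ∀ a : ℝ, 0 < a → (a ^ (-(s * (q - 1)))) ^ w.length = ((a ^ w.length) ^ s) ^ (1 - q) := by
    intro a ha
    rw [← Real.rpow_natCast, ← Real.rpow_natCast, ← Real.rpow_mul ha.le, ← Real.rpow_mul ha.le,
      ← Real.rpow_mul ha.le]
    congr 1
    ring
  have hl : 0 < lam ^ w.length := pow_pos hT.lam_pos _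
  have hc : 0 < c ^ w.length := pow_pos hT.c_pos _
  unfold wordTerm
  rw [key lam hT.lam_pos, key c hT.c_pos]
  constructor
  · refine mul_le_mul_of_nonneg_right ?_ (by positivity)
    exact Real.rpow_le_rpow_of_nonpos h0 (svf_le hN hi hs (hT.norm_wordMap_le w)) (by linarith)
  · refine mul_le_mul_of_nonneg_right ?_ (by positivity)
    exact Real.rpow_le_rpow_of_nonpos (by positivity) (le_svf hN hi hs hc (hT.lower_wordMap w))
      (by linarith)

/-- Controls the change in `q`, which is needed to replace a real `q` by a nearby larger rational.
-/
theorem wordTerm_exponent_le (hN : 1 ≤ N) (hT : NormBounds T lam c) (hp : ∀ i, 0 < p i)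
    (hs : 0 < s) {h : ℝ} (hh : 0 ≤ h) (w : List (Fin m)) :
    wordTerm T p (q + h) s w ≤ (c ^ (-(s * h))) ^ w.length * wordTerm T p q s w := by
  have hi := hT.wordMap_injective w
  have h0 := svf_pos hi hs
  have hw := wordWeight_pos hp w
  have hc : 0 < c ^ w.length := pow_pos hT.c_pos _
  have key : (c ^ (-(s * h))) ^ w.length = ((c ^ w.length) ^ s) ^ (-h) := by
    rw [← Real.rpow_natCast, ← Real.rpow_natCast, ← Real.rpow_mul hT.c_pos.le,
      ← Real.rpow_mul hT.c_pos.le, ← Real.rpow_mul hT.c_pos.le]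
    congr 1
    ring
  unfold wordTerm
  rw [key, Real.rpow_add hw, show 1 - (q + h) = (1 - q) + -h by ring, Real.rpow_add h0]
  have e1 : singularValueFunction s (wordMap T w) ^ (-h) ≤ ((c ^ w.length) ^ s) ^ (-h) :=
    Real.rpow_le_rpow_of_nonpos (by positivity) (le_svf hN hi hs hc (hT.lower_wordMap w))
      (by linarith)
  have e2 : wordWeight p w ^ h ≤ 1 := Real.rpow_le_one hw.le (wordWeight_le_one hp w) hh
  calc _ = singularValueFunction s (wordMap T w) ^ (-h) *
        (singularValueFunction s (wordMap T w) ^ (1 - q) * wordWeight p w ^ q) *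
        wordWeight p w ^ h := by ring
    _ ≤ ((c ^ w.length) ^ s) ^ (-h) *
        (singularValueFunction s (wordMap T w) ^ (1 - q) * wordWeight p w ^ q) * 1 := by
        gcongr
    _ = _ := by ring

theorem sum_wordWeight_rpow (p : PMF (Fin m)) (q : ℝ) (k : ℕ) :
    ∑ w : Fin k → Fin m, wordWeight p (List.ofFn w) ^ q = (∑ i, (p i).toReal ^ q) ^ k := by
  rw [Fintype.sum_pow]
  refine Finset.sum_congr rfl fun w _ => ?_
  rw [wordWeight, List.map_ofFn, List.prod_ofFn,
    ← Real.finsetProd_rpow _ _ fun i _ => by simp]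
  rfl

end Words

/-! ### The pressure function and its unique zero. -/

section Pressure

variable {N m : ℕ} {T : Fin m → E N →L[ℝ] E N} {lam c : ℝ} {p : PMF (Fin m)} {q s : ℝ}

theorem levelSum_add_bounds (hN : 1 ≤ N) (hT : NormBounds T lam c) (hp : ∀ i, 0 < p i)
    (hs : 0 < s) (hq : 1 < q) {h : ℝ} (hh : 0 ≤ h) (k : ℕ) :
    (lam ^ (-(h * (q - 1)))) ^ k * levelSum T (bernoulliMeasure p) q s k ≤
        levelSum T (bernoulliMeasure p) q (s + h) k ∧
      levelSum T (bernoulliMeasure p) q (s + h) k ≤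
        (c ^ (-(h * (q - 1)))) ^ k * levelSum T (bernoulliMeasure p) q s k := by
  simp only [levelSum_eq, Finset.mul_sum]
  constructor <;> refine Finset.sum_le_sum fun w _ => ?_
  · simpa using (wordTerm_add_bounds hN hT hp hs hq hh (List.ofFn w)).1
  · simpa using (wordTerm_add_bounds hN hT hp hs hq hh (List.ofFn w)).2

theorem levelSum_bounds (hN : 1 ≤ N) (hT : NormBounds T lam c) (hp : ∀ i, 0 < p i)
    (hs : 0 < s) (hq : 1 < q) (k : ℕ) :
    (lam ^ (-(s * (q - 1)))) ^ k * (∑ i, (p i).toReal ^ q) ^ k ≤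
        levelSum T (bernoulliMeasure p) q s k ∧
      levelSum T (bernoulliMeasure p) q s k ≤
        (c ^ (-(s * (q - 1)))) ^ k * (∑ i, (p i).toReal ^ q) ^ k := by
  simp only [levelSum_eq, ← sum_wordWeight_rpow, Finset.mul_sum]
  constructor <;> refine Finset.sum_le_sum fun w _ => ?_
  · simpa using (wordTerm_bounds hN hT hp hs hq (List.ofFn w)).1
  · simpa using (wordTerm_bounds hN hT hp hs hq (List.ofFn w)).2

theorem levelSum_exponent_le (hN : 1 ≤ N) (hT : NormBounds T lam c) (hp : ∀ i, 0 < p i)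
    (hs : 0 < s) {h : ℝ} (hh : 0 ≤ h) (k : ℕ) :
    levelSum T (bernoulliMeasure p) (q + h) s k ≤
      (c ^ (-(s * h))) ^ k * levelSum T (bernoulliMeasure p) q s k := by
  simp only [levelSum_eq, Finset.mul_sum]
  refine Finset.sum_le_sum fun w _ => ?_
  simpa using wordTerm_exponent_le (q := q) hN hT hp hs hh (List.ofFn w)

theorem sum_weight_rpow_pos (hm : 1 ≤ m) (hp : ∀ i, 0 < p i) : 0 < ∑ i, (p i).toReal ^ q := by
  have : Nonempty (Fin m) := ⟨⟨0, hm⟩⟩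
  exact Finset.sum_pos (fun i _ => Real.rpow_pos_of_pos (weight_pos hp i) _)
    Finset.univ_nonempty

theorem weight_lt_one (hm : 2 ≤ m) (hp : ∀ i, 0 < p i) (i : Fin m) : (p i).toReal < 1 := by
  obtain ⟨j, hj⟩ : ∃ j : Fin m, j ≠ i := by
    have : Nontrivial (Fin m) := Fin.nontrivial_iff_two_le.2 hm
    exact exists_ne i
  have h := sum_weight p
  have h2 : (p i).toReal + (p j).toReal ≤ ∑ k, (p k).toReal := by
    rw [← Finset.sum_pair (f := fun k => (p k).toReal) hj.symm]
    exact Finset.sum_le_sum_of_subset_of_nonneg (Finset.subset_univ _)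
      fun k _ _ => ENNReal.toReal_nonneg
  linarith [weight_pos hp j]

theorem sum_weight_rpow_lt_one (hm : 2 ≤ m) (hp : ∀ i, 0 < p i) (hq : 1 < q) :
    ∑ i, (p i).toReal ^ q < 1 := by
  rw [← sum_weight p]
  have : Nonempty (Fin m) := ⟨⟨0, by omega⟩⟩
  refine Finset.sum_lt_sum_of_nonempty Finset.univ_nonempty fun i _ => ?_
  have := Real.rpow_lt_rpow_of_exponent_gt (weight_pos hp i) (weight_lt_one hm hp i) hq
  rwa [Real.rpow_one] at this

/-- The pressure `lim_k (1/k) log ∑_{|𝐢| = k} φ^s(T_𝐢)^{1-q} p_𝐢^q`. -/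
noncomputable def pressure (T : Fin m → E N →L[ℝ] E N) (p : PMF (Fin m)) (q s : ℝ) : ℝ :=
  limUnder atTop fun k : ℕ => Real.log (levelSum T (bernoulliMeasure p) q s k) / k

theorem log_levelSum_div_le (hN : 1 ≤ N) (hm : 1 ≤ m) (hT : NormBounds T lam c)
    (hp : ∀ i, 0 < p i) (hs : 0 < s) (hq : 1 < q) {k : ℕ} (hk : 1 ≤ k) :
    -(s * (q - 1)) * Real.log lam + Real.log (∑ i, (p i).toReal ^ q) ≤
        Real.log (levelSum T (bernoulliMeasure p) q s k) / k ∧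
      Real.log (levelSum T (bernoulliMeasure p) q s k) / k ≤
        -(s * (q - 1)) * Real.log c + Real.log (∑ i, (p i).toReal ^ q) := by
  have hk0 : (0 : ℝ) < k := by exact_mod_cast hk
  have hQ := sum_weight_rpow_pos (q := q) hm hp
  have key : ∀ a : ℝ, 0 < a →
      Real.log ((a ^ (-(s * (q - 1)))) ^ k * (∑ i, (p i).toReal ^ q) ^ k) =
        (-(s * (q - 1)) * Real.log a + Real.log (∑ i, (p i).toReal ^ q)) * k := by
    intro a ha
    rw [Real.log_mul (by positivity) (by positivity), Real.log_pow, Real.log_pow, Real.log_rpow ha]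
    ring
  have hb := levelSum_bounds hN hT hp hs hq k
  have hl := hT.lam_pos
  constructor
  · rw [le_div_iff₀ hk0, ← key lam hT.lam_pos]
    exact Real.log_le_log (by positivity) hb.1
  · rw [div_le_iff₀ hk0, ← key c hT.c_pos]
    exact Real.log_le_log (levelSum_pos hm hT hp hs k) hb.2

/-- Fekete's lemma for minus the logarithms of the level sums. -/
theorem tendsto_pressure (hN : 1 ≤ N) (hm : 1 ≤ m) (hT : NormBounds T lam c)
    (hp : ∀ i, 0 < p i) (hs : 0 < s) (hq : 1 < q) :
    Tendsto (fun k : ℕ => Real.log (levelSum T (bernoulliMeasure p) q s k) / k) atTop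
      (𝓝 (pressure T p q s)) := by
  have hsub : Subadditive fun k => -Real.log (levelSum T (bernoulliMeasure p) q s k) := by
    intro k l
    have h1 := levelSum_pos (q := q) hm hT hp hs k
    have h2 := levelSum_pos (q := q) hm hT hp hs l
    have := Real.log_le_log (mul_pos h1 h2) (levelSum_mul_le hT hp hs hq k l)
    rw [Real.log_mul h1.ne' h2.ne'] at this
    linarith
  have hbdd : BddBelow (Set.range fun k : ℕ =>
      -Real.log (levelSum T (bernoulliMeasure p) q s k) / k) := by
    -- The `0` covers the index `k = 0`, where the quotient is a division by zero.
    refine ⟨min 0 (-(-(s * (q - 1)) * Real.log c + Real.log (∑ i, (p i).toReal ^ q))), ?_⟩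
    rintro _ ⟨k, rfl⟩
    rcases Nat.eq_zero_or_pos k with rfl | hk
    · simp
    · refine (min_le_right _ _).trans ?_
      dsimp only
      rw [neg_div]
      exact neg_le_neg (log_levelSum_div_le hN hm hT hp hs hq hk).2
  have ht := (hsub.tendsto_lim hbdd).neg
  have ht' : Tendsto (fun k : ℕ => Real.log (levelSum T (bernoulliMeasure p) q s k) / k) atTop
      (𝓝 (-hsub.lim)) := by
    refine ht.congr fun k => ?_
    rw [neg_div, neg_neg]
  rw [pressure, ht'.limUnder_eq]
  exact ht'

theorem pressure_bounds (hN : 1 ≤ N) (hm : 1 ≤ m) (hT : NormBounds T lam c)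
    (hp : ∀ i, 0 < p i) (hs : 0 < s) (hq : 1 < q) :
    -(s * (q - 1)) * Real.log lam + Real.log (∑ i, (p i).toReal ^ q) ≤ pressure T p q s ∧
      pressure T p q s ≤ -(s * (q - 1)) * Real.log c + Real.log (∑ i, (p i).toReal ^ q) := by
  have ht := tendsto_pressure hN hm hT hp hs hq
  constructor
  · refine ge_of_tendsto ht ?_
    filter_upwards [eventually_ge_atTop 1] with k hk
    exact (log_levelSum_div_le hN hm hT hp hs hq hk).1
  · refine le_of_tendsto ht ?_
    filter_upwards [eventually_ge_atTop 1] with k hk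
    exact (log_levelSum_div_le hN hm hT hp hs hq hk).2

/-- Both slopes `-(q - 1) log lam` and `-(q - 1) log c` are positive, so the pressure is strictly
increasing and Lipschitz in `s`. -/
theorem pressure_add_bounds (hN : 1 ≤ N) (hm : 1 ≤ m) (hT : NormBounds T lam c)
    (hp : ∀ i, 0 < p i) (hs : 0 < s) (hq : 1 < q) {h : ℝ} (hh : 0 ≤ h) :
    -(h * (q - 1)) * Real.log lam + pressure T p q s ≤ pressure T p q (s + h) ∧
      pressure T p q (s + h) ≤ -(h * (q - 1)) * Real.log c + pressure T p q s := by
  have ht := tendsto_pressure hN hm hT hp hs hq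
  have ht' := tendsto_pressure hN hm hT hp (by linarith : 0 < s + h) hq
  have key : ∀ a : ℝ, 0 < a → ∀ k : ℕ, 1 ≤ k →
      Real.log ((a ^ (-(h * (q - 1)))) ^ k * levelSum T (bernoulliMeasure p) q s k) / k =
        -(h * (q - 1)) * Real.log a + Real.log (levelSum T (bernoulliMeasure p) q s k) / k := by
    intro a ha k hk
    have hk0 : (k : ℝ) ≠ 0 := by positivity
    rw [Real.log_mul (by positivity) (levelSum_pos hm hT hp hs k).ne', Real.log_pow,
      Real.log_rpow ha]
    field_simp
  constructor
  · refine le_of_tendsto_of_tendsto (ht.const_add _) ht' ?_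
    filter_upwards [eventually_ge_atTop 1] with k hk
    rw [← key lam hT.lam_pos k hk]
    have := hT.lam_pos
    have := levelSum_pos (q := q) hm hT hp hs k
    exact div_le_div_of_nonneg_right (Real.log_le_log (by positivity)
      (levelSum_add_bounds hN hT hp hs hq hh k).1) (Nat.cast_nonneg k)
  · refine le_of_tendsto_of_tendsto ht' (ht.const_add _) ?_
    filter_upwards [eventually_ge_atTop 1] with k hk
    rw [← key c hT.c_pos k hk]
    exact div_le_div_of_nonneg_right (Real.log_le_log
      (levelSum_pos hm hT hp (by linarith) k)
      (levelSum_add_bounds hN hT hp hs hq hh k).2) (Nat.cast_nonneg k)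

/-- Ensures that a negative pressure stays negative when `q` is increased slightly. -/
theorem pressure_exponent_le (hN : 1 ≤ N) (hm : 1 ≤ m) (hT : NormBounds T lam c)
    (hp : ∀ i, 0 < p i) (hs : 0 < s) (hq : 1 < q) {h : ℝ} (hh : 0 ≤ h) :
    pressure T p (q + h) s ≤ -(s * h) * Real.log c + pressure T p q s := by
  have ht := tendsto_pressure hN hm hT hp hs hq
  have ht' := tendsto_pressure hN hm hT hp hs (by linarith : 1 < q + h)
  refine le_of_tendsto_of_tendsto ht' (ht.const_add _) ?_
  filter_upwards [eventually_ge_atTop 1] with k hk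
  have hk0 : (k : ℝ) ≠ 0 := by positivity
  have hc := hT.c_pos
  have h1 : Real.log ((c ^ (-(s * h))) ^ k * levelSum T (bernoulliMeasure p) q s k) / k =
        -(s * h) * Real.log c + Real.log (levelSum T (bernoulliMeasure p) q s k) / k := by
    rw [Real.log_mul (by positivity) (levelSum_pos hm hT hp hs k).ne', Real.log_pow,
      Real.log_rpow hc]
    field_simp
  rw [← h1]
  exact div_le_div_of_nonneg_right (Real.log_le_log (levelSum_pos hm hT hp hs k)
    (levelSum_exponent_le hN hT hp hs hh k)) (Nat.cast_nonneg k)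

theorem pressure_strictMonoOn (hN : 1 ≤ N) (hm : 1 ≤ m) (hT : NormBounds T lam c)
    (hp : ∀ i, 0 < p i) (hq : 1 < q) : StrictMonoOn (pressure T p q) (Set.Ioi 0) := by
  intro s hs t _ hst
  have h := (pressure_add_bounds hN hm hT hp hs hq (sub_nonneg.2 hst.le)).1
  rw [add_sub_cancel] at h
  have hl := Real.log_neg hT.lam_pos hT.lam_lt_one
  have : 0 < (t - s) * (q - 1) := mul_pos (sub_pos.2 hst) (by linarith)
  nlinarith

theorem isCriticalExponent_iff (hN : 1 ≤ N) (hm : 1 ≤ m) (hT : NormBounds T lam c)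
    (hp : ∀ i, 0 < p i) (hq : 1 < q) :
    IsCriticalExponent T (bernoulliMeasure p) q s ↔ 0 < s ∧ pressure T p q s = 0 := by
  refine and_congr_right fun hs => ?_
  have ht := tendsto_pressure hN hm hT hp hs hq
  have hexp : Tendsto (fun k : ℕ => levelSum T (bernoulliMeasure p) q s k ^ (1 / (k : ℝ))) atTop
      (𝓝 (Real.exp (pressure T p q s))) := by
    refine ((Real.continuous_exp.tendsto _).comp ht).congr fun k => ?_
    rw [Function.comp_apply, Real.rpow_def_of_pos (levelSum_pos hm hT hp hs k), mul_one_div]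
  constructor
  · intro h
    have := tendsto_nhds_unique h hexp
    exact Real.exp_eq_one_iff _ |>.1 this.symm
  · intro h
    rwa [h, Real.exp_zero] at hexp

theorem exists_pressure_eq_zero (hN : 1 ≤ N) (hm : 2 ≤ m) (hT : NormBounds T lam c)
    (hp : ∀ i, 0 < p i) (hq : 1 < q) : ∃ s, 0 < s ∧ pressure T p q s = 0 := by
  have hm1 : 1 ≤ m := by omega
  have hQ := Real.log_neg (sum_weight_rpow_pos (q := q) hm1 hp) (sum_weight_rpow_lt_one hm hp hq)
  have hl := Real.log_neg hT.lam_pos hT.lam_lt_one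
  have hc := Real.log_neg hT.c_pos hT.c_lt_one
  have hq0 : 0 < q - 1 := by linarith
  set Q := Real.log (∑ i, (p i).toReal ^ q)
  -- `a` and `b` are the zeros of the affine upper and lower bounds of `pressure_bounds`, so the
  -- pressure changes sign between them.
  let a := Q / ((q - 1) * Real.log c)
  let b := Q / ((q - 1) * Real.log lam)
  have ha : 0 < a := div_pos_of_neg_of_neg hQ (mul_neg_of_pos_of_neg hq0 hc)
  have hb : 0 < b := div_pos_of_neg_of_neg hQ (mul_neg_of_pos_of_neg hq0 hl)
  have hga : pressure T p q a ≤ 0 := by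
    refine (pressure_bounds hN hm1 hT hp ha hq).2.trans (le_of_eq ?_)
    change -(a * (q - 1)) * Real.log c + Q = 0
    have h1 := hq0.ne'
    have h2 := hc.ne
    simp only [a]
    field_simp
    ring
  have hgb : 0 ≤ pressure T p q b := by
    refine le_trans (le_of_eq ?_) (pressure_bounds hN hm1 hT hp hb hq).1
    change 0 = -(b * (q - 1)) * Real.log lam + Q
    have h1 := hq0.ne'
    have h2 := hl.ne
    simp only [b]
    field_simp
    ring
  have hab : a ≤ b := by
    by_contra hab
    have := pressure_strictMonoOn hN hm1 hT hp hq hb ha (not_le.1 hab)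
    linarith
  have hcont : ContinuousOn (pressure T p q) (Set.Icc a b) := by
    have hlip : LipschitzOnWith (Real.toNNReal ((q - 1) * -Real.log c)) (pressure T p q)
        (Set.Icc a b) := by
      have aux : ∀ x ∈ Set.Icc a b, ∀ y ∈ Set.Icc a b, x ≤ y →
          dist (pressure T p q x) (pressure T p q y) ≤ ((q - 1) * -Real.log c) * dist x y := by
        intro x hx y hy hxy
        have hx0 : 0 < x := ha.trans_le hx.1
        have h := pressure_add_bounds hN hm1 hT hp hx0 hq (sub_nonneg.2 hxy)
        rw [add_sub_cancel] at h
        have h3 : 0 ≤ (y - x) * (q - 1) := mul_nonneg (sub_nonneg.2 hxy) hq0.le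
        rw [Real.dist_eq, Real.dist_eq, abs_sub_comm, abs_sub_comm x y,
          abs_of_nonneg (sub_nonneg.2 hxy), abs_le]
        constructor <;> nlinarith [h.1, h.2]
      refine LipschitzOnWith.of_dist_le_mul fun x hx y hy => ?_
      rw [Real.coe_toNNReal _ (mul_nonneg hq0.le (by linarith))]
      rcases le_total x y with hxy | hxy
      · exact aux x hx y hy hxy
      · rw [dist_comm, dist_comm x]
        exact aux y hy x hx hxy
    exact hlip.continuousOn
  obtain ⟨s, hs, hs0⟩ := intermediate_value_Icc hab hcont ⟨hga, hgb⟩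
  exact ⟨s, ha.trans_le hs.1, hs0⟩

end Pressure

/-! ### Reindexing and resampling of i.i.d. families. -/

section ProductLaws

variable {ι κ X : Type*} [MeasurableSpace X]

/-- Reindexing an i.i.d. family along an injection does not change its law. -/
theorem infinitePi_map_comp (ν : Measure X) [IsProbabilityMeasure ν] {f : ι → κ} {g : κ → ι}
    (hgf : Function.LeftInverse g f) :
    (Measure.infinitePi fun _ : κ => ν).map (fun ω i => ω (f i)) =
      Measure.infinitePi fun _ : ι => ν := by
  refine Measure.eq_infinitePi (μ := fun _ : ι => ν) fun s t ht => ?_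
  rw [Measure.map_apply (by fun_prop) (MeasurableSet.pi s.countable_toSet fun i _ => ht i)]
  have : (fun (ω : κ → X) i => ω (f i)) ⁻¹' Set.pi s t =
      Set.pi (s.map ⟨f, hgf.injective⟩) fun k => t (g k) := by
    ext ω
    simp [Set.mem_pi, hgf _]
  rw [this, Measure.infinitePi_pi _ fun k _ => ht (g k), Finset.prod_map]
  simp [hgf _]

open Classical in
/-- Replacing part of an i.i.d. family by an independent copy does not change its law. -/
theorem infinitePi_map_merge (ν : Measure X) [IsProbabilityMeasure ν] (S : Set ι) :
    ((Measure.infinitePi fun _ : ι => ν).prod (Measure.infinitePi fun _ : ι => ν)).map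
      (fun x i => if i ∈ S then x.1 i else x.2 i) = Measure.infinitePi fun _ : ι => ν := by
  have hmeas : Measurable fun (x : (ι → X) × (ι → X)) (i : ι) =>
      if i ∈ S then x.1 i else x.2 i := by
    refine measurable_pi_lambda _ fun i => ?_
    split_ifs <;> fun_prop
  refine Measure.eq_infinitePi (μ := fun _ : ι => ν) fun s t ht => ?_
  rw [Measure.map_apply hmeas (MeasurableSet.pi s.countable_toSet fun i _ => ht i)]
  have : (fun (x : (ι → X) × (ι → X)) (i : ι) => if i ∈ S then x.1 i else x.2 i) ⁻¹' Set.pi s t =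
      (Set.pi (s.filter (· ∈ S)) t) ×ˢ (Set.pi (s.filter (· ∉ S)) t) := by
    ext x
    simp only [Set.mem_preimage, Set.mem_pi, Set.mem_prod, Finset.mem_coe, Finset.mem_filter]
    constructor
    · intro h
      exact ⟨fun i hi => by simpa [hi.2] using h i hi.1, fun i hi => by simpa [hi.2] using h i hi.1⟩
    · rintro ⟨h1, h2⟩ i hi
      by_cases hiS : i ∈ S
      · simpa [hiS] using h1 i ⟨hi, hiS⟩
      · simpa [hiS] using h2 i ⟨hi, hiS⟩
  rw [this, Measure.prod_prod, Measure.infinitePi_pi _ fun k _ => ht k,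
    Measure.infinitePi_pi _ fun k _ => ht k, Finset.prod_filter_mul_prod_filter_not]

end ProductLaws

/-! ### Self-similarity of the Bernoulli measure and of the random projection. -/

section CodeSpace

variable {N m : ℕ}

instance (p : PMF (Fin m)) : IsProbabilityMeasure (bernoulliMeasure p) := by
  unfold bernoulliMeasure
  infer_instance

instance (ν : Measure (E N)) [IsProbabilityMeasure ν] :
    IsProbabilityMeasure (displacementLaw m ν) := by
  unfold displacementLaw
  infer_instance

/-- The infinite word obtained by prepending a letter. -/
def consWord (b : Fin m) (j : ℕ → Fin m) : ℕ → Fin m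
  | 0 => b
  | n + 1 => j n

theorem measurable_consWord : Measurable fun x : Fin m × (ℕ → Fin m) => consWord x.1 x.2 := by
  refine measurable_pi_lambda _ fun n => ?_
  cases n with
  | zero => exact measurable_fst
  | succ n => exact (measurable_pi_apply n).comp measurable_snd

theorem measurable_consWord_right (b : Fin m) : Measurable (consWord b) :=
  measurable_consWord.comp measurable_prodMk_left

/-- The first letter is independent of the shifted word, which again has the Bernoulli law. -/
theorem bernoulliMeasure_eq_map (p : PMF (Fin m)) :
    (p.toMeasure.prod (bernoulliMeasure p)).map (fun x => consWord x.1 x.2) =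
      bernoulliMeasure p := by
  refine Measure.eq_infinitePi (μ := fun _ : ℕ => p.toMeasure) fun s t ht => ?_
  rw [Measure.map_apply measurable_consWord
    (MeasurableSet.pi s.countable_toSet fun i _ => ht i)]
  obtain ⟨k, hk⟩ : ∃ k, s ⊆ Finset.range (k + 1) :=
    ⟨s.sup id, fun i hi => Finset.mem_range.2 (Nat.lt_succ_of_le (Finset.le_sup (f := id) hi))⟩
  -- Padding with the full alphabet turns the index set into an initial segment, from which position
  -- 0 can be split off.
  let t' : ℕ → Set (Fin m) := fun n => if n ∈ s then t n else Set.univ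
  have hprod : ∏ i ∈ s, p.toMeasure (t i) = ∏ i ∈ Finset.range (k + 1), p.toMeasure (t' i) := by
    rw [← Finset.prod_subset hk]
    · exact Finset.prod_congr rfl fun i hi => by simp [t', hi]
    · intro i _ hi
      simp [t', hi]
  have hset : (fun x : Fin m × (ℕ → Fin m) => consWord x.1 x.2) ⁻¹' Set.pi s t =
      t' 0 ×ˢ Set.pi (Finset.range k) fun n => t' (n + 1) := by
    ext ⟨b, j⟩
    simp only [Set.mem_preimage, Set.mem_pi, Set.mem_prod, Finset.mem_coe, Finset.mem_range]
    constructor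
    · intro h
      constructor
      · by_cases h0 : 0 ∈ s
        · simpa [t', h0, consWord] using h 0 h0
        · simp [t', h0]
      · intro n _
        by_cases hn : n + 1 ∈ s
        · simpa [t', hn, consWord] using h (n + 1) hn
        · simp [t', hn]
    · rintro ⟨h0, h1⟩ n hn
      cases n with
      | zero => simpa [t', hn, consWord] using h0
      | succ n =>
        have := h1 n (by have := Finset.mem_range.1 (hk hn); omega)
        simpa [t', hn, consWord] using this
  rw [hset, Measure.prod_prod, hprod, Finset.prod_range_succ', mul_comm]
  congr 1
  exact Measure.infinitePi_pi _ fun n _ => MeasurableSet.of_discrete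

theorem lintegral_bernoulliMeasure (p : PMF (Fin m)) {f : (ℕ → Fin m) → ENNReal}
    (hf : Measurable f) :
    ∫⁻ i, f i ∂(bernoulliMeasure p) =
      ∑ b, p b * ∫⁻ j, f (consWord b j) ∂(bernoulliMeasure p) := by
  conv_lhs => rw [← bernoulliMeasure_eq_map p]
  rw [lintegral_map hf measurable_consWord,
    lintegral_prod (fun x => f (consWord x.1 x.2)) (hf.comp measurable_consWord).aemeasurable, lintegral_fintype]
  refine Finset.sum_congr rfl fun b _ => ?_
  rw [mul_comm, PMF.toMeasure_apply_singleton _ _ (MeasurableSet.singleton b)]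

theorem bernoulliMeasure_apply (p : PMF (Fin m)) {S : Set (ℕ → Fin m)} (hS : MeasurableSet S) :
    bernoulliMeasure p S = ∑ b, p b * bernoulliMeasure p (consWord b ⁻¹' S) := by
  have := lintegral_bernoulliMeasure p (measurable_const.indicator hS (f := fun _ => (1 : ENNReal)))
  rw [lintegral_indicator_const hS, one_mul] at this
  rw [this]
  refine Finset.sum_congr rfl fun b _ => ?_
  congr 1
  have h2 : ∀ j, S.indicator (fun _ => (1 : ENNReal)) (consWord b j) =
      (consWord b ⁻¹' S).indicator (fun _ => (1 : ENNReal)) j := fun j => rfl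
  simp only [h2]
  rw [lintegral_indicator_const (measurable_consWord_right b hS), one_mul]

theorem curtail_consWord (b : Fin m) (j : ℕ → Fin m) (k : ℕ) :
    curtail (consWord b j) (k + 1) = b :: curtail j k := by
  simp [curtail, List.ofFn_succ, consWord]

theorem curtail_zero (j : ℕ → Fin m) : curtail j 0 = [] := by
  simp [curtail]

theorem length_curtail (j : ℕ → Fin m) (k : ℕ) : (curtail j k).length = k := by
  simp [curtail]

variable {T : Fin m → E N →L[ℝ] E N} {lam c R : ℝ}

theorem norm_projection_term_le (hT : NormBounds T lam c) {ω : List (Fin m) → E N}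
    (hω : ∀ w, ‖ω w‖ ≤ R) (i : ℕ → Fin m) (k : ℕ) :
    ‖wordMap T (curtail i k) (ω (curtail i (k + 1)))‖ ≤ R * lam ^ k := by
  refine (ContinuousLinearMap.le_opNorm _ _).trans ?_
  rw [mul_comm]
  have := hT.norm_wordMap_le (curtail i k)
  rw [length_curtail] at this
  exact mul_le_mul (hω _) this (norm_nonneg _) ((norm_nonneg _).trans (hω []))

theorem summable_projection (hT : NormBounds T lam c) {ω : List (Fin m) → E N}
    (hω : ∀ w, ‖ω w‖ ≤ R) (i : ℕ → Fin m) :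
    Summable fun k : ℕ => wordMap T (curtail i k) (ω (curtail i (k + 1))) :=
  Summable.of_norm_bounded ((summable_geometric_of_lt_one hT.lam_pos.le hT.lam_lt_one).mul_left R)
    (norm_projection_term_le hT hω i)

theorem norm_projection_le (hT : NormBounds T lam c) {ω : List (Fin m) → E N}
    (hω : ∀ w, ‖ω w‖ ≤ R) (i : ℕ → Fin m) : ‖projection T ω i‖ ≤ R * (1 - lam)⁻¹ := by
  rw [← tsum_geometric_of_lt_one hT.lam_pos.le hT.lam_lt_one, ← tsum_mul_left]
  exact tsum_of_norm_bounded
    ((summable_geometric_of_lt_one hT.lam_pos.le hT.lam_lt_one).mul_left R).hasSum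
    (norm_projection_term_le hT hω i)

/-- The source of all recursions: below the letter `b` the projection is an affine image of the
projection for the family shifted by `b`, and for i.i.d. displacements that family has the same law.
-/
theorem projection_consWord (hT : NormBounds T lam c) {ω : List (Fin m) → E N}
    (hω : ∀ w, ‖ω w‖ ≤ R) (b : Fin m) (j : ℕ → Fin m) :
    projection T ω (consWord b j) = ω [b] + T b (projection T (fun w => ω (b :: w)) j) := by
  unfold projection
  rw [(summable_projection hT hω _).tsum_eq_zero_add,
    (T b).map_tsum (summable_projection hT (fun w => hω (b :: w)) j)]
  congr 1
  refine tsum_congr fun k => ?_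
  rw [curtail_consWord, curtail_consWord, wordMap_cons]
  rfl

/-- Displacements of norm more than `R` are replaced by `0`. -/
noncomputable def clip (R : ℝ) (ω : List (Fin m) → E N) : List (Fin m) → E N :=
  fun w => if ‖ω w‖ ≤ R then ω w else 0

theorem norm_clip_le (hR : 0 ≤ R) (ω : List (Fin m) → E N) (w : List (Fin m)) :
    ‖clip R ω w‖ ≤ R := by
  unfold clip
  split_ifs with h
  · exact h
  · simpa using hR

theorem clip_eq_self {ω : List (Fin m) → E N} (hω : ∀ w, ‖ω w‖ ≤ R) : clip R ω = ω := by
  ext1 w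
  rw [clip, if_pos (hω w)]

theorem measurable_clip_apply (R : ℝ) (w : List (Fin m)) :
    Measurable fun ω : List (Fin m) → E N => clip R ω w := by
  unfold clip
  have h : Measurable fun ω : List (Fin m) → E N => ω w := measurable_pi_apply w
  exact Measurable.ite (measurableSet_le h.norm measurable_const) h measurable_const

/-- The projection for clipped displacements. -/
noncomputable def clipProj (T : Fin m → E N →L[ℝ] E N) (R : ℝ) (ω : List (Fin m) → E N)
    (i : ℕ → Fin m) : E N := projection T (clip R ω) i

theorem clipProj_consWord (hT : NormBounds T lam c) (hR : 0 ≤ R) (ω : List (Fin m) → E N)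
    (b : Fin m) (j : ℕ → Fin m) :
    clipProj T R ω (consWord b j) =
      clip R ω [b] + T b (clipProj T R (fun w => ω (b :: w)) j) :=
  projection_consWord hT (norm_clip_le hR ω) b j

/-- Clipping makes the series converge at every `ω`, not only at almost every one. The projection is
then a pointwise limit everywhere of partial sums, each depending on finitely many letters. -/
theorem measurable_clipProj (hT : NormBounds T lam c) (hR : 0 ≤ R) :
    Measurable fun x : (List (Fin m) → E N) × (ℕ → Fin m) => clipProj T R x.1 x.2 := by
  refine measurable_of_tendsto_metrizable (f := fun n x => ∑ k ∈ Finset.range n,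
    wordMap T (curtail x.2 k) (clip R x.1 (curtail x.2 (k + 1)))) (fun n => ?_) ?_
  · refine Finset.measurable_sum _ fun k _ => ?_
    let g : (List (Fin m) → E N) × (Fin (k + 1) → Fin m) → E N := fun y =>
      wordMap T (List.ofFn fun j : Fin k => y.2 j.castSucc) (clip R y.1 (List.ofFn y.2))
    have hg : Measurable g := by
      refine measurable_from_prod_countable_left fun v => ?_
      exact (wordMap T (List.ofFn fun j : Fin k => v j.castSucc)).measurable.comp
        (measurable_clip_apply R (List.ofFn v))
    have hr : Measurable fun x : (List (Fin m) → E N) × (ℕ → Fin m) =>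
        (x.1, fun j : Fin (k + 1) => x.2 j) := by fun_prop
    exact hg.comp hr
  · rw [tendsto_pi_nhds]
    intro x
    exact (summable_projection hT (norm_clip_le hR x.1) x.2).hasSum.tendsto_sum_nat

end CodeSpace

/-! ### The transfer operator, its potential, and comparison of recursions. -/

section Transfer

variable {N m : ℕ}

/-- The weighted transfer operator `f ↦ (A ↦ ∑_a p_a^{x+1} f(A T_a))`. -/
noncomputable def transfer (T : Fin m → E N →L[ℝ] E N) (p : PMF (Fin m)) (x : ℝ)
    (f : (E N →L[ℝ] E N) → ℝ≥0∞) (A : E N →L[ℝ] E N) : ℝ≥0∞ :=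
  ∑ a, p a ^ (x + 1) * f (A * T a)

/-- The function `A ↦ φ^s(A)^{-x}`. -/
noncomputable def svfPow (s x : ℝ) (A : E N →L[ℝ] E N) : ℝ≥0∞ :=
  ENNReal.ofReal (singularValueFunction s A) ^ (-x)

/-- The `θ`-discounted sum of the iterates of the transfer operator at `φ^s(·)^{-x}`. -/
noncomputable def potential (T : Fin m → E N →L[ℝ] E N) (p : PMF (Fin m)) (s x : ℝ) (θ : ℝ≥0∞)
    (A : E N →L[ℝ] E N) : ℝ≥0∞ :=
  ∑' k : ℕ, θ ^ k * (transfer T p x)^[k] (svfPow s x) A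

variable {T : Fin m → E N →L[ℝ] E N} {lam c : ℝ} {p : PMF (Fin m)} {s x : ℝ} {θ : ℝ≥0∞}

theorem pow_mul_iterate_le_potential (k : ℕ) (A : E N →L[ℝ] E N) :
    θ ^ k * (transfer T p x)^[k] (svfPow s x) A ≤ potential T p s x θ A :=
  ENNReal.le_tsum (f := fun k : ℕ => θ ^ k * (transfer T p x)^[k] (svfPow s x) A) k

theorem svfPow_le_potential (A : E N →L[ℝ] E N) : svfPow s x A ≤ potential T p s x θ A := by
  simpa using pow_mul_iterate_le_potential (T := T) (p := p) (s := s) (x := x) (θ := θ) 0 A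

/-- Applying `θ` times the operator shifts the index of the series and loses only the term `k = 0`.
Thus the operator contracts the potential at rate `θ⁻¹`. -/
theorem mul_transfer_potential_le (A : E N →L[ℝ] E N) :
    θ * transfer T p x (potential T p s x θ) A ≤ potential T p s x θ A := by
  have h1 : θ * transfer T p x (potential T p s x θ) A =
      ∑' k : ℕ, θ ^ (k + 1) * (transfer T p x)^[k + 1] (svfPow s x) A := by
    have e1 : transfer T p x (potential T p s x θ) A =
        ∑ a, p a ^ (x + 1) * ∑' k : ℕ, θ ^ k * (transfer T p x)^[k] (svfPow s x) (A * T a) := rfl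
    have e2 : ∀ k, (transfer T p x)^[k + 1] (svfPow s x) A =
        ∑ a, p a ^ (x + 1) * (transfer T p x)^[k] (svfPow s x) (A * T a) := fun k => by
      rw [Function.iterate_succ_apply']
      rfl
    simp only [e1, e2, Finset.mul_sum, ← ENNReal.tsum_mul_left]
    rw [Summable.tsum_finsetSum fun _ _ => ENNReal.summable]
    refine Finset.sum_congr rfl fun a _ => tsum_congr fun k => ?_
    ring
  rw [h1, potential]
  exact ENNReal.tsum_comp_le_tsum_of_injective (add_left_injective 1)
    (fun k : ℕ => θ ^ k * (transfer T p x)^[k] (svfPow s x) A)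

/-- A bounded function satisfying a contracting recursive inequality is dominated by any
excessive function that dominates the inhomogeneity. -/
theorem le_of_recursive (hT : NormBounds T lam c) {w : Fin m → ℝ≥0∞} {J Z : (E N →L[ℝ] E N) → ℝ≥0∞}
    {C ρ : ℝ≥0∞} (hJ1 : ∀ A, J A ≤ 1)
    (hJ : ∀ A : E N →L[ℝ] E N, Function.Injective A → J A ≤ (∑ a, w a * J (A * T a)) + C * Z A)
    (hZ : ∀ A : E N →L[ℝ] E N, Function.Injective A → ∑ a, w a * Z (A * T a) ≤ ρ * Z A)
    (hw : ∑ a, w a < 1) {A : E N →L[ℝ] E N} (hA : Function.Injective A) :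
    J A ≤ C * (1 - ρ)⁻¹ * Z A := by
  -- After `n` iterations the remainder is `(∑ w) ^ n`, by the a priori bound `J ≤ 1`; it vanishes
  -- in the limit. The inhomogeneities form a geometric series of ratio `ρ`.
  have key : ∀ n : ℕ, ∀ A : E N →L[ℝ] E N, Function.Injective A →
      J A ≤ (∑ a, w a) ^ n + C * (∑ k ∈ Finset.range n, ρ ^ k) * Z A := by
    intro n
    induction n with
    | zero =>
      intro A _
      simpa using hJ1 A
    | succ n ih =>
      intro A hA
      refine (hJ A hA).trans ?_
      have h1 : ∑ a, w a * J (A * T a) ≤ ∑ a, w a *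
          ((∑ a, w a) ^ n + C * (∑ k ∈ Finset.range n, ρ ^ k) * Z (A * T a)) :=
        Finset.sum_le_sum fun a _ =>
          mul_le_mul_right (ih (A * T a) (mul_injective hA (hT.inj a))) _
      have h2 : ∑ a, w a * ((∑ a, w a) ^ n + C * (∑ k ∈ Finset.range n, ρ ^ k) * Z (A * T a)) =
          (∑ a, w a) ^ (n + 1) +
            C * (∑ k ∈ Finset.range n, ρ ^ k) * ∑ a, w a * Z (A * T a) := by
        simp only [mul_add, Finset.sum_add_distrib]
        rw [← Finset.sum_mul, pow_succ', Finset.mul_sum Finset.univ _ (C * _)]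
        congr 1
        exact Finset.sum_congr rfl fun a _ => by ring
      rw [h2] at h1
      calc (∑ a, w a * J (A * T a)) + C * Z A
          ≤ ((∑ a, w a) ^ (n + 1) + C * (∑ k ∈ Finset.range n, ρ ^ k) * (ρ * Z A)) + C * Z A := by
            gcongr
            exact h1.trans (by gcongr; exact hZ A hA)
        _ = (∑ a, w a) ^ (n + 1) + C * (∑ k ∈ Finset.range (n + 1), ρ ^ k) * Z A := by
            rw [Finset.sum_range_succ']
            simp only [pow_succ, ← Finset.sum_mul, pow_zero]
            ring
  have hlim : Tendsto (fun n : ℕ => (∑ a, w a) ^ n + C * (1 - ρ)⁻¹ * Z A) atTop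
      (𝓝 (0 + C * (1 - ρ)⁻¹ * Z A)) :=
    (ENNReal.tendsto_pow_atTop_nhds_zero_of_lt_one hw).add_const _
  rw [zero_add] at hlim
  refine ge_of_tendsto' hlim fun n => (key n A hA).trans ?_
  gcongr
  rw [← ENNReal.tsum_geometric]
  exact ENNReal.sum_le_tsum _

theorem le_inv_mul_iff_ennreal {a y z : ℝ≥0∞} (h0 : a ≠ 0) (ht : a ≠ ⊤) :
    y ≤ a⁻¹ * z ↔ a * y ≤ z := by
  rw [mul_comm a⁻¹, ← div_eq_mul_inv, ENNReal.le_div_iff_mul_le (Or.inl h0) (Or.inl ht), mul_comm]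

theorem sum_weight_ennreal (p : PMF (Fin m)) : ∑ a, p a = 1 := by
  have := p.tsum_coe
  rwa [tsum_fintype] at this

/-- Hölder's inequality between the iterates with exponents `x - 1` and `x`. -/
theorem iterate_transfer_le_rpow (hp : ∀ i, 0 < p i) (hx : 1 < x) (k : ℕ) (A : E N →L[ℝ] E N) :
    (transfer T p (x - 1))^[k] (svfPow s (x - 1)) A ≤
      ((transfer T p x)^[k] (svfPow s x) A) ^ ((x - 1) / x) := by
  have hx0 : 0 < x := by linarith
  have ht0 : 0 < (x - 1) / x := div_pos (by linarith) hx0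
  induction k generalizing A with
  | zero =>
    simp only [Function.iterate_zero, id_eq, svfPow]
    rw [← ENNReal.rpow_mul]
    refine le_of_eq ?_
    congr 1
    field_simp
  | succ k ih =>
    rw [Function.iterate_succ_apply', Function.iterate_succ_apply']
    set Y := (transfer T p x)^[k] (svfPow s x)
    have h1 : transfer T p (x - 1) ((transfer T p (x - 1))^[k] (svfPow s (x - 1))) A ≤
        ∑ a, p a * (p a ^ x * Y (A * T a)) ^ ((x - 1) / x) := by
      refine Finset.sum_le_sum fun a _ => ?_
      refine (mul_le_mul_right (ih (A * T a)) _).trans (le_of_eq ?_)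
      rw [ENNReal.mul_rpow_of_nonneg _ _ ht0.le, ← ENNReal.rpow_mul, ← mul_assoc]
      congr 1
      rw [show x * ((x - 1) / x) = x - 1 by field_simp, mul_comm,
        ENNReal.rpow_add _ _ (hp a).ne' (p.apply_ne_top a), ENNReal.rpow_one]
    refine h1.trans ?_
    rw [← ENNReal.rpow_inv_le_iff ht0]
    have hinv : 1 ≤ ((x - 1) / x)⁻¹ := by
      rw [one_le_inv₀ ht0, div_le_one hx0]
      linarith
    refine (ENNReal.rpow_arith_mean_le_arith_mean_rpow _ _ _ (sum_weight_ennreal p) hinv).trans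
      (le_of_eq ?_)
    refine Finset.sum_congr rfl fun a _ => ?_
    rw [← ENNReal.rpow_mul, mul_inv_cancel₀ ht0.ne', ENNReal.rpow_one, ← mul_assoc, add_comm x,
      ENNReal.rpow_add _ _ (hp a).ne' (p.apply_ne_top a), ENNReal.rpow_one]

/-- Summing Hölder's inequality geometrically: `φ^s(A)^{-1}` times the potential of order `x - 1`
is dominated by the potential of order `x`. -/
theorem exists_svfPow_mul_potential_le (hp : ∀ i, 0 < p i) (hx : 1 < x) (hθ : 1 < θ)
    (hθt : θ ≠ ⊤) :
    ∃ θ' C : ℝ≥0∞, 1 < θ' ∧ θ' ≠ ⊤ ∧ C ≠ ⊤ ∧ ∀ A : E N →L[ℝ] E N,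
      svfPow s 1 A * potential T p s (x - 1) θ' A ≤ C * potential T p s x θ A := by
  have hx0 : 0 < x := by linarith
  have ht0 : 0 < (x - 1) / x := div_pos (by linarith) hx0
  -- Hölder turns the rate `θ` into `θ ^ ((x - 1) / x) = η * η`. Discounting by only one `η` leaves
  -- the summable factor `η⁻¹ ^ k`, while `Z ^ (1 / x)` and `Z ^ ((x - 1) / x)` recombine to `Z`.
  have hθ' : 1 < θ ^ ((x - 1) / x / 2) := ENNReal.one_lt_rpow hθ (by positivity)
  have hθ't : θ ^ ((x - 1) / x / 2) ≠ ⊤ := ENNReal.rpow_ne_top_of_nonneg (by positivity) hθt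
  have hsq : θ ^ ((x - 1) / x) = θ ^ ((x - 1) / x / 2) * θ ^ ((x - 1) / x / 2) := by
    rw [← ENNReal.rpow_add _ _ (by positivity) hθt]
    congr 1
    ring
  set η := θ ^ ((x - 1) / x / 2)
  have hη0 : η ≠ 0 := (zero_lt_one.trans hθ').ne'
  refine ⟨η, (1 - η⁻¹)⁻¹, hθ', hθ't, ?_, fun A => ?_⟩
  · refine ENNReal.inv_ne_top.2 (tsub_pos_of_lt ?_).ne'
    exact ENNReal.inv_lt_one.2 hθ'
  · set Z := potential T p s x θ A
    have h0 : svfPow s 1 A ≤ Z ^ (1 / x) := by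
      have h : svfPow s 1 A = (svfPow s x A) ^ (1 / x) := by
        unfold svfPow
        rw [← ENNReal.rpow_mul]
        congr 1
        field_simp
      rw [h]
      exact ENNReal.rpow_le_rpow (svfPow_le_potential A) (by positivity)
    have hk : ∀ k : ℕ, θ ^ k ≠ 0 := fun k => pow_ne_zero k (zero_lt_one.trans hθ).ne'
    have hk' : ∀ k : ℕ, θ ^ k ≠ ⊤ := fun k => ENNReal.pow_ne_top hθt
    have hterm : ∀ k : ℕ, svfPow s 1 A *
        (η ^ k * (transfer T p (x - 1))^[k] (svfPow s (x - 1)) A) ≤ η⁻¹ ^ k * Z := by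
      intro k
      have h1 : (transfer T p x)^[k] (svfPow s x) A ≤ (θ ^ k)⁻¹ * Z := by
        rw [le_inv_mul_iff_ennreal (hk k) (hk' k)]
        exact pow_mul_iterate_le_potential k A
      have h2 := (iterate_transfer_le_rpow (T := T) (s := s) hp hx k A).trans
        (ENNReal.rpow_le_rpow h1 ht0.le)
      have h3 : ((θ ^ k)⁻¹ * Z) ^ ((x - 1) / x) = (η * η)⁻¹ ^ k * Z ^ ((x - 1) / x) := by
        rw [ENNReal.mul_rpow_of_nonneg _ _ ht0.le, ENNReal.inv_rpow, ← ENNReal.rpow_natCast_mul,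
          mul_comm (k : ℝ), ENNReal.rpow_mul_natCast, hsq, ENNReal.inv_pow]
      rw [h3] at h2
      calc svfPow s 1 A * (η ^ k * (transfer T p (x - 1))^[k] (svfPow s (x - 1)) A)
          ≤ Z ^ (1 / x) * (η ^ k * ((η * η)⁻¹ ^ k * Z ^ ((x - 1) / x))) := by gcongr
        _ = (η ^ k * (η * η)⁻¹ ^ k) * (Z ^ (1 / x) * Z ^ ((x - 1) / x)) := by ring
        _ = η⁻¹ ^ k * Z := by
          congr 1
          · rw [← mul_pow, ENNReal.mul_inv (Or.inl hη0) (Or.inl hθ't), ← mul_assoc,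
              ENNReal.mul_inv_cancel hη0 hθ't, one_mul]
          · rw [← ENNReal.rpow_add_of_nonneg _ _ (by positivity) ht0.le,
              show 1 / x + (x - 1) / x = 1 by field_simp; ring, ENNReal.rpow_one]
    calc svfPow s 1 A * potential T p s (x - 1) η A
        = ∑' k : ℕ, svfPow s 1 A *
            (η ^ k * (transfer T p (x - 1))^[k] (svfPow s (x - 1)) A) := by
          rw [potential, ENNReal.tsum_mul_left]
      _ ≤ ∑' k : ℕ, η⁻¹ ^ k * Z := ENNReal.tsum_le_tsum hterm
      _ = (1 - η⁻¹)⁻¹ * Z := by rw [ENNReal.tsum_mul_right, ENNReal.tsum_geometric]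

theorem exists_svfPow_mul_le (hT : NormBounds T lam c) (hs : 0 < s) :
    ∃ K : ℝ≥0∞, K ≠ ⊤ ∧ ∀ (A : E N →L[ℝ] E N), Function.Injective A → ∀ a,
      svfPow s 1 (A * T a) ≤ K * svfPow s 1 A := by
  choose K hK0 hK using fun a => exists_svf_le_mul (hT.inj a) hs
  refine ⟨ENNReal.ofReal (∑ a, K a), ENNReal.ofReal_ne_top, fun A hA a => ?_⟩
  have h1 := svf_pos hA hs
  have h2 := svf_pos (mul_injective hA (hT.inj a)) hs
  unfold svfPow
  rw [ENNReal.rpow_neg_one, ENNReal.rpow_neg_one, ← ENNReal.ofReal_inv_of_pos h1,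
    ← ENNReal.ofReal_inv_of_pos h2,
    ← ENNReal.ofReal_mul (Finset.sum_nonneg fun a _ => (hK0 a).le)]
  refine ENNReal.ofReal_le_ofReal ?_
  have h3 : K a ≤ ∑ a, K a :=
    Finset.single_le_sum (f := K) (fun a _ => (hK0 a).le) (Finset.mem_univ a)
  rw [inv_le_iff_one_le_mul₀ h2, ← div_eq_mul_inv, div_mul_eq_mul_div, one_le_div h1]
  exact (hK a A hA).trans (mul_le_mul_of_nonneg_right h3 h2.le)

/-- A single letter's term is at most the whole transfer sum, which excessiveness bounds by the
potential. Appending a letter therefore costs a bounded factor. -/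
theorem exists_potential_mul_le (hp : ∀ i, 0 < p i) (hx : 0 < x) (hθ : 1 ≤ θ) :
    ∃ K : ℝ≥0∞, K ≠ ⊤ ∧ ∀ (A : E N →L[ℝ] E N) (a : Fin m),
      potential T p s x θ (A * T a) ≤ K * potential T p s x θ A := by
  have hpa : ∀ a, p a ^ (x + 1) ≠ 0 := fun a =>
    (ENNReal.rpow_pos (hp a) (p.apply_ne_top a)).ne'
  have hpt : ∀ a, p a ^ (x + 1) ≠ ⊤ := fun a =>
    ENNReal.rpow_ne_top_of_nonneg (by linarith) (p.apply_ne_top a)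
  refine ⟨∑ a, (p a ^ (x + 1))⁻¹, ?_, fun A a => ?_⟩
  · rw [ENNReal.sum_ne_top]
    exact fun a _ => ENNReal.inv_ne_top.2 (hpa a)
  · have h1 : p a ^ (x + 1) * potential T p s x θ (A * T a) ≤
        transfer T p x (potential T p s x θ) A :=
      Finset.single_le_sum (f := fun a => p a ^ (x + 1) * potential T p s x θ (A * T a))
        (fun _ _ => zero_le) (Finset.mem_univ a)
    have h2 : transfer T p x (potential T p s x θ) A ≤ potential T p s x θ A :=
      (le_mul_of_one_le_left zero_le hθ).trans (mul_transfer_potential_le A)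
    have h3 : potential T p s x θ (A * T a) ≤ (p a ^ (x + 1))⁻¹ * potential T p s x θ A := by
      rw [le_inv_mul_iff_ennreal (hpa a) (hpt a)]
      exact h1.trans h2
    refine h3.trans (mul_le_mul_left ?_ _)
    exact Finset.single_le_sum (f := fun a => (p a ^ (x + 1))⁻¹) (fun _ _ => zero_le)
      (Finset.mem_univ a)

/-- The factor of `a ^ x` may be taken arbitrarily close to 1, so that the recursion for the
correlation moments still contracts. The cases are `b` small or large relative to `a`. -/
theorem exists_add_rpow_le {κ : ℝ≥0∞} (hx : 0 < x) (hκ : 1 < κ) (hκt : κ ≠ ⊤) :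
    ∃ C : ℝ≥0∞, C ≠ ⊤ ∧ ∀ a b : ℝ≥0∞, (a + b) ^ x ≤ κ * a ^ x + C * b ^ x := by
  have h1 : 1 < κ ^ (1 / x) := ENNReal.one_lt_rpow hκ (by positivity)
  have h1t : κ ^ (1 / x) ≠ ⊤ := ENNReal.rpow_ne_top_of_nonneg (by positivity) hκt
  set η := κ ^ (1 / x) - 1 with hη
  have hη0 : η ≠ 0 := (tsub_pos_of_lt h1).ne'
  have hηt : η ≠ ⊤ := ENNReal.sub_ne_top h1t
  have hη1 : 1 + η = κ ^ (1 / x) := add_tsub_cancel_of_le h1.le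
  refine ⟨(η⁻¹ + 1) ^ x, ENNReal.rpow_ne_top_of_nonneg hx.le
    (ENNReal.add_ne_top.2 ⟨ENNReal.inv_ne_top.2 hη0, ENNReal.one_ne_top⟩), fun a b => ?_⟩
  rcases le_total b (η * a) with hb | hb
  · refine le_trans ?_ le_self_add
    calc (a + b) ^ x ≤ (κ ^ (1 / x) * a) ^ x := by
          refine ENNReal.rpow_le_rpow ?_ hx.le
          rw [← hη1, add_mul, one_mul]
          gcongr
      _ = κ * a ^ x := by
          rw [ENNReal.mul_rpow_of_nonneg _ _ hx.le, ← ENNReal.rpow_mul, one_div_mul_cancel hx.ne',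
            ENNReal.rpow_one]
  · refine le_trans ?_ le_add_self
    rw [← ENNReal.mul_rpow_of_nonneg _ _ hx.le]
    refine ENNReal.rpow_le_rpow ?_ hx.le
    rw [add_mul, one_mul]
    gcongr
    rwa [le_inv_mul_iff_ennreal hη0 hηt]

theorem lintegral_rpow_le_rpow {Ω : Type*} [MeasurableSpace Ω] (P : Measure Ω)
    [IsProbabilityMeasure P] {f : Ω → ℝ≥0∞} (hf : Measurable f) {a b : ℝ} (ha : 0 < a)
    (hab : a ≤ b) : ∫⁻ ω, f ω ^ a ∂P ≤ (∫⁻ ω, f ω ^ b ∂P) ^ (a / b) := by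
  have h := eLpNorm'_le_eLpNorm'_of_exponent_le (f := f) ha hab P hf.aestronglyMeasurable
  simp only [eLpNorm'_eq_lintegral_enorm, enorm_eq_self] at h
  have h2 := ENNReal.rpow_le_rpow h ha.le
  rwa [← ENNReal.rpow_mul, ← ENNReal.rpow_mul, one_div_mul_cancel ha.ne', ENNReal.rpow_one,
    one_div_mul_eq_div] at h2

end Transfer

/-! ### Correlation and concentration moments. -/

section Correlation

variable {N m : ℕ}

/-- The mass of the infinite words projected into the ellipsoid `{z | ‖A (y - z)‖ ≤ r}`. -/
noncomputable def nearMass (T : Fin m → E N →L[ℝ] E N) (p : PMF (Fin m)) (R : ℝ)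
    (A : E N →L[ℝ] E N) (r : ℝ) (y : E N) (ω : List (Fin m) → E N) : ℝ≥0∞ :=
  bernoulliMeasure p {j | ‖A (y - clipProj T R ω j)‖ ≤ r}

/-- The expected `x`-th correlation moment of the projected measure at scale `A⁻¹ B(0, r)`. -/
noncomputable def corrMoment (T : Fin m → E N →L[ℝ] E N) (p : PMF (Fin m)) (R : ℝ)
    (ν : Measure (E N)) [IsProbabilityMeasure ν] (x : ℝ) (A : E N →L[ℝ] E N) (r : ℝ) : ℝ≥0∞ :=
  ∫⁻ ω, ∫⁻ i, nearMass T p R A r (clipProj T R ω i) ω ^ x ∂(bernoulliMeasure p)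
    ∂(displacementLaw m ν)

/-- The largest expected `x`-th moment of the mass of a translate of `A⁻¹ B(0, r)`. -/
noncomputable def concMoment (T : Fin m → E N →L[ℝ] E N) (p : PMF (Fin m)) (R : ℝ)
    (ν : Measure (E N)) [IsProbabilityMeasure ν] (x : ℝ) (A : E N →L[ℝ] E N) (r : ℝ) : ℝ≥0∞ :=
  ⨆ y : E N, ∫⁻ ω, nearMass T p R A r y ω ^ x ∂(displacementLaw m ν)

variable {T : Fin m → E N →L[ℝ] E N} {lam c R : ℝ} {p : PMF (Fin m)} {ν : Measure (E N)}
  [IsProbabilityMeasure ν] {x r : ℝ} {A : E N →L[ℝ] E N}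

theorem measurable_clipProj_comp (hT : NormBounds T lam c) (hR : 0 ≤ R) {α : Type*}
    [MeasurableSpace α] {f : α → List (Fin m) → E N} {g : α → ℕ → Fin m} (hf : Measurable f)
    (hg : Measurable g) : Measurable fun a => clipProj T R (f a) (g a) := by
  have h : Measurable fun a => (f a, g a) := hf.prodMk hg
  have e : (fun a => clipProj T R (f a) (g a)) =
      (fun x : (List (Fin m) → E N) × (ℕ → Fin m) => clipProj T R x.1 x.2) ∘
        fun a => (f a, g a) := by
    funext a
    rfl
  rw [e]
  exact (measurable_clipProj (T := T) hT hR).comp h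

theorem measurableSet_near (hT : NormBounds T lam c) (hR : 0 ≤ R) (A : E N →L[ℝ] E N) (r : ℝ)
    {α : Type*} [MeasurableSpace α] {y : α → E N} {f : α → List (Fin m) → E N}
    {g : α → ℕ → Fin m} (hy : Measurable y) (hf : Measurable f) (hg : Measurable g) :
    MeasurableSet {a | ‖A (y a - clipProj T R (f a) (g a))‖ ≤ r} :=
  measurableSet_le
    (A.measurable.comp (hy.sub (measurable_clipProj_comp hT hR hf hg))).norm measurable_const

theorem measurable_nearMass (hT : NormBounds T lam c) (hR : 0 ≤ R) (p : PMF (Fin m))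
    (A : E N →L[ℝ] E N) (r : ℝ) {α : Type*} [MeasurableSpace α] {y : α → E N}
    {f : α → List (Fin m) → E N} (hy : Measurable y) (hf : Measurable f) :
    Measurable fun a => nearMass T p R A r (y a) (f a) :=
  measurable_measure_prodMk_left (ν := bernoulliMeasure p)
    (measurableSet_near hT hR A r (hy.comp measurable_fst) (hf.comp measurable_fst)
      (measurable_snd (α := α)))

theorem nearMass_le_one (y : E N) (ω : List (Fin m) → E N) : nearMass T p R A r y ω ≤ 1 :=
  prob_le_one

theorem corrMoment_le_one (hx : 0 ≤ x) : corrMoment T p R ν x A r ≤ 1 := by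
  refine (lintegral_mono fun ω => lintegral_mono fun i =>
    ENNReal.rpow_le_one (nearMass_le_one _ _) hx).trans ?_
  simp

theorem concMoment_le_one (hx : 0 ≤ x) : concMoment T p R ν x A r ≤ 1 := by
  refine iSup_le fun y => (lintegral_mono fun ω =>
    ENNReal.rpow_le_one (nearMass_le_one _ _) hx).trans ?_
  simp

theorem clipProj_congr {ω ω' : List (Fin m) → E N} {i : ℕ → Fin m}
    (h : ∀ k, ω (curtail i (k + 1)) = ω' (curtail i (k + 1))) :
    clipProj T R ω i = clipProj T R ω' i := by
  unfold clipProj projection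
  refine tsum_congr fun k => ?_
  simp only [clip, h k]

theorem lintegral_shift (b : Fin m) {F : (List (Fin m) → E N) → ℝ≥0∞} (hF : Measurable F) :
    ∫⁻ ω, F (fun w => ω (b :: w)) ∂(displacementLaw m ν) = ∫⁻ ω, F ω ∂(displacementLaw m ν) := by
  have h := infinitePi_map_comp ν (f := List.cons b) (g := List.tail) fun _ => rfl
  unfold displacementLaw
  conv_rhs => rw [← h]
  rw [lintegral_map hF (by fun_prop)]

open Classical in
theorem lintegral_merge (S : Set (List (Fin m))) {F : (List (Fin m) → E N) → ℝ≥0∞}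
    (hF : Measurable F) :
    ∫⁻ ω, F ω ∂(displacementLaw m ν) =
      ∫⁻ ω, ∫⁻ ω', F (fun w => if w ∈ S then ω w else ω' w) ∂(displacementLaw m ν)
        ∂(displacementLaw m ν) := by
  have h := infinitePi_map_merge ν S
  have hmeas : Measurable fun (x : (List (Fin m) → E N) × (List (Fin m) → E N)) w =>
      if w ∈ S then x.1 w else x.2 w := by
    refine measurable_pi_lambda _ fun i => ?_
    split_ifs <;> fun_prop
  unfold displacementLaw
  conv_lhs => rw [← h]
  rw [lintegral_map hF hmeas]
  exact lintegral_prod _ (hF.comp hmeas).aemeasurable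

/-- Splitting by the first letter `b` replaces `A` by `A * T b` and pulls the centre back through
the affine map attached to `b`. -/
theorem nearMass_eq_sum (hT : NormBounds T lam c) (hR : 0 ≤ R) {S : Fin m → E N →L[ℝ] E N}
    (hS : ∀ b, T b * S b = 1) (y : E N) (ω : List (Fin m) → E N) :
    nearMass T p R A r y ω =
      ∑ b, p b * nearMass T p R (A * T b) r (S b (y - clip R ω [b])) fun w => ω (b :: w) := by
  unfold nearMass
  have hset : MeasurableSet {j | ‖A (y - clipProj T R ω j)‖ ≤ r} :=
    measurableSet_near hT hR A r measurable_const measurable_const measurable_id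
  rw [bernoulliMeasure_apply p hset]
  refine Finset.sum_congr rfl fun b _ => ?_
  congr 2
  ext j
  have h1 : T b (S b (y - clip R ω [b])) = y - clip R ω [b] := by
    rw [← mul_apply_eq_comp, hS]
    rfl
  simp only [Set.mem_preimage, Set.mem_ofPred_eq]
  rw [clipProj_consWord hT hR, mul_apply_eq_comp, map_sub (T b), h1, sub_sub]

/-- Splitting off the density above a high level: all but a small part of `ν` has bounded
density. -/
theorem exists_lintegral_le_of_absolutelyContinuous (hν : ν ≪ volume) (hνR : ∀ᵐ z ∂ν, ‖z‖ ≤ R)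
    {δ : ℝ≥0∞} (hδ : δ ≠ 0) :
    ∃ M : ℝ≥0∞, M ≠ ⊤ ∧ ∀ (H : E N → ℝ≥0∞) (B : ℝ≥0∞), Measurable H → (∀ z, H z ≤ B) →
      ∫⁻ z, H z ∂ν ≤ M * (∫⁻ z in Metric.closedBall 0 R, H z) + δ * B := by
  set f := ν.rnDeriv volume with hf
  have hfm : Measurable f := Measure.measurable_rnDeriv _ _
  have hfν : volume.withDensity f = ν := Measure.withDensity_rnDeriv_eq _ _ hν
  have hfin : ∀ᵐ z ∂ν, f z < ⊤ := hν.ae_le (Measure.rnDeriv_lt_top ν volume)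
  let G : ℕ → Set (E N) := fun n => {z | (n : ℝ≥0∞) < f z}
  have hGm : ∀ n, MeasurableSet (G n) := fun n => measurableSet_lt measurable_const hfm
  have hGanti : Antitone G := fun n k hnk z (hz : (k : ℝ≥0∞) < f z) =>
    show (n : ℝ≥0∞) < f z from lt_of_le_of_lt (Nat.cast_le.2 hnk) hz
  have hlim := tendsto_measure_iInter_atTop (μ := ν) (s := G)
    (fun n => (hGm n).nullMeasurableSet) hGanti ⟨0, measure_ne_top _ _⟩
  have hzero : ν (⋂ n, G n) = 0 := by
    refine measure_mono_null ?_ hfin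
    intro z hz
    simp only [Set.mem_iInter, G, Set.mem_ofPred_eq] at hz
    simp only [Set.mem_compl_iff, Set.mem_ofPred_eq, not_lt, top_le_iff]
    by_contra hne
    obtain ⟨n, hn⟩ := ENNReal.exists_nat_gt hne
    exact absurd (hz n) (not_lt.2 hn.le)
  rw [hzero] at hlim
  obtain ⟨n, hn⟩ := (hlim.eventually (gt_mem_nhds (pos_iff_ne_zero.2 hδ))).exists
  refine ⟨n, ENNReal.natCast_ne_top n, fun H B hH hB => ?_⟩
  have hball : ∀ᵐ z ∂ν, z ∈ Metric.closedBall (0 : E N) R := by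
    filter_upwards [hνR] with z hz
    simpa using hz
  have hres : ν.restrict (Metric.closedBall 0 R) = ν := Measure.restrict_eq_self_of_ae_mem hball
  rw [← lintegral_add_compl H (hGm n), add_comm]
  gcongr
  · calc ∫⁻ z in (G n)ᶜ, H z ∂ν
        = ∫⁻ z in (G n)ᶜ ∩ Metric.closedBall 0 R, H z ∂ν := by
          rw [← Measure.restrict_restrict (hGm n).compl, hres]
      _ = ∫⁻ z in (G n)ᶜ ∩ Metric.closedBall 0 R, f z * H z := by
          nth_rw 1 [← hfν]
          rw [restrict_withDensity ((hGm n).compl.inter measurableSet_closedBall),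
            lintegral_withDensity_eq_lintegral_mul _ hfm hH]
          rfl
      _ ≤ ∫⁻ z in (G n)ᶜ ∩ Metric.closedBall 0 R, n * H z := by
          refine setLIntegral_mono (measurable_const.mul hH) fun z hz => ?_
          gcongr
          have := hz.1
          simpa [G] using this
      _ = n * ∫⁻ z in (G n)ᶜ ∩ Metric.closedBall 0 R, H z := lintegral_const_mul _ hH
      _ ≤ n * ∫⁻ z in Metric.closedBall 0 R, H z := by
          gcongr
          exact Set.inter_subset_right
  · calc ∫⁻ z in G n, H z ∂ν ≤ ∫⁻ _ in G n, B ∂ν := lintegral_mono hB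
      _ = B * ν (G n) := setLIntegral_const _ _
      _ ≤ δ * B := by
          rw [mul_comm]
          gcongr
          exact hn.le

/-- One power of the mass is traded for a volume. Write `M ^ x` as the integral of `M ^ (x - 1)`
over the words `i` near the centre; a word near the centre is within `2 r` of such an `i`, so the
centre may be replaced by the projection of `i`. After Fubini, the `z` compatible with a fixed `i`
fill part of an ellipsoid of volume at most `v`. -/
theorem lintegral_nearMass_rpow_le (hT : NormBounds T lam c) (hR : 0 ≤ R) (hx : 1 ≤ x)
    {T₀ S : E N →L[ℝ] E N} (hS : T₀ * S = 1) {v : ℝ≥0∞}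
    (hv : ∀ y, volume {z : E N | ‖z‖ ≤ R ∧ ‖A (y - z)‖ ≤ r} ≤ v) (y : E N)
    (ω : List (Fin m) → E N) :
    ∫⁻ z in Metric.closedBall 0 R, nearMass T p R (A * T₀) r (S (y - z)) ω ^ x ≤
      v * ∫⁻ i, nearMass T p R (A * T₀) (2 * r) (clipProj T R ω i) ω ^ (x - 1)
        ∂(bernoulliMeasure p) := by
  let Q : Set (E N × (ℕ → Fin m)) :=
    {q | ‖(A * T₀) (S (y - q.1) - clipProj T R ω q.2)‖ ≤ r}
  have hQ : MeasurableSet Q := measurableSet_near hT hR _ r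
    (S.measurable.comp (measurable_const.sub measurable_fst)) measurable_const measurable_snd
  have hproj : Measurable fun i => clipProj T R ω i :=
    measurable_clipProj_comp hT hR measurable_const measurable_id
  let K : (ℕ → Fin m) → ℝ≥0∞ := fun i =>
    nearMass T p R (A * T₀) (2 * r) (clipProj T R ω i) ω ^ (x - 1)
  have hK : Measurable K :=
    (measurable_nearMass hT hR p _ _ hproj measurable_const).pow_const _
  let F : E N → (ℕ → Fin m) → ℝ≥0∞ := fun z i => Q.indicator (fun q => K q.2) (z, i)
  have hF : Measurable (Function.uncurry F) := (hK.comp measurable_snd).indicator hQ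
  have hpt : ∀ z, nearMass T p R (A * T₀) r (S (y - z)) ω ^ x ≤
      ∫⁻ i, F z i ∂(bernoulliMeasure p) := by
    intro z
    set M := nearMass T p R (A * T₀) r (S (y - z)) ω with hM
    have hset : MeasurableSet {i | ‖(A * T₀) (S (y - z) - clipProj T R ω i)‖ ≤ r} :=
      measurableSet_near hT hR _ r measurable_const measurable_const measurable_id
    have h1 : M ^ x = ∫⁻ i, {i | ‖(A * T₀) (S (y - z) - clipProj T R ω i)‖ ≤ r}.indicator
        (fun _ => M ^ (x - 1)) i ∂(bernoulliMeasure p) := by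
      rw [lintegral_indicator_const hset]
      change M ^ x = M ^ (x - 1) * M
      nth_rw 3 [← ENNReal.rpow_one M]
      rw [← ENNReal.rpow_add_of_nonneg _ _ (by linarith) zero_le_one, sub_add_cancel]
    rw [h1]
    refine lintegral_mono fun i => ?_
    by_cases hi : ‖(A * T₀) (S (y - z) - clipProj T R ω i)‖ ≤ r
    · have hiQ : (z, i) ∈ Q := hi
      simp only [F]
      rw [Set.indicator_of_mem (by exact hi), Set.indicator_of_mem hiQ]
      refine ENNReal.rpow_le_rpow (measure_mono fun j hj => ?_) (by linarith)
      simp only [Set.mem_ofPred_eq] at hj ⊢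
      have e : (A * T₀) (clipProj T R ω i - clipProj T R ω j) =
          (A * T₀) (S (y - z) - clipProj T R ω j) - (A * T₀) (S (y - z) - clipProj T R ω i) := by
        rw [← map_sub]
        congr 1
        abel
      rw [e]
      exact (norm_sub_le _ _).trans (by linarith)
    · rw [Set.indicator_of_notMem (by exact hi)]
      exact zero_le
  have hvol : ∀ i, ∫⁻ z in Metric.closedBall 0 R, F z i ≤ v * K i := by
    intro i
    have hQi : MeasurableSet {z | (z, i) ∈ Q} := measurable_prodMk_right hQ
    have h1 : ∀ z, F z i = {z | (z, i) ∈ Q}.indicator (fun _ => K i) z := fun z => rfl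
    simp only [h1]
    rw [lintegral_indicator_const hQi, Measure.restrict_apply hQi, mul_comm]
    gcongr
    refine (measure_mono ?_).trans (hv (y - T₀ (clipProj T R ω i)))
    rintro z ⟨hz1, hz2⟩
    refine ⟨by simpa using hz2, ?_⟩
    have h2 : ‖(A * T₀) (S (y - z) - clipProj T R ω i)‖ ≤ r := hz1
    have h3 : T₀ (S (y - z)) = y - z := by
      rw [← mul_apply_eq_comp, hS]
      rfl
    rw [mul_apply_eq_comp, map_sub, h3] at h2
    convert h2 using 3
    abel
  calc ∫⁻ z in Metric.closedBall 0 R, nearMass T p R (A * T₀) r (S (y - z)) ω ^ x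
      ≤ ∫⁻ z in Metric.closedBall 0 R, ∫⁻ i, F z i ∂(bernoulliMeasure p) := lintegral_mono hpt
    _ = ∫⁻ i, (∫⁻ z in Metric.closedBall 0 R, F z i) ∂(bernoulliMeasure p) :=
        lintegral_lintegral_swap hF.aemeasurable
    _ ≤ ∫⁻ i, v * K i ∂(bernoulliMeasure p) := lintegral_mono hvol
    _ = v * ∫⁻ i, K i ∂(bernoulliMeasure p) := lintegral_const_mul _ hK

end Correlation

/-! ### One-step recursions for the two moments. -/

section Recursion

variable {N m : ℕ} {T : Fin m → E N →L[ℝ] E N} {lam c R : ℝ} {p : PMF (Fin m)}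
  {ν : Measure (E N)} [IsProbabilityMeasure ν] {x r : ℝ} {A : E N →L[ℝ] E N}

theorem measurable_shift (b : Fin m) :
    Measurable fun (ω : List (Fin m) → E N) (w : List (Fin m)) => ω (b :: w) := by
  fun_prop

/-- The displacement at the root is independent of the projection. -/
theorem lintegral_root (hT : NormBounds T lam c) (hR : 0 ≤ R) (hνR : ∀ᵐ z ∂ν, ‖z‖ ≤ R)
    (B S : E N →L[ℝ] E N) (y : E N) :
    ∫⁻ ω, nearMass T p R B r (S (y - clip R ω [])) ω ^ x ∂(displacementLaw m ν) =
      ∫⁻ z, ∫⁻ ω, nearMass T p R B r (S (y - z)) ω ^ x ∂(displacementLaw m ν) ∂ν := by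
  classical
  have hF : Measurable fun ω : List (Fin m) → E N =>
      nearMass T p R B r (S (y - clip R ω [])) ω ^ x :=
    (measurable_nearMass hT hR p B r
      (S.measurable.comp (measurable_const.sub (measurable_clip_apply R [])))
      measurable_id).pow_const x
  obtain ⟨S', hS'⟩ : ∃ S' : Set (List (Fin m)), ∀ w, w ∈ S' ↔ w = [] := ⟨{[]}, fun w => Iff.rfl⟩
  rw [lintegral_merge S' hF]
  have h1 : ∀ ω ω' : List (Fin m) → E N,
      nearMass T p R B r (S (y - clip R (fun w => if w ∈ S' then ω w else ω' w) []))
        (fun w => if w ∈ S' then ω w else ω' w) =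
      nearMass T p R B r (S (y - clip R ω [])) ω' := by
    intro ω ω'
    unfold nearMass
    have e : ∀ j, clipProj T R (fun w => if w ∈ S' then ω w else ω' w) j =
        clipProj T R ω' j := fun j => clipProj_congr fun k => by
      have : curtail j (k + 1) ≠ [] := by
        intro h
        have := congrArg List.length h
        rw [length_curtail] at this
        simp at this
      simp [hS', this]
    simp only [e]
    simp [clip, hS']
  simp only [h1]
  have hG : Measurable fun z : E N => ∫⁻ ω, nearMass T p R B r (S (y - z)) ω ^ x
      ∂(displacementLaw m ν) := by
    refine Measurable.lintegral_prod_right'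
      (f := fun q : E N × (List (Fin m) → E N) => nearMass T p R B r (S (y - q.1)) q.2 ^ x) ?_
    exact (measurable_nearMass hT hR p B r
      (S.measurable.comp (measurable_const.sub measurable_fst)) measurable_snd).pow_const x
  have hmp : MeasurePreserving (Function.eval ([] : List (Fin m))) (displacementLaw m ν) ν :=
    measurePreserving_eval_infinitePi (fun _ : List (Fin m) => ν) []
  rw [← hmp.lintegral_comp hG]
  refine lintegral_congr_ae ?_
  filter_upwards [hmp.quasiMeasurePreserving.ae hνR] with ω hω
  have : clip R ω [] = ω [] := if_pos hω
  simp only [this, Function.eval]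

/-- One-step recursion for the concentration moments. -/
theorem concMoment_le (hT : NormBounds T lam c) (hR : 0 ≤ R) (hx : 1 ≤ x)
    (hνR : ∀ᵐ z ∂ν, ‖z‖ ≤ R) {M δ v : ℝ≥0∞}
    (hM : ∀ (H : E N → ℝ≥0∞) (B : ℝ≥0∞), Measurable H → (∀ z, H z ≤ B) →
      ∫⁻ z, H z ∂ν ≤ M * (∫⁻ z in Metric.closedBall 0 R, H z) + δ * B)
    (hv : ∀ y, volume {z : E N | ‖z‖ ≤ R ∧ ‖A (y - z)‖ ≤ r} ≤ v) :
    concMoment T p R ν x A r ≤ ∑ b, p b * (M * (v * corrMoment T p R ν (x - 1) (A * T b) (2 * r)) +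
      δ * concMoment T p R ν x (A * T b) r) := by
  choose S _ hS _ using fun b => exists_inverse (hT.inj b)
  refine iSup_le fun y => ?_
  have hmeas : ∀ b, Measurable fun ω : List (Fin m) → E N =>
      nearMass T p R (A * T b) r (S b (y - clip R ω [b])) (fun w => ω (b :: w)) ^ x := fun b =>
    (measurable_nearMass hT hR p _ r
      ((S b).measurable.comp (measurable_const.sub (measurable_clip_apply R [b])))
      (measurable_shift b)).pow_const x
  calc ∫⁻ ω, nearMass T p R A r y ω ^ x ∂(displacementLaw m ν)
      ≤ ∫⁻ ω, ∑ b, p b * nearMass T p R (A * T b) r (S b (y - clip R ω [b]))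
          (fun w => ω (b :: w)) ^ x ∂(displacementLaw m ν) := by
        refine lintegral_mono fun ω => ?_
        rw [nearMass_eq_sum hT hR hS]
        -- Convexity of the `x`-th power, with the weights `p b`; this is where `1 ≤ x` enters.
        exact ENNReal.rpow_arith_mean_le_arith_mean_rpow _ _ _ (sum_weight_ennreal p) hx
    _ = ∑ b, p b * ∫⁻ ω, nearMass T p R (A * T b) r (S b (y - clip R ω [b]))
          (fun w => ω (b :: w)) ^ x ∂(displacementLaw m ν) := by
        rw [lintegral_finsetSum _ fun b _ => (hmeas b).const_mul _]
        exact Finset.sum_congr rfl fun b _ => lintegral_const_mul _ (hmeas b)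
    _ ≤ _ := by
        refine Finset.sum_le_sum fun b _ => mul_le_mul_right ?_ _
        have hF : Measurable fun ω : List (Fin m) → E N =>
            nearMass T p R (A * T b) r (S b (y - clip R ω [])) ω ^ x :=
          (measurable_nearMass hT hR p _ r
            ((S b).measurable.comp (measurable_const.sub (measurable_clip_apply R [])))
            measurable_id).pow_const x
        have h1 := lintegral_shift (ν := ν) b hF
        have h2 : ∀ ω : List (Fin m) → E N, clip R (fun w => ω (b :: w)) [] = clip R ω [b] :=
          fun ω => rfl
        simp only [h2] at h1
        rw [h1, lintegral_root hT hR hνR]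
        have hjoint : Measurable fun q : E N × (List (Fin m) → E N) =>
            nearMass T p R (A * T b) r (S b (y - q.1)) q.2 ^ x :=
          (measurable_nearMass hT hR p _ r
            ((S b).measurable.comp (measurable_const.sub measurable_fst))
            measurable_snd).pow_const x
        -- The Lebesgue part gains the factor `v`. The `δ` part has no averaging, so its centre is
        -- arbitrary and the supremum over centres in `concMoment` is needed.
        refine (hM _ (concMoment T p R ν x (A * T b) r) hjoint.lintegral_prod_right'
          fun z => le_iSup (fun y : E N => ∫⁻ ω, nearMass T p R (A * T b) r y ω ^ x
            ∂(displacementLaw m ν)) (S b (y - z))).trans ?_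
        gcongr
        rw [lintegral_lintegral_swap (f := fun z ω =>
          nearMass T p R (A * T b) r (S b (y - z)) ω ^ x) hjoint.aemeasurable]
        refine (lintegral_mono fun ω =>
          lintegral_nearMass_rpow_le hT hR hx (hS b) hv y ω).trans (le_of_eq ?_)
        rw [lintegral_const_mul, corrMoment]
        refine Measurable.lintegral_prod_right' (f := fun q : (List (Fin m) → E N) × (ℕ → Fin m) =>
          nearMass T p R (A * T b) (2 * r) (clipProj T R q.1 q.2) q.1 ^ (x - 1)) ?_
        exact (measurable_nearMass hT hR p _ _
          (measurable_clipProj_comp hT hR measurable_fst measurable_snd)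
          measurable_fst).pow_const _

/-- The mass of the words near `y` that start with a letter other than `a`. -/
noncomputable def nearMassNe (T : Fin m → E N →L[ℝ] E N) (p : PMF (Fin m)) (R : ℝ) (a : Fin m)
    (A : E N →L[ℝ] E N) (r : ℝ) (y : E N) (ω : List (Fin m) → E N) : ℝ≥0∞ :=
  bernoulliMeasure p {j | j 0 ≠ a ∧ ‖A (y - clipProj T R ω j)‖ ≤ r}

theorem measurable_nearMassNe (hT : NormBounds T lam c) (hR : 0 ≤ R) (p : PMF (Fin m))
    (a : Fin m) (A : E N →L[ℝ] E N) (r : ℝ) {α : Type*} [MeasurableSpace α] {y : α → E N}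
    {f : α → List (Fin m) → E N} (hy : Measurable y) (hf : Measurable f) :
    Measurable fun z => nearMassNe T p R a A r (y z) (f z) := by
  refine measurable_measure_prodMk_left (ν := bernoulliMeasure p)
    (s := {q : α × (ℕ → Fin m) | q.2 0 ≠ a ∧ ‖A (y q.1 - clipProj T R (f q.1) q.2)‖ ≤ r}) ?_
  have h1 : MeasurableSet {q : α × (ℕ → Fin m) | q.2 0 ≠ a} := by
    have : Measurable fun q : α × (ℕ → Fin m) => q.2 0 := by fun_prop
    exact this (MeasurableSet.of_discrete (s := {a}ᶜ))
  exact h1.inter (measurableSet_near hT hR A r (hy.comp measurable_fst) (hf.comp measurable_fst)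
      (measurable_snd (α := α)))

/-- For two words with the same first letter `a` the displacement at `[a]` cancels in the
difference, leaving the same quantity for `A * T a` and the shifted family. -/
theorem nearMass_consWord_le (hT : NormBounds T lam c) (hR : 0 ≤ R) (a : Fin m)
    (i : ℕ → Fin m) (ω : List (Fin m) → E N) :
    nearMass T p R A r (clipProj T R ω (consWord a i)) ω ≤
      p a * nearMass T p R (A * T a) r (clipProj T R (fun w => ω (a :: w)) i)
        (fun w => ω (a :: w)) +
      nearMassNe T p R a A r (clipProj T R ω (consWord a i)) ω := by
  set y := clipProj T R ω (consWord a i) with hy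
  let Q : Set (ℕ → Fin m) := {j | ‖A (y - clipProj T R ω j)‖ ≤ r}
  have hQ : MeasurableSet Q :=
    measurableSet_near hT hR A r measurable_const measurable_const measurable_id
  let D : Set (ℕ → Fin m) := {j | j 0 = a}
  have hD : MeasurableSet D := by
    have : Measurable fun j : ℕ → Fin m => j 0 := by fun_prop
    exact this (MeasurableSet.of_discrete (s := {a}))
  have h1 : nearMass T p R A r y ω ≤ bernoulliMeasure p (Q ∩ D) +
      nearMassNe T p R a A r y ω := by
    refine le_trans (measure_mono ?_) (measure_union_le _ _)
    intro j hj
    by_cases h : j 0 = a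
    · exact Or.inl ⟨hj, h⟩
    · exact Or.inr ⟨h, hj⟩
  refine h1.trans (add_le_add_left (le_of_eq ?_) _)
  rw [bernoulliMeasure_apply p (hQ.inter hD), Finset.sum_eq_single a]
  · congr 2
    ext j
    simp only [Set.mem_preimage, Set.mem_inter_iff, Q, D, Set.mem_ofPred_eq]
    have h2 : consWord a j 0 = a := rfl
    simp only [h2, and_true]
    rw [hy, clipProj_consWord hT hR, clipProj_consWord hT hR, add_sub_add_left_eq_sub, ← map_sub,
      ← mul_apply_eq_comp]
  · intro b _ hb
    have : consWord b ⁻¹' (Q ∩ D) = ∅ := by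
      ext j
      have h2 : consWord b j 0 = b := rfl
      simp [D, h2, hb]
    rw [this]
    simp
  · simp

/-- The centre depends only on displacements at words beginning with `a`, and the mass only on the
others. The two groups are independent, so the centre can be frozen while the second group is
integrated. -/
theorem lintegral_nearMassNe_le (hT : NormBounds T lam c) (hR : 0 ≤ R) (hx : 0 ≤ x)
    (a : Fin m) :
    ∫⁻ ω, ∫⁻ i, nearMassNe T p R a A r (clipProj T R ω (consWord a i)) ω ^ x
      ∂(bernoulliMeasure p) ∂(displacementLaw m ν) ≤ concMoment T p R ν x A r := by
  classical
  let S : Set (List (Fin m)) := {w | ∃ v, w = a :: v}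
  have hjoint : Measurable fun q : (List (Fin m) → E N) × (ℕ → Fin m) =>
      nearMassNe T p R a A r (clipProj T R q.1 (consWord a q.2)) q.1 ^ x :=
    (measurable_nearMassNe hT hR p a A r (measurable_clipProj_comp hT hR measurable_fst
      ((measurable_consWord_right a).comp measurable_snd)) measurable_fst).pow_const x
  rw [lintegral_merge S hjoint.lintegral_prod_right']
  have h1 : ∀ (ω ω' : List (Fin m) → E N) (i : ℕ → Fin m),
      nearMassNe T p R a A r (clipProj T R (fun w => if w ∈ S then ω w else ω' w) (consWord a i))
        (fun w => if w ∈ S then ω w else ω' w) =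
      nearMassNe T p R a A r (clipProj T R ω (consWord a i)) ω' := by
    intro ω ω' i
    have e1 : clipProj T R (fun w => if w ∈ S then ω w else ω' w) (consWord a i) =
        clipProj T R ω (consWord a i) := clipProj_congr fun k => by
      rw [curtail_consWord]
      exact if_pos ⟨_, rfl⟩
    have e2 : ∀ j : ℕ → Fin m, j 0 ≠ a →
        clipProj T R (fun w => if w ∈ S then ω w else ω' w) j = clipProj T R ω' j :=
      fun j hj => clipProj_congr fun k => by
        refine if_neg ?_
        rintro ⟨v, hv⟩
        rw [curtail, List.ofFn_succ] at hv
        exact hj (List.cons.inj hv).1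
    unfold nearMassNe
    rw [e1]
    congr 1
    ext j
    simp only [Set.mem_ofPred_eq]
    refine and_congr_right fun hj => ?_
    rw [e2 j hj]
  simp only [h1]
  have h2 : ∀ ω : List (Fin m) → E N,
      ∫⁻ ω', ∫⁻ i, nearMassNe T p R a A r (clipProj T R ω (consWord a i)) ω' ^ x
        ∂(bernoulliMeasure p) ∂(displacementLaw m ν) ≤ concMoment T p R ν x A r := by
    intro ω
    have hm2 : Measurable fun q : (List (Fin m) → E N) × (ℕ → Fin m) =>
        nearMassNe T p R a A r (clipProj T R ω (consWord a q.2)) q.1 ^ x :=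
      (measurable_nearMassNe hT hR p a A r (measurable_clipProj_comp hT hR measurable_const
        ((measurable_consWord_right a).comp measurable_snd)) measurable_fst).pow_const x
    rw [lintegral_lintegral_swap (f := fun (ω' : List (Fin m) → E N) (i : ℕ → Fin m) =>
      nearMassNe T p R a A r (clipProj T R ω (consWord a i)) ω' ^ x) hm2.aemeasurable]
    calc _ ≤ ∫⁻ _, concMoment T p R ν x A r ∂(bernoulliMeasure p) := by
          refine lintegral_mono fun i => le_trans (lintegral_mono fun ω' => ?_)
            (le_iSup (fun y : E N => ∫⁻ ω, nearMass T p R A r y ω ^ x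
              ∂(displacementLaw m ν)) (clipProj T R ω (consWord a i)))
          exact ENNReal.rpow_le_rpow (measure_mono fun j hj => hj.2) hx
      _ = _ := by simp
  calc _ ≤ ∫⁻ _, concMoment T p R ν x A r ∂(displacementLaw m ν) := lintegral_mono h2
    _ = _ := by simp

/-- One-step recursion for the correlation moments. -/
theorem corrMoment_le (hT : NormBounds T lam c) (hR : 0 ≤ R) (hx : 0 < x)
    (hp : ∀ i, 0 < p i) {κ C : ℝ≥0∞}
    (hC : ∀ a b : ℝ≥0∞, (a + b) ^ x ≤ κ * a ^ x + C * b ^ x) :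
    corrMoment T p R ν x A r ≤ (∑ a, κ * p a ^ (x + 1) * corrMoment T p R ν x (A * T a) r) +
      C * concMoment T p R ν x A r := by
  let F : Fin m → (List (Fin m) → E N) → ℝ≥0∞ := fun a ω =>
    ∫⁻ i, nearMass T p R (A * T a) r (clipProj T R ω i) ω ^ x ∂(bernoulliMeasure p)
  let G : Fin m → (List (Fin m) → E N) → ℝ≥0∞ := fun a ω =>
    ∫⁻ i, nearMassNe T p R a A r (clipProj T R ω (consWord a i)) ω ^ x ∂(bernoulliMeasure p)
  have hF : ∀ a, Measurable (F a) := fun a => by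
    refine Measurable.lintegral_prod_right' (f := fun q : (List (Fin m) → E N) × (ℕ → Fin m) =>
      nearMass T p R (A * T a) r (clipProj T R q.1 q.2) q.1 ^ x) ?_
    exact (measurable_nearMass hT hR p _ _
      (measurable_clipProj_comp hT hR measurable_fst measurable_snd) measurable_fst).pow_const _
  have hG : ∀ a, Measurable (G a) := fun a => by
    refine Measurable.lintegral_prod_right' (f := fun q : (List (Fin m) → E N) × (ℕ → Fin m) =>
      nearMassNe T p R a A r (clipProj T R q.1 (consWord a q.2)) q.1 ^ x) ?_
    exact (measurable_nearMassNe hT hR p a A r (measurable_clipProj_comp hT hR measurable_fst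
      ((measurable_consWord_right a).comp measurable_snd)) measurable_fst).pow_const x
  have hpt : ∀ ω : List (Fin m) → E N,
      ∫⁻ i, nearMass T p R A r (clipProj T R ω i) ω ^ x ∂(bernoulliMeasure p) ≤
        ∑ a, (κ * p a ^ (x + 1) * F a (fun w => ω (a :: w)) + C * (p a * G a ω)) := by
    intro ω
    have hm1 : Measurable fun i => nearMass T p R A r (clipProj T R ω i) ω ^ x :=
      (measurable_nearMass hT hR p _ _
        (measurable_clipProj_comp hT hR measurable_const measurable_id)
        measurable_const).pow_const _
    rw [lintegral_bernoulliMeasure p hm1]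
    refine Finset.sum_le_sum fun a _ => ?_
    have hm2 : Measurable fun i => nearMass T p R (A * T a) r
        (clipProj T R (fun w => ω (a :: w)) i) (fun w => ω (a :: w)) ^ x :=
      (measurable_nearMass hT hR p _ _
        (measurable_clipProj_comp hT hR measurable_const measurable_id)
        measurable_const).pow_const _
    have hm3 : Measurable fun i =>
        nearMassNe T p R a A r (clipProj T R ω (consWord a i)) ω ^ x :=
      (measurable_nearMassNe hT hR p a A r (measurable_clipProj_comp hT hR measurable_const
        (measurable_consWord_right a)) measurable_const).pow_const x
    calc p a * ∫⁻ i, nearMass T p R A r (clipProj T R ω (consWord a i)) ω ^ x ∂(bernoulliMeasure p)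
        ≤ p a * ∫⁻ i, (κ * p a ^ x * nearMass T p R (A * T a) r
            (clipProj T R (fun w => ω (a :: w)) i) (fun w => ω (a :: w)) ^ x +
            C * nearMassNe T p R a A r (clipProj T R ω (consWord a i)) ω ^ x)
            ∂(bernoulliMeasure p) := by
          gcongr with i
          refine (ENNReal.rpow_le_rpow (nearMass_consWord_le hT hR a i ω) hx.le).trans
            ((hC _ _).trans (le_of_eq ?_))
          rw [ENNReal.mul_rpow_of_nonneg _ _ hx.le, mul_assoc]
      _ = p a * (κ * p a ^ x * F a (fun w => ω (a :: w)) + C * G a ω) := by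
          rw [lintegral_add_left (hm2.const_mul _), lintegral_const_mul _ hm2,
            lintegral_const_mul _ hm3]
      _ = κ * p a ^ (x + 1) * F a (fun w => ω (a :: w)) + C * (p a * G a ω) := by
          rw [ENNReal.rpow_add _ _ (hp a).ne' (p.apply_ne_top a), ENNReal.rpow_one]
          ring
  have hFs : ∀ a, Measurable fun ω : List (Fin m) → E N => F a (fun w => ω (a :: w)) :=
    fun a => (hF a).comp (measurable_shift a)
  calc corrMoment T p R ν x A r
      ≤ ∫⁻ ω, ∑ a, (κ * p a ^ (x + 1) * F a (fun w => ω (a :: w)) + C * (p a * G a ω))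
          ∂(displacementLaw m ν) := lintegral_mono hpt
    _ = ∑ a, (κ * p a ^ (x + 1) * corrMoment T p R ν x (A * T a) r +
          C * (p a * ∫⁻ ω, G a ω ∂(displacementLaw m ν))) := by
        have hsum : ∀ a ∈ Finset.univ, Measurable fun ω : List (Fin m) → E N =>
            κ * p a ^ (x + 1) * F a (fun w => ω (a :: w)) + C * (p a * G a ω) := fun a _ =>
          ((hFs a).const_mul _).add (((hG a).const_mul _).const_mul _)
        rw [lintegral_finsetSum _ hsum]
        refine Finset.sum_congr rfl fun a _ => ?_
        rw [lintegral_add_left ((hFs a).const_mul _), lintegral_const_mul _ (hFs a),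
          lintegral_const_mul _ ((hG a).const_mul _), lintegral_const_mul _ (hG a),
          lintegral_shift a (hF a)]
        rfl
    _ ≤ ∑ a, (κ * p a ^ (x + 1) * corrMoment T p R ν x (A * T a) r +
          C * (p a * concMoment T p R ν x A r)) := by
        gcongr with a
        exact lintegral_nearMassNe_le hT hR hx.le a
    _ = _ := by
        rw [Finset.sum_add_distrib, ← Finset.mul_sum, ← Finset.sum_mul, sum_weight_ennreal, one_mul]

end Recursion

/-! ### Solving the recursions by induction on the order of the moment. -/

section MomentBounds

variable {N m : ℕ} {T : Fin m → E N →L[ℝ] E N} {lam c R : ℝ} {p : PMF (Fin m)}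
  {ν : Measure (E N)} [IsProbabilityMeasure ν] {s x : ℝ}

theorem sum_rpow_lt_one (hm : 2 ≤ m) (hp : ∀ i, 0 < p i) (hx : 0 < x) :
    ∑ a, p a ^ (x + 1) < 1 := by
  have h := sum_weight_rpow_lt_one hm hp (by linarith : 1 < x + 1)
  have h1 : ∑ a, p a ^ (x + 1) = ENNReal.ofReal (∑ i, (p i).toReal ^ (x + 1)) := by
    rw [ENNReal.ofReal_sum_of_nonneg fun i _ => by positivity]
    refine Finset.sum_congr rfl fun a _ => ?_
    rw [← ENNReal.ofReal_rpow_of_pos (weight_pos hp a), ENNReal.ofReal_toReal (p.apply_ne_top a)]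
  rw [h1, ← ENNReal.ofReal_one]
  exact ENNReal.ofReal_lt_ofReal_iff zero_lt_one |>.2 h

theorem exists_corrMoment_le_of_concMoment_le (hm : 2 ≤ m) (hT : NormBounds T lam c)
    (hp : ∀ i, 0 < p i) (hR : 0 ≤ R) (hx : 0 < x) {θ : ℝ≥0∞} (hθ : 1 < θ) (hθt : θ ≠ ⊤)
    (hconc : ∃ C : ℝ≥0∞, C ≠ ⊤ ∧ ∀ A : E N →L[ℝ] E N, Function.Injective A → ∀ r, 0 < r →
      concMoment T p R ν x A r ≤ C * ENNReal.ofReal (r ^ (s * x)) * potential T p s x θ A) :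
    ∃ C : ℝ≥0∞, C ≠ ⊤ ∧ ∀ A : E N →L[ℝ] E N, Function.Injective A → ∀ r, 0 < r →
      corrMoment T p R ν x A r ≤ C * ENNReal.ofReal (r ^ (s * x)) * potential T p s x θ A := by
  obtain ⟨C₁, hC₁, hconc⟩ := hconc
  have hQ := sum_rpow_lt_one hm hp hx
  -- `κ < θ` makes the potential contract at rate `κ / θ`, and `κ < (∑ p a ^ (x + 1))⁻¹` makes the
  -- total weight of the recursion less than 1.
  obtain ⟨κ, hκ1, hκ2⟩ := exists_between (lt_min hθ (ENNReal.one_lt_inv.2 hQ))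
  have hκθ : κ < θ := hκ2.trans_le (min_le_left _ _)
  have hκQ : κ * ∑ a, p a ^ (x + 1) < 1 := by
    refine ENNReal.mul_lt_of_lt_div ?_
    rw [one_div]
    exact hκ2.trans_le (min_le_right _ _)
  have hκt : κ ≠ ⊤ := hκθ.ne_top
  obtain ⟨C₂, hC₂, hadd⟩ := exists_add_rpow_le hx hκ1 hκt
  have hθ0 : θ ≠ 0 := (zero_lt_one.trans hθ).ne'
  have hρ : κ / θ < 1 := ENNReal.div_lt_of_lt_mul (by rwa [one_mul])
  refine ⟨C₂ * C₁ * (1 - κ / θ)⁻¹, ENNReal.mul_ne_top (ENNReal.mul_ne_top hC₂ hC₁)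
    (ENNReal.inv_ne_top.2 (tsub_pos_of_lt hρ).ne'), fun A hA r hr => ?_⟩
  have h := le_of_recursive hT (w := fun a => κ * p a ^ (x + 1))
    (J := fun A => corrMoment T p R ν x A r) (Z := potential T p s x θ)
    (C := C₂ * C₁ * ENNReal.ofReal (r ^ (s * x))) (ρ := κ / θ)
    (fun A => corrMoment_le_one hx.le) (fun A hA => ?_) (fun A hA => ?_) ?_ hA
  · refine h.trans (le_of_eq ?_)
    ring
  · refine (corrMoment_le hT hR hx hp hadd).trans ?_
    refine add_le_add le_rfl ((mul_le_mul_right (hconc A hA r hr) _).trans (le_of_eq ?_))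
    ring
  · have h1 : ∑ a, κ * p a ^ (x + 1) * potential T p s x θ (A * T a) =
        κ / θ * (θ * transfer T p x (potential T p s x θ) A) := by
      rw [← mul_assoc, ENNReal.div_mul_cancel hθ0 hθt, transfer, Finset.mul_sum]
      exact Finset.sum_congr rfl fun a _ => by ring
    rw [h1]
    gcongr
    exact mul_transfer_potential_le A
  · rwa [← Finset.mul_sum]

/-- The part of `ν` with large density is made so light, `δ = 1 / (2 (K + 1))`, that it outweighs
the growth `K` of `V` per letter and can be absorbed. `V` is left general: it is φ^s(·)^{-1} at
order 1 and φ^s(·)^{-1} times a potential at higher orders. -/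
theorem exists_concMoment_le (hN : 1 ≤ N) (hT : NormBounds T lam c) (hR : 0 ≤ R)
    (hν : ν ≪ volume) (hνR : ∀ᵐ z ∂ν, ‖z‖ ≤ R) (hs : 0 < s) (hsN : s ≤ N) (hx : 1 ≤ x)
    {V : (E N →L[ℝ] E N) → ℝ≥0∞} {K C₁ : ℝ≥0∞} (hK : K ≠ ⊤) (hC₁ : C₁ ≠ ⊤)
    (hV : ∀ A : E N →L[ℝ] E N, Function.Injective A → ∀ a, V (A * T a) ≤ K * V A)
    (hcorr : ∀ A : E N →L[ℝ] E N, Function.Injective A → ∀ r, 0 < r → ∀ b,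
      svfPow s 1 A * corrMoment T p R ν (x - 1) (A * T b) (2 * r) ≤
        C₁ * ENNReal.ofReal (r ^ (s * (x - 1))) * V A) :
    ∃ C : ℝ≥0∞, C ≠ ⊤ ∧ ∀ A : E N →L[ℝ] E N, Function.Injective A → ∀ r, 0 < r →
      concMoment T p R ν x A r ≤ C * ENNReal.ofReal (r ^ (s * x)) * V A := by
  set δ : ℝ≥0∞ := (2 * (K + 1))⁻¹ with hδ
  have hK2 : 2 * (K + 1) ≠ ⊤ :=
    ENNReal.mul_ne_top ENNReal.ofNat_ne_top (ENNReal.add_ne_top.2 ⟨hK, ENNReal.one_ne_top⟩)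
  have hδ0 : δ ≠ 0 := ENNReal.inv_ne_zero.2 hK2
  have hK1 : 1 < 2 * (K + 1) := by
    calc (1 : ℝ≥0∞) < 2 := ENNReal.one_lt_two
      _ = 2 * 1 := (mul_one _).symm
      _ ≤ 2 * (K + 1) := by gcongr; exact le_add_self
  have hδ1 : δ < 1 := ENNReal.inv_lt_one.2 hK1
  have hδK : δ * K < 1 := by
    have h1 : K < 2 * (K + 1) := by
      calc K < K + 1 := ENNReal.lt_add_right hK one_ne_zero
        _ = 1 * (K + 1) := (one_mul _).symm
        _ ≤ 2 * (K + 1) := by gcongr; exact ENNReal.one_lt_two.le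
    rw [hδ, mul_comm, ← div_eq_mul_inv]
    exact ENNReal.div_lt_of_lt_mul (by rwa [one_mul])
  obtain ⟨M, hMt, hM⟩ := exists_lintegral_le_of_absolutelyContinuous hν hνR hδ0
  set c₀ : ℝ := (2 * (R + 1)) ^ N with hc₀
  have hc₀0 : 0 ≤ c₀ := by positivity
  refine ⟨M * ENNReal.ofReal c₀ * C₁ * (1 - δ * K)⁻¹,
    ENNReal.mul_ne_top (ENNReal.mul_ne_top (ENNReal.mul_ne_top hMt ENNReal.ofReal_ne_top) hC₁)
      (ENNReal.inv_ne_top.2 (tsub_pos_of_lt hδK).ne'), fun A hA r hr => ?_⟩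
  have h := le_of_recursive hT (w := fun a => δ * p a)
    (J := fun A => concMoment T p R ν x A r) (Z := V)
    (C := M * ENNReal.ofReal c₀ * C₁ * ENNReal.ofReal (r ^ (s * x))) (ρ := δ * K)
    (fun A => concMoment_le_one (by linarith)) (fun A hA => ?_) (fun A hA => ?_) ?_ hA
  · refine h.trans (le_of_eq ?_)
    ring
  · set v : ℝ≥0∞ := ENNReal.ofReal c₀ * ENNReal.ofReal (r ^ s) * svfPow s 1 A with hv
    have hvol : ∀ y, volume {z : E N | ‖z‖ ≤ R ∧ ‖A (y - z)‖ ≤ r} ≤ v := by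
      intro y
      refine (volume_ellipsoid_le hN hs hsN hR hA y hr).trans (le_of_eq ?_)
      rw [hv, svfPow, ENNReal.rpow_neg_one, ENNReal.ofReal_mul hc₀0, mul_assoc,
        ENNReal.ofReal_div_of_pos (svf_pos hA hs), div_eq_mul_inv]
    refine (concMoment_le hT hR hx hνR hM hvol).trans ?_
    have h1 : ∀ b, p b * (M * (v * corrMoment T p R ν (x - 1) (A * T b) (2 * r)) +
        δ * concMoment T p R ν x (A * T b) r) ≤
        δ * p b * concMoment T p R ν x (A * T b) r +
          p b * (M * ENNReal.ofReal c₀ * C₁ * ENNReal.ofReal (r ^ (s * x)) * V A) := by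
      intro b
      have h2 : M * (v * corrMoment T p R ν (x - 1) (A * T b) (2 * r)) ≤
          M * ENNReal.ofReal c₀ * C₁ * ENNReal.ofReal (r ^ (s * x)) * V A := by
        have e : ENNReal.ofReal (r ^ (s * x)) =
            ENNReal.ofReal (r ^ s) * ENNReal.ofReal (r ^ (s * (x - 1))) := by
          rw [← ENNReal.ofReal_mul (by positivity), ← Real.rpow_add hr]
          congr 2
          ring
        calc M * (v * corrMoment T p R ν (x - 1) (A * T b) (2 * r))
            = M * ENNReal.ofReal c₀ * ENNReal.ofReal (r ^ s) *
              (svfPow s 1 A * corrMoment T p R ν (x - 1) (A * T b) (2 * r)) := by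
              rw [hv]
              ring
          _ ≤ M * ENNReal.ofReal c₀ * ENNReal.ofReal (r ^ s) *
              (C₁ * ENNReal.ofReal (r ^ (s * (x - 1))) * V A) :=
              mul_le_mul_right (hcorr A hA r hr b) _
          _ = _ := by
              rw [e]
              ring
      calc _ = δ * p b * concMoment T p R ν x (A * T b) r +
            p b * (M * (v * corrMoment T p R ν (x - 1) (A * T b) (2 * r))) := by ring
        _ ≤ _ := by gcongr
    refine (Finset.sum_le_sum fun b _ => h1 b).trans (le_of_eq ?_)
    rw [Finset.sum_add_distrib, ← Finset.sum_mul, sum_weight_ennreal, one_mul]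
  · calc ∑ a, δ * p a * V (A * T a) ≤ ∑ a, p a * (δ * K * V A) := by
          refine Finset.sum_le_sum fun a _ => ?_
          calc δ * p a * V (A * T a) ≤ δ * p a * (K * V A) := by
                gcongr
                exact hV A hA a
            _ = p a * (δ * K * V A) := by ring
      _ = δ * K * V A := by rw [← Finset.sum_mul, sum_weight_ennreal, one_mul]
  · rw [← Finset.mul_sum, sum_weight_ennreal, mul_one]
    exact hδ1

theorem exists_concMoment_one_le (hN : 1 ≤ N) (hT : NormBounds T lam c) (hR : 0 ≤ R)
    (hν : ν ≪ volume) (hνR : ∀ᵐ z ∂ν, ‖z‖ ≤ R) (hs : 0 < s) (hsN : s ≤ N) :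
    ∃ C : ℝ≥0∞, C ≠ ⊤ ∧ ∀ A : E N →L[ℝ] E N, Function.Injective A → ∀ r, 0 < r →
      concMoment T p R ν 1 A r ≤ C * ENNReal.ofReal (r ^ s) * svfPow s 1 A := by
  obtain ⟨K, hK, hV⟩ := exists_svfPow_mul_le hT hs
  have h := exists_concMoment_le (p := p) (x := 1) (V := svfPow s 1) (K := K) (C₁ := 1)
    hN hT hR hν hνR hs hsN le_rfl hK ENNReal.one_ne_top hV fun A hA r hr b => by
      simp only [sub_self, mul_zero, Real.rpow_zero, ENNReal.ofReal_one, one_mul]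
      exact mul_le_of_le_one_right' (corrMoment_le_one le_rfl)
  simpa using h

theorem concMoment_le_rpow (hT : NormBounds T lam c) (hR : 0 ≤ R) (hx : 0 < x) (hx1 : x ≤ 1)
    (A : E N →L[ℝ] E N) (r : ℝ) :
    concMoment T p R ν x A r ≤ concMoment T p R ν 1 A r ^ x := by
  refine iSup_le fun y => ?_
  refine (lintegral_rpow_le_rpow _
    (measurable_nearMass hT hR p A r measurable_const measurable_id) hx hx1).trans ?_
  rw [div_one]
  exact ENNReal.rpow_le_rpow (le_iSup (fun y : E N => ∫⁻ ω, nearMass T p R A r y ω ^ (1 : ℝ)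
    ∂(displacementLaw m ν)) y) hx.le

/-- The correlation moments of order `x` are bounded by `r^{sx}` times the potential. -/
theorem exists_corrMoment_le (hN : 1 ≤ N) (hm : 2 ≤ m) (hT : NormBounds T lam c)
    (hp : ∀ i, 0 < p i) (hR : 0 ≤ R) (hν : ν ≪ volume) (hνR : ∀ᵐ z ∂ν, ‖z‖ ≤ R) (hs : 0 < s)
    (hsN : s ≤ N) (hx : 0 < x) {θ : ℝ≥0∞} (hθ : 1 < θ) (hθt : θ ≠ ⊤) :
    ∃ C : ℝ≥0∞, C ≠ ⊤ ∧ ∀ A : E N →L[ℝ] E N, Function.Injective A → ∀ r, 0 < r →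
      corrMoment T p R ν x A r ≤ C * ENNReal.ofReal (r ^ (s * x)) * potential T p s x θ A := by
  -- Induction on an integer bound for `x`: orders up to 1 follow from order 1 by Jensen, larger
  -- orders from order `x - 1`. The discount `θ` is generalised because the Hölder step calls the
  -- lower order with a different one.
  obtain ⟨n, hn⟩ := exists_nat_ge x
  induction n generalizing x θ with
  | zero =>
    norm_num at hn
    linarith
  | succ n ih =>
    refine exists_corrMoment_le_of_concMoment_le hm hT hp hR hx hθ hθt ?_
    rcases le_or_gt x 1 with hx1 | hx1
    · obtain ⟨C, hC, hle⟩ := exists_concMoment_one_le (p := p) hN hT hR hν hνR hs hsN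
      refine ⟨C ^ x, ENNReal.rpow_ne_top_of_nonneg hx.le hC, fun A hA r hr => ?_⟩
      calc concMoment T p R ν x A r ≤ concMoment T p R ν 1 A r ^ x :=
            concMoment_le_rpow hT hR hx hx1 A r
        _ ≤ (C * ENNReal.ofReal (r ^ s) * svfPow s 1 A) ^ x :=
            ENNReal.rpow_le_rpow (hle A hA r hr) hx.le
        _ = C ^ x * ENNReal.ofReal (r ^ (s * x)) * svfPow s x A := by
            rw [ENNReal.mul_rpow_of_nonneg _ _ hx.le, ENNReal.mul_rpow_of_nonneg _ _ hx.le,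
              ENNReal.ofReal_rpow_of_pos (by positivity), ← Real.rpow_mul hr.le, svfPow, svfPow,
              ← ENNReal.rpow_mul]
            congr 2
            ring
        _ ≤ _ := by
            gcongr
            exact svfPow_le_potential A
    · obtain ⟨θ', C₂, hθ', hθ't, hC₂, hpot⟩ :=
        exists_svfPow_mul_potential_le (T := T) (s := s) hp hx1 hθ hθt
      obtain ⟨C₃, hC₃, hcorr⟩ := ih (x := x - 1) (θ := θ') (by linarith) hθ' hθ't (by
        push_cast at hn
        linarith)
      obtain ⟨K₁, hK₁, hsv⟩ := exists_svfPow_mul_le hT hs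
      obtain ⟨K₂, hK₂, hpo⟩ := exists_potential_mul_le (T := T) (s := s) (x := x - 1) (θ := θ')
        hp (by linarith) hθ'.le
      have h2 : (0 : ℝ) ≤ 2 ^ (s * (x - 1)) := by positivity
      obtain ⟨C, hC, hle⟩ := exists_concMoment_le (p := p) (x := x)
        (V := fun A => svfPow s 1 A * potential T p s (x - 1) θ' A) (K := K₁ * K₂)
        (C₁ := C₃ * ENNReal.ofReal (2 ^ (s * (x - 1))) * K₂) hN hT hR hν hνR hs hsN hx1.le
        (ENNReal.mul_ne_top hK₁ hK₂)
        (ENNReal.mul_ne_top (ENNReal.mul_ne_top hC₃ ENNReal.ofReal_ne_top) hK₂)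
        (fun A hA a => by
          calc svfPow s 1 (A * T a) * potential T p s (x - 1) θ' (A * T a)
              ≤ (K₁ * svfPow s 1 A) * (K₂ * potential T p s (x - 1) θ' A) :=
                mul_le_mul' (hsv A hA a) (hpo A a)
            _ = _ := by ring)
        (fun A hA r hr b => by
          have h1 := hcorr (A * T b) (mul_injective hA (hT.inj b)) (2 * r) (by positivity)
          rw [Real.mul_rpow (by norm_num) hr.le, ENNReal.ofReal_mul h2] at h1
          calc svfPow s 1 A * corrMoment T p R ν (x - 1) (A * T b) (2 * r)
              ≤ svfPow s 1 A * (C₃ * (ENNReal.ofReal (2 ^ (s * (x - 1))) *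
                ENNReal.ofReal (r ^ (s * (x - 1)))) *
                (K₂ * potential T p s (x - 1) θ' A)) := by
                gcongr
                exact h1.trans (by gcongr; exact hpo A b)
            _ = _ := by ring)
      refine ⟨C * C₂, ENNReal.mul_ne_top hC hC₂, fun A hA r hr => ?_⟩
      refine (hle A hA r hr).trans ?_
      calc C * ENNReal.ofReal (r ^ (s * x)) * (svfPow s 1 A * potential T p s (x - 1) θ' A)
          ≤ C * ENNReal.ofReal (r ^ (s * x)) * (C₂ * potential T p s x θ A) :=
            mul_le_mul_right (hpot A) _
        _ = _ := by ring

end MomentBounds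

/-! ### Almost sure bounds for correlation moments, for all `q` at once. -/

section LocalMoment

variable {N m : ℕ} {T : Fin m → E N →L[ℝ] E N} {lam c R : ℝ} {p : PMF (Fin m)}
  {ν : Measure (E N)} [IsProbabilityMeasure ν] {q s x r : ℝ}

theorem iterate_transfer_eq_sum (hp : ∀ i, 0 < p i) (f : (E N →L[ℝ] E N) → ℝ≥0∞) (k : ℕ)
    (A : E N →L[ℝ] E N) :
    (transfer T p x)^[k] f A = ∑ w : Fin k → Fin m,
      ENNReal.ofReal (wordWeight p (List.ofFn w)) ^ (x + 1) * f (A * wordMap T (List.ofFn w)) := by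
  induction k generalizing A with
  | zero => simp [wordWeight_nil, wordMap_nil]
  | succ k ih =>
    rw [Function.iterate_succ_apply', transfer,
      ← Fintype.sum_equiv (Fin.consEquiv fun _ : Fin (k + 1) => Fin m)
        (fun v => ENNReal.ofReal (wordWeight p (List.ofFn (Fin.cons v.1 v.2 : Fin (k + 1) → Fin m)))
          ^ (x + 1) * f (A * wordMap T (List.ofFn (Fin.cons v.1 v.2 : Fin (k + 1) → Fin m)))) _
        fun v => rfl, Fintype.sum_prod_type]
    refine Finset.sum_congr rfl fun a _ => ?_
    rw [ih, Finset.mul_sum]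
    refine Finset.sum_congr rfl fun w _ => ?_
    rw [List.ofFn_succ]
    simp only [Fin.cons_zero, Fin.cons_succ]
    rw [wordWeight_cons, wordMap_cons, ENNReal.ofReal_mul (weight_pos hp a).le,
      ENNReal.mul_rpow_of_ne_zero (by simpa using weight_pos hp a)
        (by simpa using wordWeight_pos hp _), ENNReal.ofReal_toReal (p.apply_ne_top a)]
    rw [mul_assoc A, mul_assoc]

/-- The link with the pressure: at the identity the iterates are the level sums, so the potential
there is a power series in `θ` whose convergence the pressure governs. -/
theorem iterate_transfer_one (hT : NormBounds T lam c) (hp : ∀ i, 0 < p i) (hs : 0 < s) (k : ℕ) :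
    (transfer T p (q - 1))^[k] (svfPow s (q - 1)) 1 =
      ENNReal.ofReal (levelSum T (bernoulliMeasure p) q s k) := by
  rw [iterate_transfer_eq_sum hp, levelSum_eq,
    ENNReal.ofReal_sum_of_nonneg fun w _ => (wordTerm_pos hT hp hs _).le]
  refine Finset.sum_congr rfl fun w _ => ?_
  have h1 := svf_pos (hT.wordMap_injective (List.ofFn w)) hs
  have h2 := wordWeight_pos hp (List.ofFn w)
  rw [wordTerm, ENNReal.ofReal_mul (by positivity), ← ENNReal.ofReal_rpow_of_pos h1,
    ← ENNReal.ofReal_rpow_of_pos h2, svfPow, one_mul, sub_add_cancel, mul_comm, neg_sub]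

theorem exists_potential_one_ne_top (hN : 1 ≤ N) (hm : 1 ≤ m) (hT : NormBounds T lam c)
    (hp : ∀ i, 0 < p i) (hs : 0 < s) (hq : 1 < q) (hP : pressure T p q s < 0) :
    ∃ θ : ℝ≥0∞, 1 < θ ∧ θ ≠ ⊤ ∧ potential T p s (q - 1) θ 1 ≠ ⊤ := by
  set P := pressure T p q s with hPdef
  -- The level sums are eventually below `exp (k P / 2)`, so this discount leaves a geometric series
  -- of ratio `exp (P / 4) < 1`.
  refine ⟨ENNReal.ofReal (Real.exp (-P / 4)), ?_, ENNReal.ofReal_ne_top, ?_⟩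
  · rw [ENNReal.one_lt_ofReal, Real.one_lt_exp_iff]
    linarith
  · have h1 : ∀ k, ENNReal.ofReal (Real.exp (-P / 4)) ^ k *
        (transfer T p (q - 1))^[k] (svfPow s (q - 1)) 1 =
        ENNReal.ofReal (Real.exp (-P / 4) ^ k * levelSum T (bernoulliMeasure p) q s k) := fun k => by
      rw [iterate_transfer_one hT hp hs, ENNReal.ofReal_mul (by positivity),
        ENNReal.ofReal_pow (by positivity)]
    simp only [potential, h1]
    refine Summable.tsum_ofReal_ne_top ?_
    refine Summable.of_norm_bounded_eventually_nat
      (summable_geometric_of_lt_one (Real.exp_pos (P / 4)).le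
        (Real.exp_lt_one_iff.2 (by linarith : P / 4 < 0))) ?_
    have ht := tendsto_pressure hN hm hT hp hs hq
    filter_upwards [ht.eventually (gt_mem_nhds (by linarith : P < P / 2)),
      eventually_ge_atTop 1] with k hk hk1
    have hk0 : (0 : ℝ) < k := by exact_mod_cast hk1
    have hS := levelSum_pos hm hT hp hs (q := q) k
    rw [div_lt_iff₀ hk0, Real.log_lt_iff_lt_exp hS] at hk
    rw [Real.norm_of_nonneg (by positivity)]
    calc _ ≤ Real.exp (-P / 4) ^ k * Real.exp (P / 2 * k) := by gcongr
      _ = _ := by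
        rw [← Real.exp_nat_mul, ← Real.exp_nat_mul, ← Real.exp_add]
        congr 1
        ring

/-- The `x`-th correlation moment of the projected measure at scale `r`. -/
noncomputable def localMoment (T : Fin m → E N →L[ℝ] E N) (p : PMF (Fin m)) (R x r : ℝ)
    (ω : List (Fin m) → E N) : ℝ≥0∞ :=
  ∫⁻ i, nearMass T p R 1 r (clipProj T R ω i) ω ^ x ∂(bernoulliMeasure p)

theorem measurable_localMoment (hT : NormBounds T lam c) (hR : 0 ≤ R) :
    Measurable (localMoment T p R x r) := by
  have h : Measurable fun y : (List (Fin m) → E N) × (ℕ → Fin m) =>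
      nearMass T p R 1 r (clipProj T R y.1 y.2) y.1 ^ x :=
    (measurable_nearMass hT hR p 1 r (measurable_clipProj hT hR) measurable_fst).pow_const x
  exact h.lintegral_prod_right'

theorem localMoment_mono (hx : 0 ≤ x) {r' : ℝ} (h : r ≤ r') (ω : List (Fin m) → E N) :
    localMoment T p R x r ω ≤ localMoment T p R x r' ω :=
  lintegral_mono fun _ => ENNReal.rpow_le_rpow
    (measure_mono fun _ hj => le_trans hj h) hx

theorem localMoment_le_rpow (hT : NormBounds T lam c) (hR : 0 ≤ R) {y : ℝ} (hx : 0 < x)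
    (hxy : x ≤ y) (ω : List (Fin m) → E N) :
    localMoment T p R x r ω ≤ localMoment T p R y r ω ^ (x / y) := by
  have h : Measurable fun i => clipProj T R ω i :=
    measurable_clipProj_comp hT hR measurable_const measurable_id
  exact lintegral_rpow_le_rpow _ (measurable_nearMass hT hR p 1 r h measurable_const) hx hxy

/-- At scale `2⁻ⁿ` the expected moment is at most a constant times `2 ^ (-n s (q - 1))`. As `t < s`,
the sum weighted by `2 ^ (n t (q - 1))` has finite expectation, hence is almost surely finite and
bounds each of its terms. Monotonicity in `r` fills the gaps between dyadic scales. -/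
theorem ae_localMoment_le (hN : 1 ≤ N) (hm : 2 ≤ m) (hT : NormBounds T lam c)
    (hp : ∀ i, 0 < p i) (hR : 0 ≤ R) (hν : ν ≪ volume) (hνR : ∀ᵐ z ∂ν, ‖z‖ ≤ R)
    (hsN : s ≤ N) (hq : 1 < q) (hP : pressure T p q s < 0) {t : ℝ} (ht : 0 < t) (hts : t < s) :
    ∀ᵐ ω ∂(displacementLaw m ν), ∃ C : ℝ≥0∞, C ≠ ⊤ ∧ ∀ r, 0 < r → r ≤ 1 →
      localMoment T p R (q - 1) r ω ≤ C * ENNReal.ofReal (r ^ (t * (q - 1))) := by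
  have hs : 0 < s := ht.trans hts
  have hx : 0 < q - 1 := by linarith
  obtain ⟨θ, hθ, hθt, hpot⟩ := exists_potential_one_ne_top hN (by omega) hT hp hs hq hP
  obtain ⟨C, hC, hcorr⟩ := exists_corrMoment_le hN hm hT hp hR hν hνR hs hsN hx hθ hθt
  have hsum : ∫⁻ ω, ∑' n : ℕ, ENNReal.ofReal (((1 / 2 : ℝ) ^ n) ^ (-(t * (q - 1)))) *
      localMoment T p R (q - 1) ((1 / 2) ^ n) ω ∂(displacementLaw m ν) ≠ ⊤ := by
    rw [lintegral_tsum fun n => ((measurable_localMoment hT hR).const_mul _).aemeasurable]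
    have h1 : ∀ n : ℕ, ∫⁻ ω, ENNReal.ofReal (((1 / 2 : ℝ) ^ n) ^ (-(t * (q - 1)))) *
        localMoment T p R (q - 1) ((1 / 2) ^ n) ω ∂(displacementLaw m ν) ≤
        C * potential T p s (q - 1) θ 1 *
          ENNReal.ofReal (((1 / 2 : ℝ) ^ ((s - t) * (q - 1))) ^ n) := fun n => by
      rw [lintegral_const_mul _ (measurable_localMoment hT hR)]
      have h2 := hcorr 1 (fun a b h => h) ((1 / 2) ^ n) (by positivity)
      refine (mul_le_mul_right h2 _).trans (le_of_eq ?_)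
      have e : ((1 / 2 : ℝ) ^ ((s - t) * (q - 1))) ^ n =
          ((1 / 2 : ℝ) ^ n) ^ (-(t * (q - 1))) * ((1 / 2 : ℝ) ^ n) ^ (s * (q - 1)) := by
        rw [← Real.rpow_add (by positivity), ← Real.rpow_natCast, ← Real.rpow_natCast,
          ← Real.rpow_mul (by norm_num), ← Real.rpow_mul (by norm_num)]
        congr 1
        ring
      rw [e, ENNReal.ofReal_mul (by positivity)]
      ring
    refine ne_top_of_le_ne_top ?_ (ENNReal.tsum_le_tsum h1)
    rw [ENNReal.tsum_mul_left]
    refine ENNReal.mul_ne_top (ENNReal.mul_ne_top hC hpot) (Summable.tsum_ofReal_ne_top ?_)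
    exact summable_geometric_of_lt_one (by positivity)
      (Real.rpow_lt_one (by norm_num) (by norm_num) (mul_pos (by linarith) hx))
  have hmeas : Measurable fun ω => ∑' n : ℕ, ENNReal.ofReal (((1 / 2 : ℝ) ^ n) ^ (-(t * (q - 1)))) *
      localMoment T p R (q - 1) ((1 / 2) ^ n) ω :=
    Measurable.tsum fun n => (measurable_localMoment hT hR).const_mul _
  filter_upwards [ae_lt_top hmeas hsum] with ω hω
  set K := ∑' n : ℕ, ENNReal.ofReal (((1 / 2 : ℝ) ^ n) ^ (-(t * (q - 1)))) *
      localMoment T p R (q - 1) ((1 / 2) ^ n) ω with hK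
  refine ⟨K * ENNReal.ofReal (2 ^ (t * (q - 1))),
    ENNReal.mul_ne_top hω.ne ENNReal.ofReal_ne_top, fun r hr hr1 => ?_⟩
  obtain ⟨n, hn1, hn2⟩ := exists_nat_pow_near_of_lt_one hr hr1
    (by norm_num : (0 : ℝ) < 1 / 2) (by norm_num)
  refine (localMoment_mono hx.le hn2 ω).trans ?_
  have h3 : ENNReal.ofReal (((1 / 2 : ℝ) ^ n) ^ (-(t * (q - 1)))) *
      localMoment T p R (q - 1) ((1 / 2) ^ n) ω ≤ K :=
    ENNReal.le_tsum (f := fun n : ℕ => ENNReal.ofReal (((1 / 2 : ℝ) ^ n) ^ (-(t * (q - 1)))) *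
      localMoment T p R (q - 1) ((1 / 2) ^ n) ω) n
  have h4 : (0 : ℝ) < (1 / 2) ^ n := by positivity
  have e1 : ENNReal.ofReal (((1 / 2 : ℝ) ^ n) ^ (t * (q - 1))) *
      ENNReal.ofReal (((1 / 2 : ℝ) ^ n) ^ (-(t * (q - 1)))) = 1 := by
    rw [← ENNReal.ofReal_mul (by positivity), ← Real.rpow_add h4, add_neg_cancel, Real.rpow_zero,
      ENNReal.ofReal_one]
  calc localMoment T p R (q - 1) ((1 / 2) ^ n) ω
      = ENNReal.ofReal (((1 / 2 : ℝ) ^ n) ^ (t * (q - 1))) *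
        (ENNReal.ofReal (((1 / 2 : ℝ) ^ n) ^ (-(t * (q - 1)))) *
          localMoment T p R (q - 1) ((1 / 2) ^ n) ω) := by rw [← mul_assoc, e1, one_mul]
    _ ≤ ENNReal.ofReal ((2 * r) ^ (t * (q - 1))) * K := by
      refine mul_le_mul' (ENNReal.ofReal_le_ofReal (Real.rpow_le_rpow h4.le ?_ (by positivity))) h3
      rw [pow_succ] at hn1
      linarith
    _ = _ := by
      rw [Real.mul_rpow (by norm_num) hr.le, ENNReal.ofReal_mul (by positivity)]
      ring

/-- Only countably many null sets may be discarded, so the bound is taken at rational parameters. A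
real `q` is reached from a slightly larger rational `Q` at which the pressure is still negative, and
Jensen descends from order `Q - 1` to `q - 1`. -/
theorem ae_forall_localMoment_le (hN : 1 ≤ N) (hm : 2 ≤ m) (hT : NormBounds T lam c)
    (hp : ∀ i, 0 < p i) (hR : 0 ≤ R) (hν : ν ≪ volume) (hνR : ∀ᵐ z ∂ν, ‖z‖ ≤ R) :
    ∀ᵐ ω ∂(displacementLaw m ν), ∀ q s t : ℝ, 1 < q → s ≤ N → pressure T p q s < 0 → 0 < t →
      t < s → ∃ C : ℝ≥0∞, C ≠ ⊤ ∧ ∀ r, 0 < r → r ≤ 1 →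
        localMoment T p R (q - 1) r ω ≤ C * ENNReal.ofReal (r ^ (t * (q - 1))) := by
  have hae : ∀ᵐ ω ∂(displacementLaw m ν), ∀ Q S t : ℚ, (1 : ℝ) < Q → (S : ℝ) ≤ N →
      pressure T p Q S < 0 → (0 : ℝ) < t → (t : ℝ) < S → ∃ C : ℝ≥0∞, C ≠ ⊤ ∧ ∀ r, 0 < r → r ≤ 1 →
        localMoment T p R (Q - 1) r ω ≤ C * ENNReal.ofReal (r ^ ((t : ℝ) * (Q - 1))) := by
    simp only [ae_all_iff]
    intro Q S t hQ hS hP ht hts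
    exact ae_localMoment_le hN hm hT hp hR hν hνR hS hQ hP ht hts
  filter_upwards [hae] with ω hω q s t hq hsN hP ht hts
  obtain ⟨S, hS1, hS2⟩ := exists_rat_btwn hts
  obtain ⟨t', ht1, ht2⟩ := exists_rat_btwn hS1
  have hS0 : (0 : ℝ) < S := by linarith
  have hPS : pressure T p q S < 0 :=
    (pressure_strictMonoOn hN (by omega) hT hp hq hS0 (hS0.trans hS2) hS2).trans hP
  have hlc : Real.log c < 0 := Real.log_neg hT.c_pos hT.c_lt_one
  obtain ⟨Q, hQ1, hQ2⟩ := exists_rat_btwn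
    (lt_add_of_pos_right q (div_pos_of_neg_of_neg hPS (mul_neg_of_pos_of_neg hS0 hlc)))
  have hPQ : pressure T p Q S < 0 := by
    have h := pressure_exponent_le hN (by omega) hT hp hS0 hq (sub_nonneg.2 hQ1.le)
    rw [add_sub_cancel] at h
    have h2 : (Q : ℝ) - q < pressure T p q S / (S * Real.log c) := by linarith
    rw [lt_div_iff_of_neg (mul_neg_of_pos_of_neg hS0 hlc)] at h2
    nlinarith
  obtain ⟨C, hC, hle⟩ := hω Q S t' (hq.trans hQ1) (hS2.le.trans hsN) hPQ (ht.trans ht1) ht2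
  have hx : 0 < q - 1 := by linarith
  have hX : 0 < (Q : ℝ) - 1 := by linarith
  refine ⟨C ^ ((q - 1) / (Q - 1)), ENNReal.rpow_ne_top_of_nonneg (by positivity) hC,
    fun r hr hr1 => ?_⟩
  refine (localMoment_le_rpow hT hR hx (by linarith : q - 1 ≤ Q - 1) ω).trans ?_
  refine (ENNReal.rpow_le_rpow (hle r hr hr1) (by positivity)).trans ?_
  rw [ENNReal.mul_rpow_of_nonneg _ _ (by positivity), ENNReal.ofReal_rpow_of_pos (by positivity),
    ← Real.rpow_mul hr.le]
  refine mul_le_mul_right (ENNReal.ofReal_le_ofReal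
    (Real.rpow_le_rpow_of_exponent_ge hr hr1 ?_)) _
  rw [mul_assoc, mul_div_cancel₀ _ hX.ne']
  exact mul_le_mul_of_nonneg_right ht1.le hx.le

end LocalMoment

/-! ### From correlation moments to mesh moment sums. -/

section MomentSum

variable {N m : ℕ} {T : Fin m → E N →L[ℝ] E N} {lam c R : ℝ} {p : PMF (Fin m)} {q r : ℝ}
  {ω : List (Fin m) → E N}

theorem clipProj_eq_projection (hω : ∀ w, ‖ω w‖ ≤ R) : clipProj T R ω = projection T ω := by
  funext i
  rw [clipProj, clip_eq_self hω]

theorem measurable_projection (hT : NormBounds T lam c) (hR : 0 ≤ R) (hω : ∀ w, ‖ω w‖ ≤ R) :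
    Measurable (projection T ω) := by
  rw [← clipProj_eq_projection hω]
  exact measurable_clipProj_comp hT hR measurable_const measurable_id

theorem tsum_measure_meshCube (τ : Measure (E N)) [IsProbabilityMeasure τ] (hr : 0 < r) :
    ∑' j : Fin N → ℤ, τ (meshCube r j) = 1 := by
  rw [← measure_iUnion (pairwise_disjoint_meshCube hr) fun j => measurableSet_meshCube r j,
    iUnion_meshCube hr, measure_univ]

theorem tsum_measure_rpow_le_one (τ : Measure (E N)) [IsProbabilityMeasure τ] (hr : 0 < r)
    (hq : 1 ≤ q) : ∑' j : Fin N → ℤ, τ (meshCube r j) ^ q ≤ 1 := by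
  rw [← tsum_measure_meshCube τ hr]
  exact ENNReal.tsum_le_tsum fun j => ENNReal.rpow_le_self_of_le_one prob_le_one hq

theorem ofReal_momentSum (τ : Measure (E N)) [IsProbabilityMeasure τ] (hr : 0 < r) (hq : 1 ≤ q) :
    ENNReal.ofReal (momentSum τ q r) = ∑' j : Fin N → ℤ, τ (meshCube r j) ^ q := by
  have h := tsum_measure_rpow_le_one τ hr hq
  have h1 : momentSum τ q r = (∑' j : Fin N → ℤ, τ (meshCube r j) ^ q).toReal := by
    rw [ENNReal.tsum_toReal_eq fun j => ENNReal.rpow_ne_top_of_nonneg (by linarith)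
      (measure_ne_top τ _)]
    simp only [momentSum, Measure.real, ENNReal.toReal_rpow]
  rw [h1, ENNReal.ofReal_toReal (h.trans_lt ENNReal.one_lt_top).ne]

/-- Points of one mesh cube are within `√N r` of each other, so the mass of a cube is at most the
near mass around each of its points. Integrating the `(q - 1)`-th power over the cube produces the
`q`-th power. -/
theorem tsum_measure_rpow_le_localMoment (hT : NormBounds T lam c) (hR : 0 ≤ R)
    (hω : ∀ w, ‖ω w‖ ≤ R) (hr : 0 < r) (hq : 1 < q) :
    ∑' j : Fin N → ℤ, projectedMeasure T (bernoulliMeasure p) ω (meshCube r j) ^ q ≤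
      localMoment T p R (q - 1) (Real.sqrt N * r) ω := by
  have hm := measurable_projection hT hR hω
  have hS : ∀ j : Fin N → ℤ, MeasurableSet (projection T ω ⁻¹' meshCube r j) := fun j =>
    hm (measurableSet_meshCube r j)
  have hU : ⋃ j : Fin N → ℤ, projection T ω ⁻¹' meshCube r j = Set.univ := by
    rw [← Set.preimage_iUnion, iUnion_meshCube hr, Set.preimage_univ]
  rw [localMoment, ← setLIntegral_univ, ← hU, lintegral_iUnion hS
    fun j k hjk => (pairwise_disjoint_meshCube hr hjk).preimage _]
  refine ENNReal.tsum_le_tsum fun j => ?_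
  rw [projectedMeasure, Measure.map_apply hm (measurableSet_meshCube r j)]
  set S := projection T ω ⁻¹' meshCube r j with hSdef
  have h1 : bernoulliMeasure p S ^ q = ∫⁻ _ in S, bernoulliMeasure p S ^ (q - 1)
      ∂(bernoulliMeasure p) := by
    have h2 := ENNReal.rpow_add_of_nonneg (x := bernoulliMeasure p S) (q - 1) 1 (by linarith)
      zero_le_one
    rwa [sub_add_cancel, ENNReal.rpow_one, ← setLIntegral_const] at h2
  rw [h1]
  refine setLIntegral_mono' (hS j) fun i hi => ENNReal.rpow_le_rpow (measure_mono fun k hk => ?_)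
    (by linarith)
  rw [Set.mem_ofPred_eq, clipProj_eq_projection hω]
  exact norm_sub_le_of_mem_meshCube hi hk hr

theorem exists_momentSum_le (hN : 1 ≤ N) (hT : NormBounds T lam c) (hR : 0 ≤ R)
    (hω : ∀ w, ‖ω w‖ ≤ R) (hq : 1 < q) {t : ℝ} {C : ℝ≥0∞} (hC : C ≠ ⊤)
    (h : ∀ r, 0 < r → r ≤ 1 →
      localMoment T p R (q - 1) r ω ≤ C * ENNReal.ofReal (r ^ (t * (q - 1)))) :
    ∃ K : ℝ, 0 < K ∧ ∀ᶠ r in 𝓝[>] 0,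
      momentSum (projectedMeasure T (bernoulliMeasure p) ω) q r ≤ K * r ^ (t * (q - 1)) := by
  have hN0 : 0 < Real.sqrt N := Real.sqrt_pos.2 (by exact_mod_cast hN)
  refine ⟨C.toReal * Real.sqrt N ^ (t * (q - 1)) + 1, by positivity, ?_⟩
  have : IsProbabilityMeasure (projectedMeasure T (bernoulliMeasure p) ω) :=
    Measure.isProbabilityMeasure_map (measurable_projection hT hR hω).aemeasurable
  filter_upwards [Ioc_mem_nhdsGT (inv_pos.2 hN0)] with r hr
  have h1 := (tsum_measure_rpow_le_localMoment (p := p) hT hR hω hr.1 hq).trans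
    (h (Real.sqrt N * r) (mul_pos hN0 hr.1) (by
      rw [mul_comm, ← le_div_iff₀ hN0, one_div]
      exact hr.2))
  rw [← ofReal_momentSum _ hr.1 hq.le, ← ENNReal.ofReal_toReal hC,
    ← ENNReal.ofReal_mul ENNReal.toReal_nonneg] at h1
  have hpos := Real.rpow_pos_of_pos hr.1 (t * (q - 1))
  have hN1 := Real.rpow_pos_of_pos hN0 (t * (q - 1))
  have h2 := (ENNReal.ofReal_le_ofReal_iff
    (mul_nonneg ENNReal.toReal_nonneg (Real.rpow_nonneg (mul_pos hN0 hr.1).le _))).1 h1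
  rw [Real.mul_rpow hN0.le hr.1.le] at h2
  nlinarith

end MomentSum

/-! ### Lower bounds for moment sums by counting cubes. -/

section Counting

variable {N m : ℕ} {T : Fin m → E N →L[ℝ] E N} {lam c R : ℝ} {p : PMF (Fin m)} {q r s : ℝ}
  {ω : List (Fin m) → E N}

/-- A singular value is a quotient of consecutive leading products. Apply submultiplicativity to `A
= (A * B) * B⁻¹` for the longer product and to `A * B` for the shorter one. The estimate limits how
far a singular value can fall when one block of letters is appended. -/
theorem pow_mul_sv_le_sv_mul {A B : E N →L[ℝ] E N} (hA : Function.Injective A)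
    (hB : Function.Injective B) (hB1 : ‖B‖ ≤ 1) {d : ℝ} (hd0 : 0 < d) (hd1 : d ≤ 1)
    (hd : ∀ x, d * ‖x‖ ≤ ‖B x‖) {i : ℕ} (hi : i < N) : d ^ N * sv A i ≤ sv (A * B) i := by
  obtain ⟨C, hC, hBC, -⟩ := exists_inverse hB
  have hCn : ‖C‖ ≤ d⁻¹ := by
    refine ContinuousLinearMap.opNorm_le_bound _ (by positivity) fun y => ?_
    have h := hd (C y)
    rw [← mul_apply_eq_comp, hBC] at h
    rw [inv_mul_eq_div, le_div_iff₀ hd0, mul_comm]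
    exact h
  have h1 := prod_sv_mul_le (A * B) hC (Nat.succ_le_of_lt hi)
  rw [mul_assoc, hBC, mul_one] at h1
  have h2 := prod_sv_mul_le A hB hi.le
  have hPB : ∏ k ∈ Finset.range i, sv B k ≤ 1 :=
    Finset.prod_le_one (fun k _ => sv_nonneg B k) fun k _ => (sv_le_norm B k).trans hB1
  have hPC : ∏ k ∈ Finset.range (i + 1), sv C k ≤ d⁻¹ ^ N := by
    refine (Finset.prod_le_prod (fun k _ => sv_nonneg C k)
      fun k _ => (sv_le_norm C k).trans hCn).trans ?_
    rw [Finset.prod_const, Finset.card_range]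
    exact pow_le_pow_right₀ (one_le_inv_iff₀.2 ⟨hd0, hd1⟩) hi
  have hPA : 0 < ∏ k ∈ Finset.range i, sv A k :=
    Finset.prod_pos fun k hk => sv_pos hA ((Finset.mem_range.1 hk).trans hi)
  have h3 : ∏ k ∈ Finset.range i, sv (A * B) k ≤ ∏ k ∈ Finset.range i, sv A k :=
    h2.trans (mul_le_of_le_one_right hPA.le hPB)
  rw [Nat.succ_eq_add_one, Finset.prod_range_succ, Finset.prod_range_succ] at h1
  have h4 : (∏ k ∈ Finset.range i, sv A k) * sv A i ≤
      (∏ k ∈ Finset.range i, sv A k) * (sv (A * B) i * d⁻¹ ^ N) := by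
    refine h1.trans ?_
    rw [← mul_assoc]
    exact mul_le_mul (mul_le_mul_of_nonneg_right h3 (sv_nonneg _ i)) hPC
      (Finset.prod_nonneg fun k _ => sv_nonneg C k) (mul_nonneg hPA.le (sv_nonneg _ i))
  have h5 := le_of_mul_le_mul_left h4 hPA
  rwa [inv_pow, ← div_eq_mul_inv, le_div_iff₀ (by positivity), mul_comm] at h5

/-- The infinite words that start with a given finite word. -/
def wordCylinder (u : List (Fin m)) : Set (ℕ → Fin m) :=
  {i | curtail i u.length = u}

theorem wordCylinder_ofFn {k : ℕ} (w : Fin k → Fin m) :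
    wordCylinder (List.ofFn w) = cylinder w := by
  ext i
  simp only [wordCylinder, cylinder, Set.mem_ofPred_eq, curtail]
  rw [List.ofFn_congr (List.length_ofFn (f := w)), List.ofFn_inj, funext_iff]
  rfl

theorem measurableSet_wordCylinder (u : List (Fin m)) : MeasurableSet (wordCylinder u) := by
  rw [← List.ofFn_get u, wordCylinder_ofFn]
  have : cylinder u.get = ⋂ j : Fin u.length, {i : ℕ → Fin m | i j = u.get j} := by
    ext i
    simp [cylinder]
  rw [this]
  exact MeasurableSet.iInter fun j => measurable_pi_apply (j : ℕ) (measurableSet_singleton _)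

theorem bernoulliMeasure_wordCylinder (p : PMF (Fin m)) (u : List (Fin m)) :
    bernoulliMeasure p (wordCylinder u) = ENNReal.ofReal (wordWeight p u) := by
  conv_lhs => rw [← List.ofFn_get u]
  rw [wordCylinder_ofFn, ← ENNReal.ofReal_toReal (measure_ne_top (bernoulliMeasure p) _)]
  congr 1
  rw [← Measure.real, bernoulliMeasure_real_cylinder, List.ofFn_get]

theorem curtail_take (i : ℕ → Fin m) {k l : ℕ} (h : k ≤ l) : (curtail i l).take k = curtail i k := by
  refine List.ext_getElem (by simp [curtail, h]) fun n h1 h2 => ?_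
  simp [curtail]

theorem wordCylinder_append_subset (u v : List (Fin m)) :
    wordCylinder (u ++ v) ⊆ wordCylinder u := by
  intro i hi
  rw [wordCylinder, Set.mem_ofPred_eq] at hi ⊢
  rw [← curtail_take i (show u.length ≤ (u ++ v).length by simp), hi, List.take_left']
  rfl

theorem disjoint_wordCylinder {u v : List (Fin m)} (hl : u.length = v.length) (huv : u ≠ v) :
    Disjoint (wordCylinder u) (wordCylinder v) := by
  rw [Set.disjoint_left]
  intro i hi hi'
  rw [wordCylinder, Set.mem_ofPred_eq] at hi hi'
  rw [← hl, hi] at hi'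
  exact huv hi'

theorem exists_projection_eq_add (hT : NormBounds T lam c) (u : List (Fin m))
    (hω : ∀ w, ‖ω w‖ ≤ R) :
    ∃ y : E N, ∀ i ∈ wordCylinder u, ∃ x, ‖x‖ ≤ R * (1 - lam)⁻¹ ∧
      projection T ω i = y + wordMap T u x := by
  induction u generalizing ω with
  | nil =>
    refine ⟨0, fun i _ => ⟨projection T ω i, norm_projection_le hT hω i, ?_⟩⟩
    rw [wordMap_nil, zero_add]
    rfl
  | cons b v ih =>
    obtain ⟨y, hy⟩ := ih fun w => hω (b :: w)
    refine ⟨ω [b] + T b y, fun i hi => ?_⟩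
    have hij : i = consWord (i 0) fun n => i (n + 1) := by
      funext n
      cases n <;> rfl
    rw [wordCylinder, Set.mem_ofPred_eq, List.length_cons, hij, curtail_consWord,
      List.cons.injEq] at hi
    obtain ⟨x, hx, hxe⟩ := hy _ hi.2
    refine ⟨x, hx, ?_⟩
    rw [hij, hi.1, projection_consWord hT hω, hxe, wordMap_cons, map_add, mul_apply_eq_comp,
      add_assoc]

/-- The moment sum of the projection of the Bernoulli measure restricted to a cylinder. -/
noncomputable def cylinderMoment (T : Fin m → E N →L[ℝ] E N) (p : PMF (Fin m))
    (ω : List (Fin m) → E N) (q r : ℝ) (u : List (Fin m)) : ℝ≥0∞ :=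
  ∑' j : Fin N → ℤ, bernoulliMeasure p (wordCylinder u ∩ projection T ω ⁻¹' meshCube r j) ^ q

theorem cylinderMoment_nil (hT : NormBounds T lam c) (hR : 0 ≤ R) (hω : ∀ w, ‖ω w‖ ≤ R) :
    cylinderMoment T p ω q r [] =
      ∑' j : Fin N → ℤ, projectedMeasure T (bernoulliMeasure p) ω (meshCube r j) ^ q := by
  have h : wordCylinder ([] : List (Fin m)) = Set.univ := by
    ext i
    simp [wordCylinder, curtail_zero]
  refine tsum_congr fun j => ?_
  rw [h, Set.univ_inter, projectedMeasure,
    Measure.map_apply (measurable_projection hT hR hω) (measurableSet_meshCube r j)]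

theorem sum_rpow_le_of_sum_le {ι : Type*} {F : Finset ι} {f : ι → ℝ≥0∞} {a : ℝ≥0∞} (hq : 1 ≤ q)
    (h : ∑ i ∈ F, f i ≤ a) : ∑ i ∈ F, f i ^ q ≤ a ^ q := by
  have e : ∀ b : ℝ≥0∞, b ^ q = b ^ (q - 1) * b := fun b => by
    have h2 := ENNReal.rpow_add_of_nonneg (x := b) (q - 1) 1 (by linarith) zero_le_one
    rwa [sub_add_cancel, ENNReal.rpow_one] at h2
  calc ∑ i ∈ F, f i ^ q ≤ ∑ i ∈ F, a ^ (q - 1) * f i := by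
        refine Finset.sum_le_sum fun i hi => ?_
        rw [e]
        exact mul_le_mul_left (ENNReal.rpow_le_rpow
          ((Finset.single_le_sum (fun _ _ => zero_le) hi).trans h) (by linarith)) _
    _ ≤ a ^ q := by
        rw [← Finset.mul_sum, e a]
        exact mul_le_mul_right h _

/-- In each cube, `t ↦ t ^ q` is superadditive and the subcylinders are disjoint. -/
theorem sum_cylinderMoment_le (hT : NormBounds T lam c) (hR : 0 ≤ R) (hω : ∀ w, ‖ω w‖ ≤ R)
    (hq : 1 ≤ q) (u : List (Fin m)) (k : ℕ) :
    ∑ w : Fin k → Fin m, cylinderMoment T p ω q r (u ++ List.ofFn w) ≤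
      cylinderMoment T p ω q r u := by
  unfold cylinderMoment
  rw [← Summable.tsum_finsetSum fun _ _ => ENNReal.summable]
  refine ENNReal.tsum_le_tsum fun j => sum_rpow_le_of_sum_le hq ?_
  rw [← measure_biUnion_finset]
  · exact measure_mono (Set.iUnion₂_subset fun w _ =>
      Set.inter_subset_inter_left _ (wordCylinder_append_subset u _))
  · intro w _ w' _ hww
    refine Disjoint.mono Set.inter_subset_left Set.inter_subset_left
      (disjoint_wordCylinder (by simp) fun h => hww ?_)
    exact List.ofFn_injective (List.append_cancel_left h)
  · exact fun w _ => (measurableSet_wordCylinder _).inter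
      (measurable_projection hT hR hω (measurableSet_meshCube r j))

/-- The mass of the cylinder is spread over a bounded number of cubes, since its image is a
translate of the image of a ball under `wordMap T u`; the power mean inequality then applies. -/
theorem rpow_wordWeight_le_cylinderMoment (hN : 1 ≤ N) (hT : NormBounds T lam c) (hR : 0 ≤ R)
    (hω : ∀ w, ‖ω w‖ ≤ R) (hq : 1 < q) (hr : 0 < r) (u : List (Fin m)) :
    ENNReal.ofReal (wordWeight p u) ^ q ≤
      ENNReal.ofReal ((2 * (R * (1 - lam)⁻¹ + Real.sqrt N)) ^ N *
        ∏ i ∈ Finset.range N, max 1 (sv (wordMap T u) i / r)) ^ (q - 1) *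
      cylinderMoment T p ω q r u := by
  set B := (2 * (R * (1 - lam)⁻¹ + Real.sqrt N)) ^ N *
        ∏ i ∈ Finset.range N, max 1 (sv (wordMap T u) i / r) with hB
  have hm := measurable_projection hT hR hω
  set a : (Fin N → ℤ) → ℝ≥0∞ := fun j =>
    bernoulliMeasure p (wordCylinder u ∩ projection T ω ⁻¹' meshCube r j) with ha
  have hsum : ENNReal.ofReal (wordWeight p u) = ∑' j, a j := by
    rw [← bernoulliMeasure_wordCylinder, ← measure_iUnion, ← Set.inter_iUnion,
      ← Set.preimage_iUnion, iUnion_meshCube hr, Set.preimage_univ, Set.inter_univ]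
    · exact fun j k hjk => Disjoint.mono Set.inter_subset_right Set.inter_subset_right
        ((pairwise_disjoint_meshCube hr hjk).preimage _)
    · exact fun j => (measurableSet_wordCylinder u).inter (hm (measurableSet_meshCube r j))
  obtain ⟨y, hy⟩ := exists_projection_eq_add hT u hω
  have hlam : 0 ≤ R * (1 - lam)⁻¹ :=
    mul_nonneg hR (inv_nonneg.2 (sub_nonneg.2 hT.lam_lt_one.le))
  have hfin : ∀ F : Finset (Fin N → ℤ), ∑ j ∈ F, a j ≤
      (ENNReal.ofReal B ^ (q - 1) * cylinderMoment T p ω q r u) ^ q⁻¹ := by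
    intro F
    rw [ENNReal.le_rpow_inv_iff (by linarith)]
    -- Only cubes of positive mass contain a projected point of the cylinder, so only these are
    -- counted.
    have h0 : ∑ j ∈ F, a j = ∑ j ∈ F with a j ≠ 0, a j := (Finset.sum_filter_ne_zero F).symm
    rw [h0]
    refine (ENNReal.rpow_sum_le_const_mul_sum_rpow _ _ hq.le).trans
      (mul_le_mul' (ENNReal.rpow_le_rpow ?_ (by linarith)) (ENNReal.sum_le_tsum _))
    rw [← ENNReal.ofReal_natCast]
    refine ENNReal.ofReal_le_ofReal
      (card_meshCube_le hN hlam (hT.wordMap_injective u) y hr _ fun j hj => ?_)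
    obtain ⟨i, hi1, hi2⟩ := nonempty_of_measure_ne_zero (Finset.mem_filter.1 hj).2
    obtain ⟨x, hx, hxe⟩ := hy i hi1
    refine ⟨x, hx, ?_⟩
    rw [← hxe]
    exact hi2
  rw [hsum, ← ENNReal.le_rpow_inv_iff (by linarith), ENNReal.tsum_eq_iSup_sum]
  exact iSup_le hfin

theorem ofReal_le_of_rpow_le {w b K : ℝ} {M : ℝ≥0∞} (hw : 0 < w) (hK : 0 < K)
    (hbK : b ≤ K) (hq : 1 < q)
    (h : ENNReal.ofReal w ^ q ≤ ENNReal.ofReal b ^ (q - 1) * M) :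
    ENNReal.ofReal (K ^ (1 - q) * w ^ q) ≤ M := by
  have h1 : ENNReal.ofReal w ^ q ≤ ENNReal.ofReal K ^ (q - 1) * M :=
    h.trans (mul_le_mul_left
      (ENNReal.rpow_le_rpow (ENNReal.ofReal_le_ofReal hbK) (by linarith)) _)
  rw [ENNReal.ofReal_mul (by positivity), ← ENNReal.ofReal_rpow_of_pos hK,
    ← ENNReal.ofReal_rpow_of_pos hw]
  have hK0 : ENNReal.ofReal K ≠ 0 := by simpa using hK
  calc _ ≤ ENNReal.ofReal K ^ (1 - q) * (ENNReal.ofReal K ^ (q - 1) * M) := mul_le_mul_right h1 _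
    _ = M := by
      rw [← mul_assoc, ← ENNReal.rpow_add _ _ hK0 ENNReal.ofReal_ne_top]
      simp

/-- A stopping-time argument. Words are extended by blocks of length `k` until α_⌈s⌉ is at most `r`;
one block cannot take it below `(c ^ k) ^ N * r`, so the cube count is then controlled by φ^s
r^{-s}. Since the level sum at `k` is at least 1, the terms of the extensions add up to at least the
term of `u`, and the bound passes back to `u`. The number `n` bounds the letters still needed before
stopping is forced. -/
theorem mul_wordTerm_le_cylinderMoment (hN : 1 ≤ N) (hT : NormBounds T lam c)
    (hp : ∀ i, 0 < p i) (hR : 0 ≤ R) (hω : ∀ w, ‖ω w‖ ≤ R) (hq : 1 < q) (hr : 0 < r) (hs : 0 < s)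
    (hsN : s ≤ N) {k : ℕ} (hk : 1 ≤ k) (hS : 1 ≤ levelSum T (bernoulliMeasure p) q s k) (n : ℕ)
    (u : List (Fin m)) (hn : lam ^ (u.length + n) ≤ r)
    (hu : (c ^ k) ^ N * r ≤ sv (wordMap T u) (⌈s⌉₊ - 1)) :
    ENNReal.ofReal (((2 * (R * (1 - lam)⁻¹ + Real.sqrt N)) ^ N * ((c ^ k) ^ N)⁻¹ ^ N) ^ (1 - q) *
      r ^ (s * (q - 1)) * wordTerm T p q s u) ≤ cylinderMoment T p ω q r u := by
  have hc := hT.c_pos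
  have hl := hT.lam_pos
  have hlam : 0 ≤ R * (1 - lam)⁻¹ :=
    mul_nonneg hR (inv_nonneg.2 (sub_nonneg.2 hT.lam_lt_one.le))
  have hN0 : 0 < Real.sqrt N := Real.sqrt_pos.2 (by exact_mod_cast hN)
  have hck : c ^ k ≤ 1 := pow_le_one₀ hc.le hT.c_lt_one.le
  have hJ : ⌈s⌉₊ - 1 < N := by
    have := Nat.ceil_le.2 hsN
    omega
  set D := (2 * (R * (1 - lam)⁻¹ + Real.sqrt N)) ^ N with hD
  have hD0 : 0 < D := by positivity
  have hsmall : ∀ u : List (Fin m), (c ^ k) ^ N * r ≤ sv (wordMap T u) (⌈s⌉₊ - 1) →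
      sv (wordMap T u) (⌈s⌉₊ - 1) ≤ r →
      ENNReal.ofReal ((D * ((c ^ k) ^ N)⁻¹ ^ N) ^ (1 - q) * r ^ (s * (q - 1)) *
        wordTerm T p q s u) ≤ cylinderMoment T p ω q r u := by
    intro u h1 h2
    have hφ := svf_pos (hT.wordMap_injective u) hs
    have hmax := prod_max_le hN hs hsN (hT.wordMap_injective u) hr (by positivity)
      (pow_le_one₀ (by positivity) hck) h1 h2
    have h3 := ofReal_le_of_rpow_le (wordWeight_pos hp u)
      (by positivity) (mul_le_mul_of_nonneg_left hmax hD0.le) hq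
      (rpow_wordWeight_le_cylinderMoment hN hT hR hω hq hr u)
    refine le_trans (le_of_eq ?_) h3
    congr 1
    rw [wordTerm, ← mul_assoc D,
      Real.mul_rpow (x := D * ((c ^ k) ^ N)⁻¹ ^ N) (y := _ / _) (by positivity) (by positivity),
      Real.div_rpow hφ.le (by positivity), ← Real.rpow_mul hr.le,
      show s * (q - 1) = -(s * (1 - q)) by ring, Real.rpow_neg hr.le]
    ring
  induction n generalizing u with
  | zero =>
    exact hsmall u hu (((sv_le_norm _ _).trans (hT.norm_wordMap_le u)).trans (by simpa using hn))
  | succ n ih =>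
    rcases le_or_gt (sv (wordMap T u) (⌈s⌉₊ - 1)) r with h | h
    · exact hsmall u hu h
    · refine le_trans ?_ (sum_cylinderMoment_le hT hR hω hq.le u k)
      have hstep : ∀ w : Fin k → Fin m, ENNReal.ofReal ((D * ((c ^ k) ^ N)⁻¹ ^ N) ^ (1 - q) *
          r ^ (s * (q - 1)) * wordTerm T p q s (u ++ List.ofFn w)) ≤
          cylinderMoment T p ω q r (u ++ List.ofFn w) := by
        intro w
        refine ih _ ?_ ?_
        · refine le_trans (pow_le_pow_of_le_one hl.le hT.lam_lt_one.le ?_) hn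
          rw [List.length_append, List.length_ofFn]
          omega
        · rw [wordMap_append]
          have hlow := hT.lower_wordMap (List.ofFn w)
          have hle := hT.norm_wordMap_le (List.ofFn w)
          rw [List.length_ofFn] at hlow hle
          refine le_trans ?_ (pow_mul_sv_le_sv_mul (hT.wordMap_injective u)
            (hT.wordMap_injective (List.ofFn w))
            (hle.trans (pow_le_one₀ hl.le hT.lam_lt_one.le)) (by positivity) hck hlow hJ)
          exact mul_le_mul_of_nonneg_left h.le (by positivity)
      refine le_trans ?_ (Finset.sum_le_sum fun w _ => hstep w)
      have hW : ∀ w, 0 < wordTerm T p q s w := wordTerm_pos hT hp hs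
      rw [← ENNReal.ofReal_sum_of_nonneg fun w _ => mul_nonneg (by positivity) (hW _).le,
        ← Finset.mul_sum]
      refine ENNReal.ofReal_le_ofReal (mul_le_mul_of_nonneg_left ?_ (by positivity))
      calc wordTerm T p q s u ≤ wordTerm T p q s u * levelSum T (bernoulliMeasure p) q s k :=
            le_mul_of_one_le_right (hW u).le hS
        _ ≤ _ := by
            rw [levelSum_eq, Finset.mul_sum]
            exact Finset.sum_le_sum fun w _ => wordTerm_mul_le hT hp hs hq u _

theorem exists_le_momentSum_of_pressure_pos (hN : 1 ≤ N) (hm : 1 ≤ m) (hT : NormBounds T lam c)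
    (hp : ∀ i, 0 < p i) (hR : 0 ≤ R) (hω : ∀ w, ‖ω w‖ ≤ R) (hq : 1 < q) (hs : 0 < s)
    (hsN : s ≤ N) (hP : 0 < pressure T p q s) :
    ∃ K : ℝ, 0 < K ∧ ∀ᶠ r in 𝓝[>] 0,
      K * r ^ (s * (q - 1)) ≤ momentSum (projectedMeasure T (bernoulliMeasure p) ω) q r := by
  have : IsProbabilityMeasure (projectedMeasure T (bernoulliMeasure p) ω) :=
    Measure.isProbabilityMeasure_map (measurable_projection hT hR hω).aemeasurable
  have hc := hT.c_pos
  have hlam : 0 ≤ R * (1 - lam)⁻¹ :=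
    mul_nonneg hR (inv_nonneg.2 (sub_nonneg.2 hT.lam_lt_one.le))
  have hN0 : 0 < Real.sqrt N := Real.sqrt_pos.2 (by exact_mod_cast hN)
  obtain ⟨k, hk, hk1⟩ := (((tendsto_pressure hN hm hT hp hs hq).eventually
    (lt_mem_nhds hP)).and (eventually_ge_atTop 1)).exists
  have hS : 1 ≤ levelSum T (bernoulliMeasure p) q s k := by
    have hk0 : (0 : ℝ) < k := by exact_mod_cast hk1
    have h1 : 0 < Real.log (levelSum T (bernoulliMeasure p) q s k) := by
      rw [lt_div_iff₀ hk0, zero_mul] at hk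
      exact hk
    exact ((Real.log_pos_iff (levelSum_pos hm hT hp hs k).le).1 h1).le
  refine ⟨((2 * (R * (1 - lam)⁻¹ + Real.sqrt N)) ^ N * ((c ^ k) ^ N)⁻¹ ^ N) ^ (1 - q),
    by positivity, ?_⟩
  filter_upwards [Ioc_mem_nhdsGT one_pos] with r hr
  obtain ⟨n, hn⟩ := exists_pow_lt_of_lt_one hr.1 hT.lam_lt_one
  have hJ : ⌈s⌉₊ - 1 < N := by
    have := Nat.ceil_le.2 hsN
    omega
  -- At the empty word the term is 1, and `r ≤ 1` gives the required lower bound on the singular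
  -- values of the identity.
  have h := mul_wordTerm_le_cylinderMoment hN hT hp hR hω hq hr.1 hs hsN hk1 hS n []
    (by simpa using hn.le) (by
      rw [wordMap_nil, sv_one hJ]
      exact mul_le_one₀ (pow_le_one₀ (by positivity) (pow_le_one₀ hc.le hT.c_lt_one.le)) hr.1.le
        hr.2)
  rw [cylinderMoment_nil hT hR hω, ← ofReal_momentSum _ hr.1 hq.le, wordTerm, wordMap_nil,
    wordWeight_nil, svf_one hs, Real.one_rpow, Real.one_rpow, one_mul, mul_one] at h
  exact (ENNReal.ofReal_le_ofReal_iff (tsum_nonneg fun j => by positivity)).1 h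

/-- The image is bounded, hence meets at most a constant times `r ^ (-N)` cubes. This gives the cap
`N` on the dimension and the positivity of the moment sums near 0. -/
theorem exists_le_momentSum (hN : 1 ≤ N) (hT : NormBounds T lam c)
    (hR : 0 ≤ R) (hω : ∀ w, ‖ω w‖ ≤ R) (hq : 1 < q) :
    ∃ K : ℝ, 0 < K ∧ ∀ᶠ r in 𝓝[>] 0,
      K * r ^ (N * (q - 1)) ≤ momentSum (projectedMeasure T (bernoulliMeasure p) ω) q r := by
  have : IsProbabilityMeasure (projectedMeasure T (bernoulliMeasure p) ω) :=
    Measure.isProbabilityMeasure_map (measurable_projection hT hR hω).aemeasurable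
  have hlam : 0 ≤ R * (1 - lam)⁻¹ :=
    mul_nonneg hR (inv_nonneg.2 (sub_nonneg.2 hT.lam_lt_one.le))
  have hN0 : 0 < Real.sqrt N := Real.sqrt_pos.2 (by exact_mod_cast hN)
  refine ⟨((2 * (R * (1 - lam)⁻¹ + Real.sqrt N)) ^ N) ^ (1 - q), by positivity, ?_⟩
  filter_upwards [Ioc_mem_nhdsGT one_pos] with r hr
  have hr0 := hr.1
  have h := rpow_wordWeight_le_cylinderMoment (p := p) hN hT hR hω hq hr.1 []
  have hprod : ∏ i ∈ Finset.range N, max 1 (sv (wordMap T []) i / r) = r⁻¹ ^ N := by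
    rw [Finset.prod_congr rfl fun i hi => ?_, Finset.prod_const, Finset.card_range]
    rw [wordMap_nil, sv_one (Finset.mem_range.1 hi), one_div,
      max_eq_right (one_le_inv_iff₀.2 hr)]
  rw [hprod, wordWeight_nil] at h
  have h2 := ofReal_le_of_rpow_le one_pos (by positivity) le_rfl hq h
  rw [cylinderMoment_nil hT hR hω, ← ofReal_momentSum _ hr.1 hq.le, Real.one_rpow, mul_one,
    Real.mul_rpow (by positivity) (by positivity), ← Real.rpow_natCast r⁻¹, Real.inv_rpow hr0.le,
    ← Real.rpow_neg hr0.le, ← Real.rpow_mul hr0.le,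
    show -(N : ℝ) * (1 - q) = N * (q - 1) by ring] at h2
  exact (ENNReal.ofReal_le_ofReal_iff (tsum_nonneg fun j => by positivity)).1 h2

end Counting

/-! ### From power bounds on moment sums to the dimensions. -/

section Dimension

variable {N m : ℕ} {T : Fin m → E N →L[ℝ] E N} {lam c R : ℝ} {p : PMF (Fin m)} {q : ℝ}
  {ω : List (Fin m) → E N}

theorem tendsto_add_div_log (hq : 1 < q) (K t : ℝ) :
    Tendsto (fun r => t + Real.log K / ((q - 1) * Real.log r)) (𝓝[>] 0) (𝓝 t) := by
  have h : Tendsto (fun r => (q - 1) * Real.log r) (𝓝[>] 0) atBot :=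
    Real.tendsto_log_nhdsGT_zero.const_mul_atBot (by linarith)
  simpa using (h.const_div_atBot (Real.log K)).const_add t

/-- Near 0 the denominator is negative, so a lower bound on moment sums becomes an upper bound on
the dimension quotient; the constant `K` is negligible in the limit. -/
theorem eventually_log_div_lt {f : ℝ → ℝ} (hq : 1 < q) {K s b : ℝ} (hK : 0 < K)
    (h : ∀ᶠ r in 𝓝[>] 0, K * r ^ (s * (q - 1)) ≤ f r) (hb : s < b) :
    ∀ᶠ r in 𝓝[>] 0, Real.log (f r) / ((q - 1) * Real.log r) < b := by
  filter_upwards [h, (tendsto_add_div_log hq K s).eventually (gt_mem_nhds hb),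
    Ioo_mem_nhdsGT one_pos] with r h1 h2 hr
  refine lt_of_le_of_lt ?_ h2
  have hl : (q - 1) * Real.log r < 0 :=
    mul_neg_of_pos_of_neg (by linarith) (Real.log_neg hr.1 hr.2)
  have hp := Real.rpow_pos_of_pos hr.1 (s * (q - 1))
  have h3 := Real.log_le_log (by positivity) h1
  rw [Real.log_mul hK.ne' hp.ne', Real.log_rpow hr.1] at h3
  rw [div_le_iff_of_neg hl, add_mul, div_mul_cancel₀ _ hl.ne]
  linarith

theorem eventually_lt_log_div {f : ℝ → ℝ} (hq : 1 < q) {K t b : ℝ} (hK : 0 < K)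
    (hf : ∀ᶠ r in 𝓝[>] 0, 0 < f r) (h : ∀ᶠ r in 𝓝[>] 0, f r ≤ K * r ^ (t * (q - 1)))
    (hb : b < t) : ∀ᶠ r in 𝓝[>] 0, b < Real.log (f r) / ((q - 1) * Real.log r) := by
  filter_upwards [hf, h, (tendsto_add_div_log hq K t).eventually (lt_mem_nhds hb),
    Ioo_mem_nhdsGT one_pos] with r h0 h1 h2 hr
  refine lt_of_lt_of_le h2 ?_
  have hl : (q - 1) * Real.log r < 0 :=
    mul_neg_of_pos_of_neg (by linarith) (Real.log_neg hr.1 hr.2)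
  have hp := Real.rpow_pos_of_pos hr.1 (t * (q - 1))
  have h3 := Real.log_le_log h0 h1
  rw [Real.log_mul hK.ne' hp.ne', Real.log_rpow hr.1] at h3
  rw [le_div_iff_of_neg hl, add_mul, div_mul_cancel₀ _ hl.ne]
  linarith

theorem tendsto_log_momentSum (hN : 1 ≤ N) (hm : 1 ≤ m) (hT : NormBounds T lam c)
    (hp : ∀ i, 0 < p i) (hR : 0 ≤ R) (hω : ∀ w, ‖ω w‖ ≤ R) (hq : 1 < q) {d : ℝ} (hd : 0 < d)
    (hP : pressure T p q d = 0)
    (h : ∀ s t : ℝ, s ≤ N → pressure T p q s < 0 → 0 < t → t < s →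
      ∃ C : ℝ≥0∞, C ≠ ⊤ ∧ ∀ r, 0 < r → r ≤ 1 →
        localMoment T p R (q - 1) r ω ≤ C * ENNReal.ofReal (r ^ (t * (q - 1)))) :
    Tendsto (fun r : ℝ => Real.log (momentSum (projectedMeasure T (bernoulliMeasure p) ω) q r) /
      ((q - 1) * Real.log r)) (𝓝[>] 0) (𝓝 (min d N)) := by
  have hmono := pressure_strictMonoOn hN hm hT hp hq
  obtain ⟨K₀, hK₀, hle₀⟩ := exists_le_momentSum (p := p) hN hT hR hω hq
  have hpos : ∀ᶠ r in 𝓝[>] 0, 0 < momentSum (projectedMeasure T (bernoulliMeasure p) ω) q r := by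
    filter_upwards [hle₀, self_mem_nhdsWithin] with r hr hr0
    exact lt_of_lt_of_le (mul_pos hK₀ (Real.rpow_pos_of_pos hr0 _)) hr
  have hNpos : (0 : ℝ) < N := by exact_mod_cast hN
  refine tendsto_order.2 ⟨fun b hb => ?_, fun b hb => ?_⟩
  -- Exponents `max b 0 < t < s < min d N`: the pressure is negative at `s < d`, and the moment
  -- bound then holds with exponent `t`.
  · obtain ⟨t, ht1, ht2⟩ := exists_between (max_lt hb (lt_min hd hNpos))
    obtain ⟨s, hs1, hs2⟩ := exists_between ht2
    have ht0 : 0 < t := (le_max_right _ _).trans_lt ht1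
    have hPs : pressure T p q s < 0 := by
      rw [← hP]
      exact hmono (ht0.trans hs1) hd (hs2.trans_le (min_le_left _ _))
    obtain ⟨C, hC, hle⟩ := h s t (hs2.le.trans (min_le_right _ _)) hPs ht0 hs1
    obtain ⟨K, hK, hKle⟩ := exists_momentSum_le hN hT hR hω hq hC hle
    exact eventually_lt_log_div hq hK hpos hKle ((le_max_left _ _).trans_lt ht1)
  · rcases le_or_gt (N : ℝ) d with hNd | hdN
    · rw [min_eq_right hNd] at hb
      exact eventually_log_div_lt hq hK₀ hle₀ hb
    · rw [min_eq_left hdN.le] at hb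
      obtain ⟨s, hs1, hs2⟩ := exists_between (lt_min hb hdN)
      have hPs : 0 < pressure T p q s := by
        rw [← hP]
        exact hmono hd (hd.trans hs1) hs1
      obtain ⟨K, hK, hKle⟩ := exists_le_momentSum_of_pressure_pos hN hm hT hp hR hω hq
        (hd.trans hs1) (hs2.le.trans (min_le_right _ _)) hPs
      exact eventually_log_div_lt hq hK hKle (hs2.trans_le (min_le_left _ _))

theorem lowerDim_upperDim_eq {τ : Measure (E N)} {D : ℝ}
    (h : Tendsto (fun r : ℝ => Real.log (momentSum τ q r) / ((q - 1) * Real.log r))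
      (𝓝[>] 0) (𝓝 D)) :
    lowerDim q τ = (D : EReal) ∧ upperDim q τ = (D : EReal) := by
  have h' := (continuous_coe_real_ereal.tendsto D).comp h
  exact ⟨h'.liminf_eq, h'.limsup_eq⟩

theorem ae_displacementLaw_norm_le {ν : Measure (E N)} [IsProbabilityMeasure ν]
    (hνR : ∀ᵐ z ∂ν, ‖z‖ ≤ R) : ∀ᵐ ω ∂(displacementLaw m ν), ∀ w, ‖ω w‖ ≤ R := by
  rw [ae_all_iff]
  intro w
  exact (measurePreserving_eval_infinitePi (fun _ : List (Fin m) => ν) w).quasiMeasurePreserving.ae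
    hνR

end Dimension

end AlmostSelfAffine

/-! ### The theorem. -/

open AlmostSelfAffine in
theorem corollary8p3 {N m : ℕ} (hN : 1 ≤ N) (hm : 2 ≤ m)
    (T : Fin m → E N →L[ℝ] E N)
    (hT_inj : ∀ i, Function.Injective (T i))
    (hT_norm : ∀ i, ‖T i‖ < 1)
    (p : PMF (Fin m)) (hp : ∀ i, 0 < p i)
    (D : Set (E N)) (hD : Bornology.IsBounded D)
    (ν : Measure (E N)) [IsProbabilityMeasure ν]
    (hνD : ∀ᵐ x ∂ν, x ∈ D)
    (hν : ν ≪ volume) :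
    ∃ d : ℝ → ℝ,
      (∀ q : ℝ, 1 < q →
        IsCriticalExponent T (bernoulliMeasure p) q (d q) ∧
        ∀ s : ℝ, IsCriticalExponent T (bernoulliMeasure p) q s → s = d q) ∧
      ∀ᵐ ω ∂(displacementLaw m ν), ∀ q : ℝ, 1 < q →
        lowerDim q (projectedMeasure T (bernoulliMeasure p) ω) = ((min (d q) N : ℝ) : EReal) ∧
        upperDim q (projectedMeasure T (bernoulliMeasure p) ω) = ((min (d q) N : ℝ) : EReal) := by
  obtain ⟨lam, c, hT⟩ := exists_normBounds T hT_inj hT_norm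
  have hm1 : 1 ≤ m := by omega
  obtain ⟨R₀, hR₀⟩ := hD.subset_closedBall 0
  have hνR : ∀ᵐ z ∂ν, ‖z‖ ≤ max R₀ 0 := by
    filter_upwards [hνD] with z hz
    exact le_max_of_le_left (by simpa using hR₀ hz)
  have hR : 0 ≤ max R₀ 0 := le_max_right _ _
  -- The exponents are chosen before any `ω`, so `d` is deterministic; its value `0` for `q ≤ 1`
  -- plays no role.
  have hex : ∀ q : ℝ, ∃ d : ℝ, 1 < q → 0 < d ∧ pressure T p q d = 0 := fun q => by
    by_cases hq : 1 < q
    · obtain ⟨d, hd⟩ := exists_pressure_eq_zero hN hm hT hp hq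
      exact ⟨d, fun _ => hd⟩
    · exact ⟨0, fun h => absurd h hq⟩
  choose d hd using hex
  refine ⟨d, fun q hq => ⟨(isCriticalExponent_iff hN hm1 hT hp hq).2 (hd q hq), fun s hs => ?_⟩, ?_⟩
  · obtain ⟨hs0, hPs⟩ := (isCriticalExponent_iff hN hm1 hT hp hq).1 hs
    exact (pressure_strictMonoOn hN hm1 hT hp hq).injOn hs0 (hd q hq).1
      (hPs.trans (hd q hq).2.symm)
  · filter_upwards [ae_displacementLaw_norm_le (m := m) hνR,
      ae_forall_localMoment_le hN hm hT hp hR hν hνR] with ω hω hloc q hq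
    exact lowerDim_upperDim_eq (tendsto_log_momentSum hN hm1 hT hp hR hω hq (hd q hq).1
      (hd q hq).2 fun s t => hloc q s t hq)
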